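/- Let $N\ge 2$, let $R>0$ and let $B$ be the open ball of $\mathbb{R}^N$ of radius $R$ centered at the origin (in particular the centered unit ball, or the centered ball of unit volume). For $h\in W^{1,\infty}(\partial B)$, i.e. $h:\partial B\to\mathbb{R}$ Lipschitz, put $$B_h:=\{t\,x\,(1+h(x)) : t\in[0,1),\ x\in\partial B\}.$$ Let $|\cdot|$ denote Lebesgue measure, let $P(A):=\sup\{\int_A \operatorname{div}\varphi : \varphi\in C^1_c(\mathbb{R}^N;\mathbb{R}^N),\ |\varphi|\le 1\}$ be the (De Giorgi) perimeter, and, for an open set $\Omega$, let $$\lambda_1(\Omega):=\inf\Big\{\frac{\int_\Omega|\nabla u|^2}{\int_\Omega u^2} : u\in H^1_0(\Omega)\setminus\{0\}\Big\}$$ be the first Dirichlet eigenvalue. With $\nabla_\tau h$ the tangential gradient of $h$ on $\partial B$, write $\|h\|_{H^1(\partial B)}^2=\int_{\partial B}h^2+\int_{\partial B}|\nabla_\tau h|^2$ and $\|h\|_{W^{1,\infty}(\partial B)}=\|h\|_{L^\infty(\partial B)}+\|\nabla_\tau h\|_{L^\infty(\partial B)}$. (i) There exists $C>0$, depending only on $N$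 and $R$, such that for every $h\in W^{1,\infty}(\partial B)$ with $|B_h|=|B|$ and $\|h\|_{L^\infty(\partial B)}\le 1/2$, $$\lambda_1(B_h)-\lambda_1(B)\le C\,\|h\|_{H^1(\partial B)}^2 .$$ (ii) There exist $\eta>0$ and $\varepsilon_0>0$, depending only on $N$ and $R$, such that for every $h\in W^{1,\infty}(\partial B)$ with $\|h\|_{W^{1,\infty}(\partial B)}\le\eta$, $|B_h|=|B|$ and the barycenter of $B_h$ at the origin, and for every $\varepsilon\in(0,\varepsilon_0)$, $$P(B_h)-\varepsilon\lambda_1(B_h)\ \ge\ P(B)-\varepsilon\lambda_1(B),$$ with equality only if $B_h=B$. -/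

import Mathlib

open MeasureTheory Filter Topology Set
open scoped ENNReal NNReal ContDiff

noncomputable section

namespace BallStability

/-- The surface measure (with its standard normalization) of the sphere of radius `R` centred at
the origin of `ℝ^N`, as a measure on `ℝ^N`: the push-forward of the surface measure of the unit
sphere under `θ ↦ R θ`, multiplied by `R^(N-1)`. -/
def sphereMeasure (N : ℕ) (R : ℝ) : Measure (EuclideanSpace ℝ (Fin N)) :=
  ENNReal.ofReal (R ^ (N - 1)) •
    ((volume : Measure (EuclideanSpace ℝ (Fin N))).toSphere).map
      (fun θ : Metric.sphere (0 : EuclideanSpace ℝ (Fin N)) 1 => R • (θ : EuclideanSpace ℝ (Fin N)))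

variable {N : ℕ}

/-- `h` belongs to `W^{1,∞}` of the sphere of radius `R`. Elements of this space are represented
by their Lipschitz representative, which is the one through which the domain `B_h` is defined.
Only the values of `h` on the sphere matter. -/
def MemW1Inf (R : ℝ) (h : EuclideanSpace ℝ (Fin N) → ℝ) : Prop :=
  ∃ K : ℝ≥0, LipschitzOnWith K h (Metric.sphere 0 R)

/-- The extension of a function on the sphere of radius `R` that is constant on the open
half-lines issued from the origin. -/
def radialExtension (R : ℝ) (h : EuclideanSpace ℝ (Fin N) → ℝ) :
    EuclideanSpace ℝ (Fin N) → ℝ :=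
  fun x => h ((R / ‖x‖) • x)

/-- The tangential gradient on the sphere of radius `R`: at a point of the sphere, the gradient of
the extension that is constant along normals. For a Lipschitz function it exists almost
everywhere on the sphere. -/
def tangentialGradient (R : ℝ) (h : EuclideanSpace ℝ (Fin N) → ℝ)
    (x : EuclideanSpace ℝ (Fin N)) : EuclideanSpace ℝ (Fin N) :=
  gradient (radialExtension R h) x

/-- The `L^∞` norm on the sphere of radius `R`. -/
def normLInf (R : ℝ) (h : EuclideanSpace ℝ (Fin N) → ℝ) : ℝ≥0∞ :=
  eLpNorm h ∞ (sphereMeasure N R)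

/-- The `W^{1,∞}` norm on the sphere of radius `R`. -/
def normW1Inf (R : ℝ) (h : EuclideanSpace ℝ (Fin N) → ℝ) : ℝ≥0∞ :=
  normLInf R h + eLpNorm (tangentialGradient R h) ∞ (sphereMeasure N R)

/-- The `H^1` norm on the sphere of radius `R`. -/
def normH1 (R : ℝ) (h : EuclideanSpace ℝ (Fin N) → ℝ) : ℝ :=
  Real.sqrt ((∫ x, (h x) ^ 2 ∂(sphereMeasure N R)) +
    ∫ x, ‖tangentialGradient R h x‖ ^ 2 ∂(sphereMeasure N R))

/-- The domain `B_h = {t x (1 + h x) : t ∈ [0,1), x ∈ ∂B}`, with `B` the ball of radius `R`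
centred at the origin. -/
def perturbedBall (R : ℝ) (h : EuclideanSpace ℝ (Fin N) → ℝ) : Set (EuclideanSpace ℝ (Fin N)) :=
  {y | ∃ t ∈ Ico (0 : ℝ) 1, ∃ x ∈ Metric.sphere (0 : EuclideanSpace ℝ (Fin N)) R,
    y = (t * (1 + h x)) • x}

/-- The barycenter of a set. -/
def barycenter (A : Set (EuclideanSpace ℝ (Fin N))) : EuclideanSpace ℝ (Fin N) :=
  ⨍ x in A, x

/-- The divergence of a vector field. -/
def divergence (φ : EuclideanSpace ℝ (Fin N) → EuclideanSpace ℝ (Fin N))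
    (x : EuclideanSpace ℝ (Fin N)) : ℝ :=
  ∑ i, (fderiv ℝ φ x (EuclideanSpace.single i 1)) i

/-- The perimeter in the sense of De Giorgi:
`P(A) = sup {∫_A div φ : φ ∈ C^1_c(ℝ^N; ℝ^N), |φ| ≤ 1}`. -/
def perimeter (A : Set (EuclideanSpace ℝ (Fin N))) : ℝ≥0∞ :=
  ⨆ (φ : EuclideanSpace ℝ (Fin N) → EuclideanSpace ℝ (Fin N)) (_ : ContDiff ℝ 1 φ)
    (_ : HasCompactSupport φ) (_ : ∀ x, ‖φ x‖ ≤ 1),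
    ENNReal.ofReal (∫ x in A, divergence φ x)

/-- `u` (extended by zero outside `Ω`) belongs to `H^1_0(Ω)` and has weak gradient `g`: the pair
`(u, g)` is the limit in `L^2` of pairs `(φ, ∇φ)` with `φ ∈ C^∞_c(Ω)`. -/
def MemH10 (Ω : Set (EuclideanSpace ℝ (Fin N))) (u : EuclideanSpace ℝ (Fin N) → ℝ)
    (g : EuclideanSpace ℝ (Fin N) → EuclideanSpace ℝ (Fin N)) : Prop :=
  MemLp u 2 volume ∧ MemLp g 2 volume ∧
    ∃ φ : ℕ → EuclideanSpace ℝ (Fin N) → ℝ,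
      (∀ n, ContDiff ℝ ∞ (φ n) ∧ HasCompactSupport (φ n) ∧ tsupport (φ n) ⊆ Ω) ∧
      Tendsto (fun n => eLpNorm (φ n - u) 2 volume) atTop (𝓝 0) ∧
      Tendsto (fun n => eLpNorm (gradient (φ n) - g) 2 volume) atTop (𝓝 0)

/-- The first Dirichlet eigenvalue of an open set `Ω`: the infimum of the Rayleigh quotient
`∫_Ω |∇u|² / ∫_Ω u²` over the nonzero elements `u` of `H^1_0(Ω)`. -/
def lambda1 (Ω : Set (EuclideanSpace ℝ (Fin N))) : ℝ :=
  sInf {q : ℝ | ∃ (u : EuclideanSpace ℝ (Fin N) → ℝ)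
    (g : EuclideanSpace ℝ (Fin N) → EuclideanSpace ℝ (Fin N)),
    MemH10 Ω u g ∧ ¬ (u =ᵐ[volume] 0) ∧
      q = (∫ x in Ω, ‖g x‖ ^ 2) / (∫ x in Ω, (u x) ^ 2)}

/-- The functional `P - ε λ₁`, with values in the extended reals because the perimeter of a set
may be infinite. -/
def energy (ε : ℝ) (Ω : Set (EuclideanSpace ℝ (Fin N))) : EReal :=
  (perimeter Ω : EReal) - ((ε * lambda1 Ω : ℝ) : EReal)

end BallStability

end

noncomputable section

namespace BallStability

local notation "𝔼" N => EuclideanSpace ℝ (Fin N)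

local notation "ℙ" N => MvPolynomial (Fin N) ℝ

/-! Extend `h` to a function `f` constant on rays and set `gauge f x = ‖x‖ / (1 + f x)`, so that
`B_h` is the sublevel set `{gauge f < R}` and the spheres `‖x‖ = t` correspond to the level sets of
a 1-homogeneous Lipschitz function `s`. On each ray the substitution `t ↦ t / s(θ)` splits integrals
of `F(s) G`, with `G` constant on rays, into `∫ G s⁻ᴺ` over the unit sphere times `∫ tᴺ⁻¹ F(t)`
(`integral_comp_gauge`). Volume, perimeter and Rayleigh quotients all reduce to spherical integrals
in this way.

Eigenvalue: no eigenfunction of the ball is needed. For a test function `φ` of the ball and a unit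
vector `ξ`, the function `x ↦ φ(s(x) ξ)` is admissible in `B_h`. Averaging the resulting inequality
over `ξ` rebuilds `∫ φ²` and bounds the radial derivatives by `∫ |∇φ|²`, whence `λ₁(B_h) m ≤ A
λ₁(B)` with `m = ∫ (1+f)ᴺ` and `A` any positive upper bound of `∫ |∇s|² s⁻ᴺ = ∫ ((1+f)ᴺ⁻² + (1+f)ᴺ⁻⁴
|∇f|²)` (`lambda1_mul_le_of_profile`). The volume constraint makes `m` the area of the unit sphere,
and convexity bounds `∫ (1+f)ᴺ⁻²` by `m`; only a multiple of `∫ |∇f|²` remains.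

Perimeter: testing with smooth fields close to `∇s / |∇s|` gives `P(B_h) ≥ Rᴺ⁻¹ ∫ |∇s| s⁻ᴺ`
(`ofReal_area_le_perimeter`), while `P(B) ≤ Rᴺ⁻¹ m` is direct. The integrand is then expanded to
second order as in Fuglede's argument, giving `m - (3/4)(N-1) ∫ f² + (3/8) ∫ |∇f|²` as a lower
bound. The volume and barycenter constraints make the moments of `f` of degree 0 and 1 quadratically
small, so the second spectral gap `2N` of the sphere applies up to a small loss, and the form is
coercive in `H¹` (`le_integral_norm_gradient_gauge`). For small `ε` this gain beats the eigenvalue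
bound.

Spectral gap: on polynomials, minus the Laplace-Beltrami operator is symmetric by Green's formula
and, for the filtration by degree, acts on the top degree `k` as the scalar `k (k + N - 2)`.
Induction on the degree gives the gap (`sphLap_gap`), without harmonic decomposition, and
Stone-Weierstrass passes to Lipschitz functions (`poincare_sphere`). -/

/-- The surface measure of the unit sphere. -/
abbrev surface (N : ℕ) : Measure (Metric.sphere (0 : 𝔼 N) 1) :=
  (volume : Measure (𝔼 N)).toSphere

variable {N : ℕ}

/-! ### Polar coordinates and integrals of functions of a gauge -/

section Polar

theorem integral_volumeIoiPow (n : ℕ) (F : ℝ → ℝ) :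
    ∫ r : Ioi (0 : ℝ), F r ∂(Measure.volumeIoiPow n) = ∫ t in Ioi (0 : ℝ), t ^ n * F t := by
  simp only [Measure.volumeIoiPow, ENNReal.ofReal]
  rw [integral_withDensity_eq_integral_smul,
    integral_subtype_comap measurableSet_Ioi fun a ↦ Real.toNNReal (a ^ n) • F a,
    setIntegral_congr_fun measurableSet_Ioi fun x hx ↦ ?_]
  · rw [NNReal.smul_def, Real.coe_toNNReal _ (pow_nonneg hx.out.le _), smul_eq_mul]
  · exact (measurable_subtype_coe.pow_const _).real_toNNReal

/-- The inverse of the polar coordinates on the complement of the origin. -/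
def polarEquiv (N : ℕ) :
    Metric.sphere (0 : 𝔼 N) 1 × Ioi (0 : ℝ) ≃ᵐ ({0}ᶜ : Set (𝔼 N)) :=
  (homeomorphUnitSphereProd (𝔼 N)).symm.toMeasurableEquiv

theorem measurePreserving_polarEquiv : MeasurePreserving (polarEquiv N)
    ((surface N).prod (Measure.volumeIoiPow (N - 1)))
    ((volume : Measure (𝔼 N)).comap Subtype.val) := by
  have h := (volume : Measure (𝔼 N)).measurePreserving_homeomorphUnitSphereProd
  rw [finrank_euclideanSpace_fin] at h
  exact MeasurePreserving.symm (homeomorphUnitSphereProd (𝔼 N)).toMeasurableEquiv h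

/-- By Fubini, almost every ray carries the property at almost all of its points, hence at one point
because the radial measure is nonzero; homogeneity moves it to the sphere. This is how Rademacher's
theorem reaches the sphere, itself a null set. -/
theorem ae_sphere_of_ae {p : (𝔼 N) → Prop} (hp : ∀ᵐ x, p x)
    (hom : ∀ (r : ℝ) (x : 𝔼 N), 0 < r → p (r • x) → p x) :
    ∀ᵐ θ : Metric.sphere (0 : 𝔼 N) 1 ∂(surface N), p (θ : 𝔼 N) := by
  have h2 : ∀ᵐ x : ({0}ᶜ : Set (𝔼 N)) ∂((volume : Measure (𝔼 N)).comap (Subtype.val : ({0}ᶜ : Set (𝔼 N)) → 𝔼 N)),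
      p (x : 𝔼 N) := by
    have := (ae_restrict_of_ae (s := ({0}ᶜ : Set (𝔼 N))) hp)
    rw [← map_comap_subtype_coe (measurableSet_singleton (0 : 𝔼 N)).compl] at this
    exact ae_of_ae_map measurable_subtype_coe.aemeasurable this
  have h3 := measurePreserving_polarEquiv.quasiMeasurePreserving.ae h2
  have h4 := Measure.ae_ae_of_ae_prod h3
  have : NeBot (ae (Measure.volumeIoiPow (N - 1))) := by
    rw [ae_neBot]
    intro h0
    have := Measure.volumeIoiPow_apply_Iio (N - 1) ⟨1, mem_Ioi.2 one_pos⟩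
    rw [h0] at this
    simp at this
    have h5 : (0 : ℝ) < ((N - 1 : ℕ) : ℝ) + 1 := by positivity
    linarith
  filter_upwards [h4] with θ hθ
  obtain ⟨r, hr⟩ := hθ.exists
  exact hom r θ r.2 hr

variable [NeZero N]

theorem integrable_polar_iff (f : (𝔼 N) → ℝ) :
    Integrable f ↔ Integrable (fun p : Metric.sphere (0 : 𝔼 N) 1 × Ioi (0 : ℝ) =>
      f ((p.2 : ℝ) • (p.1 : 𝔼 N))) ((surface N).prod (Measure.volumeIoiPow (N - 1))) := by
  have := measurePreserving_polarEquiv.integrable_comp_emb (g := fun x => f x)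
    (polarEquiv N).measurableEmbedding
  rw [← restrict_compl_singleton (μ := (volume : Measure (𝔼 N))) 0, ← IntegrableOn,
    integrableOn_iff_comap_subtypeVal (by measurability)]
  exact this.symm

theorem integral_polar_prod (f : (𝔼 N) → ℝ) :
    ∫ x, f x = ∫ p : Metric.sphere (0 : 𝔼 N) 1 × Ioi (0 : ℝ),
      f ((p.2 : ℝ) • (p.1 : 𝔼 N)) ∂((surface N).prod (Measure.volumeIoiPow (N - 1))) := by
  have := measurePreserving_polarEquiv.integral_comp
    (polarEquiv N).measurableEmbedding (fun x => f x)
  rw [← restrict_compl_singleton (μ := (volume : Measure (𝔼 N))) 0,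
    ← integral_subtype_comap (measurableSet_singleton _).compl f]
  exact this.symm

theorem integral_polar {f : (𝔼 N) → ℝ} (hf : Integrable f) :
    ∫ x, f x = ∫ θ, (∫ t in Ioi (0 : ℝ), t ^ (N - 1) * f (t • (θ : 𝔼 N))) ∂(surface N) := by
  rw [integral_polar_prod, integral_prod _ ((integrable_polar_iff f).1 hf)]
  refine integral_congr_ae (Eventually.of_forall fun θ => ?_)
  exact integral_volumeIoiPow (N - 1) (fun t => f (t • (θ : 𝔼 N)))

theorem integrable_radial_integral {f : (𝔼 N) → ℝ} (hf : Integrable f) :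
    Integrable (fun θ : Metric.sphere (0 : 𝔼 N) 1 =>
      ∫ t in Ioi (0 : ℝ), t ^ (N - 1) * f (t • (θ : 𝔼 N))) (surface N) := by
  have := ((integrable_polar_iff f).1 hf).integral_prod_left
  refine this.congr (Eventually.of_forall fun θ => ?_)
  exact integral_volumeIoiPow (N - 1) (fun t => f (t • (θ : 𝔼 N)))

/-- On the ray through `θ` one has `s(tθ) = t s(θ)`; the substitution `t ↦ t / s(θ)` produces the
factor `s(θ)⁻ᴺ` and separates the variables. -/
theorem integral_comp_gauge {s G : (𝔼 N) → ℝ} {F : ℝ → ℝ}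
    (hs : ∀ (r : ℝ) (x : 𝔼 N), 0 < r → s (r • x) = r * s x) (hs0 : ∀ x, x ≠ 0 → 0 < s x)
    (hG : ∀ (r : ℝ) (x : 𝔼 N), 0 < r → G (r • x) = G x)
    (hi : Integrable (fun x => F (s x) * G x)) :
    ∫ x, F (s x) * G x = (∫ θ, G (θ : 𝔼 N) * (s (θ : 𝔼 N) ^ N)⁻¹ ∂(surface N)) *
      ∫ t in Ioi (0 : ℝ), t ^ (N - 1) * F t := by
  rw [integral_polar hi, ← integral_mul_const]
  refine integral_congr_ae (Eventually.of_forall fun θ => ?_)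
  have hθ : 0 < s (θ : 𝔼 N) := hs0 _ (Metric.ne_of_mem_sphere θ.2 one_ne_zero)
  have h1 := integral_comp_mul_right_Ioi (fun t => t ^ (N - 1) * F t) 0 hθ
  rw [zero_mul, smul_eq_mul] at h1
  have hN : N = N - 1 + 1 := by have := NeZero.pos N; omega
  have h2 : (∫ t in Ioi (0 : ℝ), t ^ (N - 1) * (F (s (t • (θ : 𝔼 N))) * G (t • (θ : 𝔼 N))))
      = (G (θ : 𝔼 N) * (s (θ : 𝔼 N) ^ (N - 1))⁻¹) *
        ∫ t in Ioi (0 : ℝ), (t * s (θ : 𝔼 N)) ^ (N - 1) * F (t * s (θ : 𝔼 N)) := by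
    rw [← integral_const_mul]
    refine setIntegral_congr_fun measurableSet_Ioi fun t ht => ?_
    have ht' : 0 < t := ht
    simp only [hs _ _ ht', hG _ _ ht', mul_pow]
    field_simp
  have h3 : s (θ : 𝔼 N) ^ N = s (θ : 𝔼 N) ^ (N - 1) * s (θ : 𝔼 N) := by
    rw [← pow_succ, ← hN]
  simp only
  rw [h2, h1, h3]
  field_simp

end Polar

/-! ### Functions constant on rays and the gauge they define -/

section Homogeneous

theorem norm_gradient (f : (𝔼 N) → ℝ) (x : 𝔼 N) : ‖gradient f x‖ = ‖fderiv ℝ f x‖ := by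
  simp [gradient]

theorem measurable_gradient (f : (𝔼 N) → ℝ) : Measurable (gradient f) :=
  (InnerProductSpace.toDual ℝ (𝔼 N)).symm.continuous.measurable.comp (measurable_fderiv ℝ f)

/-- The derivative rules for `f (r • ·)` and `c • f` hold without differentiability, the derivative
being 0 by convention where it does not exist. -/
theorem gradient_smul_of_homogeneous {f : (𝔼 N) → ℝ} {r c : ℝ} (hr : r ≠ 0)
    (hf : ∀ x, f (r • x) = c * f x) (x : 𝔼 N) :
    gradient f (r • x) = (c / r) • gradient f x := by
  have h1 : fderiv ℝ (fun y => f (r • y)) x = r • fderiv ℝ f (r • x) := fderiv_comp_smul r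
  have h2 : fderiv ℝ (fun y => f (r • y)) x = c • fderiv ℝ f x := by
    have : (fun y => f (r • y)) = c • f := by ext y; simp [hf]
    rw [this, fderiv_const_smul_field]
    rfl
  have h3 : fderiv ℝ f (r • x) = (c / r) • fderiv ℝ f x := by
    rw [div_eq_inv_mul, mul_smul, ← h2, h1, smul_smul, inv_mul_cancel₀ hr, one_smul]
  simp [gradient, h3]

/-- A function on the punctured space that is constant on rays and Lipschitz on the unit sphere. -/
structure IsProfile (f : (𝔼 N) → ℝ) : Prop where
  hom : ∀ (r : ℝ) (x : 𝔼 N), 0 < r → f (r • x) = f x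
  lip : ∃ K : ℝ≥0, LipschitzOnWith K f (Metric.sphere 0 1)

/-- After scaling by `‖x‖`, the second unit vector becomes a multiple of `y` of length `‖x‖`, which
is within `|‖x‖ - ‖y‖|` of `y`. -/
theorem mul_norm_normalize_sub_le {x y : 𝔼 N} (hx : x ≠ 0) (hy : y ≠ 0) :
    ‖x‖ * ‖‖x‖⁻¹ • x - ‖y‖⁻¹ • y‖ ≤ 2 * ‖x - y‖ := by
  have hx' := norm_pos_iff.2 hx
  have hy' := norm_pos_iff.2 hy
  have h1 : ‖x‖ * ‖‖x‖⁻¹ • x - ‖y‖⁻¹ • y‖ = ‖x - (‖x‖ * ‖y‖⁻¹) • y‖ := by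
    rw [← norm_norm x, ← norm_smul, norm_norm, smul_sub, smul_smul, smul_smul,
      mul_inv_cancel₀ hx'.ne', one_smul]
  have h2 : ‖y - (‖x‖ * ‖y‖⁻¹) • y‖ ≤ ‖x - y‖ := by
    have : y - (‖x‖ * ‖y‖⁻¹) • y = ((‖y‖ - ‖x‖) * ‖y‖⁻¹) • y := by
      rw [sub_mul, mul_inv_cancel₀ hy'.ne', sub_smul, one_smul]
    rw [this, norm_smul, norm_mul, norm_inv, norm_norm, inv_mul_cancel_right₀ hy'.ne',
      Real.norm_eq_abs, norm_sub_rev x y]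
    exact abs_norm_sub_norm_le y x
  calc _ = ‖(x - y) + (y - (‖x‖ * ‖y‖⁻¹) • y)‖ := by rw [h1]; congr 1; abel
    _ ≤ ‖x - y‖ + ‖y - (‖x‖ * ‖y‖⁻¹) • y‖ := norm_add_le _ _
    _ ≤ _ := by linarith

theorem normalize_mem_sphere {x : 𝔼 N} (hx : x ≠ 0) : ‖x‖⁻¹ • x ∈ Metric.sphere (0 : 𝔼 N) 1 := by
  simp [norm_smul, hx]

namespace IsProfile

variable {f : (𝔼 N) → ℝ}

theorem apply_normalize (hf : IsProfile f) {x : 𝔼 N} (hx : x ≠ 0) : f (‖x‖⁻¹ • x) = f x :=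
  hf.hom _ _ (inv_pos.2 (norm_pos_iff.2 hx))

/-- The factor `‖x‖` makes the estimate scale invariant. It yields Lipschitz bounds away from the
origin and, in the gauge, compensates the blow-up of the slope of `f` at the origin. -/
theorem abs_sub_le (hf : IsProfile f) : ∃ K : ℝ≥0, ∀ x y : 𝔼 N, x ≠ 0 → y ≠ 0 →
    ‖x‖ * |f x - f y| ≤ K * ‖x - y‖ := by
  obtain ⟨K, hK⟩ := hf.lip
  refine ⟨2 * K, fun x y hx hy => ?_⟩
  have h1 := hK.dist_le_mul _ (normalize_mem_sphere hx) _ (normalize_mem_sphere hy)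
  rw [hf.apply_normalize hx, hf.apply_normalize hy, Real.dist_eq, dist_eq_norm] at h1
  calc ‖x‖ * |f x - f y| ≤ ‖x‖ * (K * ‖‖x‖⁻¹ • x - ‖y‖⁻¹ • y‖) := by gcongr
    _ = K * (‖x‖ * ‖‖x‖⁻¹ • x - ‖y‖⁻¹ • y‖) := by ring
    _ ≤ K * (2 * ‖x - y‖) :=
      mul_le_mul_of_nonneg_left (mul_norm_normalize_sub_le hx hy) K.coe_nonneg
    _ = _ := by push_cast; ring

theorem lipschitzOnWith (hf : IsProfile f) {δ : ℝ} (hδ : 0 < δ) :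
    ∃ K : ℝ≥0, LipschitzOnWith K f {x | δ ≤ ‖x‖} := by
  obtain ⟨K, hK⟩ := hf.abs_sub_le
  refine ⟨K * ⟨δ⁻¹, (inv_pos.2 hδ).le⟩, LipschitzOnWith.of_dist_le_mul fun x hx y hy => ?_⟩
  have hx0 : x ≠ 0 := norm_pos_iff.1 (hδ.trans_le hx)
  have hy0 : y ≠ 0 := norm_pos_iff.1 (hδ.trans_le hy)
  rw [Real.dist_eq, dist_eq_norm]
  have h1 := hK x y hx0 hy0
  have h2 : δ * |f x - f y| ≤ K * ‖x - y‖ :=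
    (mul_le_mul_of_nonneg_right hx (abs_nonneg _)).trans h1
  rw [← le_div_iff₀' hδ] at h2
  refine h2.trans (le_of_eq ?_)
  change _ = (K : ℝ) * δ⁻¹ * ‖x - y‖
  rw [div_eq_mul_inv]
  ring

/-- Rademacher's theorem and integration by parts are stated for globally Lipschitz functions; they
are applied to `f` through such extensions, off a ball about the origin. -/
theorem exists_lipschitz_extension (hf : IsProfile f) {δ : ℝ} (hδ : 0 < δ) :
    ∃ (K : ℝ≥0) (w : (𝔼 N) → ℝ), LipschitzWith K w ∧ ∀ x, δ ≤ ‖x‖ → f x = w x := by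
  obtain ⟨K, hK⟩ := hf.lipschitzOnWith hδ
  obtain ⟨w, hw, h⟩ := hK.extend_real
  exact ⟨K, w, hw, fun x hx => h hx⟩

theorem isOpen_lt_norm (δ : ℝ) : IsOpen {x : 𝔼 N | δ < ‖x‖} :=
  isOpen_lt continuous_const continuous_norm

theorem continuousAt (hf : IsProfile f) {x : 𝔼 N} (hx : x ≠ 0) : ContinuousAt f x := by
  have h0 : 0 < ‖x‖ / 2 := half_pos (norm_pos_iff.2 hx)
  obtain ⟨K, hK⟩ := hf.lipschitzOnWith h0
  refine (hK.continuousOn).continuousAt ?_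
  have : {y : 𝔼 N | ‖x‖ / 2 < ‖y‖} ∈ 𝓝 x :=
    (isOpen_lt_norm _).mem_nhds (by simp only [Set.mem_ofPred_eq]; linarith)
  exact Filter.mem_of_superset this fun y (hy : _ < ‖y‖) => by exact hy.le

theorem continuous_sphere (hf : IsProfile f) :
    Continuous (fun θ : Metric.sphere (0 : 𝔼 N) 1 => f θ) := by
  rw [continuous_iff_continuousAt]
  intro θ
  exact (hf.continuousAt (Metric.ne_of_mem_sphere θ.2 one_ne_zero)).comp
    continuous_subtype_val.continuousAt

theorem ae_differentiableAt (hf : IsProfile f) :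
    ∀ᵐ θ : Metric.sphere (0 : 𝔼 N) 1 ∂(surface N), DifferentiableAt ℝ f (θ : 𝔼 N) := by
  have key : ∀ (r : ℝ) (x : 𝔼 N), 0 < r → DifferentiableAt ℝ f (r • x) →
      DifferentiableAt ℝ f x := by
    intro r x hr h
    have : (fun y => f (r • y)) = f := funext fun y => hf.hom r y hr
    rw [← this]
    exact h.comp x (differentiableAt_id.const_smul r)
  have h4 : ∀ᵐ x : 𝔼 N, x ≠ 0 → DifferentiableAt ℝ f x := by
    have h5 : ∀ n : ℕ, ∀ᵐ x : 𝔼 N, ((n : ℝ) + 1)⁻¹ < ‖x‖ → DifferentiableAt ℝ f x := by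
      intro n
      have hn : (0 : ℝ) < (n : ℝ) + 1 := by positivity
      obtain ⟨K, w, hw, hfw⟩ := hf.exists_lipschitz_extension (inv_pos.2 hn)
      filter_upwards [hw.ae_differentiableAt] with x hx hx1
      refine hx.congr_of_eventuallyEq ?_
      filter_upwards [(isOpen_lt_norm _).mem_nhds hx1] with y hy
      exact hfw y (le_of_lt hy)
    filter_upwards [ae_all_iff.2 h5] with x hx hx0
    obtain ⟨n, hn⟩ := exists_nat_one_div_lt (norm_pos_iff.2 hx0)
    exact hx n (by rwa [← one_div])
  have h6 := ae_sphere_of_ae (p := fun x => x ≠ 0 → DifferentiableAt ℝ f x) h4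
    (fun r x hr h hx => key r x hr (h (smul_ne_zero hr.ne' hx)))
  filter_upwards [h6] with θ hθ
  exact hθ (Metric.ne_of_mem_sphere θ.2 one_ne_zero)

theorem gradient_smul (hf : IsProfile f) {r : ℝ} (hr : 0 < r) (x : 𝔼 N) :
    gradient f (r • x) = r⁻¹ • gradient f x := by
  rw [gradient_smul_of_homogeneous hr.ne' (c := 1) (fun y => by rw [hf.hom r y hr, one_mul]),
    one_div]

/-- The derivative along a ray vanishes since `f` is constant there; where `f` is not differentiable
its gradient is 0 by convention. -/
theorem inner_gradient (hf : IsProfile f) (x : 𝔼 N) : inner ℝ x (gradient f x) = 0 := by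
  by_cases hd : DifferentiableAt ℝ f x
  · have h1 : HasDerivAt (fun t : ℝ => f ((1 + t) • x)) (fderiv ℝ f x x) 0 := by
      have h2 : HasDerivAt (fun t : ℝ => (1 + t) • x) x 0 := by
        simpa using ((hasDerivAt_id (0 : ℝ)).const_add 1).smul_const x
      have h3 : HasFDerivAt f (fderiv ℝ f x) ((1 + (0 : ℝ)) • x) := by
        simpa using hd.hasFDerivAt
      exact h3.comp_hasDerivAt 0 h2
    have h4 : HasDerivAt (fun t : ℝ => f ((1 + t) • x)) 0 0 := by
      refine (hasDerivAt_const (0 : ℝ) (f x)).congr_of_eventuallyEq ?_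
      filter_upwards [Ioi_mem_nhds (show (-1 : ℝ) < 0 by norm_num)] with t ht
      exact hf.hom _ _ (by have : -1 < t := ht; linarith)
    rw [real_inner_comm, inner_gradient_left]
    exact h1.unique h4
  · rw [gradient_eq_zero_of_not_differentiableAt hd, inner_zero_right]

theorem exists_norm_gradient_le (hf : IsProfile f) :
    ∃ K : ℝ, ∀ θ : Metric.sphere (0 : 𝔼 N) 1, ‖gradient f (θ : 𝔼 N)‖ ≤ K := by
  obtain ⟨K, hK⟩ := hf.lipschitzOnWith (δ := 1 / 2) (by norm_num)
  refine ⟨K, fun θ => ?_⟩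
  rw [norm_gradient]
  refine norm_fderiv_le_of_lipschitzOn ℝ ?_ hK
  have : {y : 𝔼 N | 1 / 2 < ‖y‖} ∈ 𝓝 (θ : 𝔼 N) := by
    refine (isOpen_lt_norm _).mem_nhds ?_
    simp only [Set.mem_ofPred_eq, norm_eq_of_mem_sphere]
    norm_num
  exact Filter.mem_of_superset this fun y (hy : _ < ‖y‖) => by exact hy.le

theorem integrable_norm_gradient_sq (hf : IsProfile f) :
    Integrable (fun θ : Metric.sphere (0 : 𝔼 N) 1 => ‖gradient f (θ : 𝔼 N)‖ ^ 2) (surface N) := by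
  obtain ⟨K, hK⟩ := hf.exists_norm_gradient_le
  refine Integrable.of_bound (C := K ^ 2) ?_ (Eventually.of_forall fun θ => ?_)
  · exact (((measurable_gradient f).comp measurable_subtype_coe).norm.pow_const
      2).aestronglyMeasurable
  · rw [Real.norm_of_nonneg (by positivity)]
    gcongr
    exact hK θ

end IsProfile

theorem integrable_sphere_of_continuous {F : Metric.sphere (0 : 𝔼 N) 1 → ℝ} (hF : Continuous F) :
    Integrable F (surface N) :=
  hF.integrable_of_hasCompactSupport (HasCompactSupport.of_compactSpace F)

/-- The gauge of the domain `{x | ‖x‖ < 1 + f x}`. -/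
def gauge (f : (𝔼 N) → ℝ) (x : 𝔼 N) : ℝ := ‖x‖ / (1 + f x)

section Gauge

variable {f : (𝔼 N) → ℝ}

theorem gauge_zero : gauge f (0 : 𝔼 N) = 0 := by simp [gauge]

theorem gauge_smul (hf : IsProfile f) (r : ℝ) (x : 𝔼 N) (hr : 0 < r) :
    gauge f (r • x) = r * gauge f x := by
  rw [gauge, gauge, hf.hom r x hr, norm_smul, Real.norm_of_nonneg hr.le, mul_div_assoc]

theorem one_add_pos (hb : ∀ x : 𝔼 N, x ≠ 0 → |f x| ≤ 1 / 2) {x : 𝔼 N} (hx : x ≠ 0) :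
    0 < 1 + f x := by
  have := (abs_le.1 (hb x hx)).1; linarith

theorem gauge_pos (hb : ∀ x : 𝔼 N, x ≠ 0 → |f x| ≤ 1 / 2) (x : 𝔼 N) (hx : x ≠ 0) :
    0 < gauge f x :=
  div_pos (norm_pos_iff.2 hx) (one_add_pos hb hx)

theorem gauge_nonneg (hb : ∀ x : 𝔼 N, x ≠ 0 → |f x| ≤ 1 / 2) (x : 𝔼 N) : 0 ≤ gauge f x := by
  rcases eq_or_ne x 0 with rfl | hx
  · rw [gauge_zero]
  · exact (gauge_pos hb x hx).le

theorem le_gauge (hb : ∀ x : 𝔼 N, x ≠ 0 → |f x| ≤ 1 / 2) (x : 𝔼 N) :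
    ‖x‖ / 2 ≤ gauge f x := by
  rcases eq_or_ne x 0 with rfl | hx
  · simp [gauge_zero]
  · have h1 := one_add_pos hb hx
    have h2 := (abs_le.1 (hb x hx)).2
    rw [gauge]
    gcongr
    linarith

theorem gauge_le (hb : ∀ x : 𝔼 N, x ≠ 0 → |f x| ≤ 1 / 2) (x : 𝔼 N) :
    gauge f x ≤ 2 * ‖x‖ := by
  rcases eq_or_ne x 0 with rfl | hx
  · simp [gauge_zero]
  · have h1 := one_add_pos hb hx
    have h2 := (abs_le.1 (hb x hx)).1
    rw [gauge, div_le_iff₀ h1]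
    nlinarith [norm_nonneg x]

theorem exists_lipschitzWith_gauge (hf : IsProfile f) (hb : ∀ x : 𝔼 N, x ≠ 0 → |f x| ≤ 1 / 2) :
    ∃ K : ℝ≥0, LipschitzWith K (gauge f) := by
  obtain ⟨K, hK⟩ := hf.abs_sub_le
  refine ⟨2 + 4 * K, LipschitzWith.of_dist_le_mul fun x y => ?_⟩
  rw [Real.dist_eq, dist_eq_norm]
  push_cast
  have hn : 0 ≤ ‖x - y‖ := norm_nonneg _
  rcases eq_or_ne x 0 with rfl | hx
  · rw [gauge_zero, zero_sub, abs_neg, abs_of_nonneg (gauge_nonneg hb y), zero_sub, norm_neg]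
    have := gauge_le hb y
    nlinarith [K.coe_nonneg, norm_nonneg y, mul_nonneg K.coe_nonneg (norm_nonneg y)]
  rcases eq_or_ne y 0 with rfl | hy
  · rw [gauge_zero, sub_zero, abs_of_nonneg (gauge_nonneg hb x), sub_zero]
    have := gauge_le hb x
    nlinarith [K.coe_nonneg, norm_nonneg x, mul_nonneg K.coe_nonneg (norm_nonneg x)]
  have hx1 : 1 / 2 ≤ 1 + f x := by have := (abs_le.1 (hb x hx)).1; linarith
  have hy1 : 1 / 2 ≤ 1 + f y := by have := (abs_le.1 (hb y hy)).1; linarith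
  have hx2 : 0 < 1 + f x := by linarith
  have hy2 : 0 < 1 + f y := by linarith
  -- The splitting puts `‖x‖` in front of `f y - f x`, as the scale-invariant bound requires. With
  -- `1 + f ≥ 1/2` the two terms give the constants `2` and `4 K`.
  have h1 : gauge f x - gauge f y = (‖x‖ - ‖y‖) * (1 + f y)⁻¹ +
      (‖x‖ * (f y - f x)) * ((1 + f x)⁻¹ * (1 + f y)⁻¹) := by
    rw [gauge, gauge]; field_simp; ring
  have i1 : |(1 + f x)⁻¹| ≤ 2 := by
    rw [abs_of_pos (inv_pos.2 hx2), inv_le_comm₀ hx2 (by norm_num)]; linarith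
  have i2 : |(1 + f y)⁻¹| ≤ 2 := by
    rw [abs_of_pos (inv_pos.2 hy2), inv_le_comm₀ hy2 (by norm_num)]; linarith
  have h2 := hK x y hx hy
  calc |gauge f x - gauge f y| ≤ |(‖x‖ - ‖y‖) * (1 + f y)⁻¹| +
        |(‖x‖ * (f y - f x)) * ((1 + f x)⁻¹ * (1 + f y)⁻¹)| := by rw [h1]; exact abs_add_le _ _
    _ = |‖x‖ - ‖y‖| * |(1 + f y)⁻¹| + (‖x‖ * |f x - f y|) * (|(1 + f x)⁻¹| * |(1 + f y)⁻¹|) := by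
      simp only [abs_mul, abs_norm, abs_sub_comm (f x)]
    _ ≤ ‖x - y‖ * 2 + (K * ‖x - y‖) * (2 * 2) := by
      gcongr
      exact abs_norm_sub_norm_le x y
    _ = (2 + 4 * K) * ‖x - y‖ := by ring

theorem gradient_gauge_smul (hf : IsProfile f) (r : ℝ) (x : 𝔼 N) (hr : 0 < r) :
    gradient (gauge f) (r • x) = gradient (gauge f) x := by
  rw [gradient_smul_of_homogeneous hr.ne' (fun y => gauge_smul hf r y hr), div_self hr.ne',
    one_smul]

theorem hasGradientAt_gauge {θ : 𝔼 N} (hθ : ‖θ‖ = 1) (h0 : 1 + f θ ≠ 0)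
    (hd : DifferentiableAt ℝ f θ) :
    HasGradientAt (gauge f) ((1 + f θ)⁻¹ • θ - ((1 + f θ) ^ 2)⁻¹ • gradient f θ) θ := by
  have hθ0 : θ ≠ 0 := norm_pos_iff.1 (by rw [hθ]; norm_num)
  have h1 : HasFDerivAt (fun x : 𝔼 N => ‖x‖) (innerSL ℝ θ) θ := by
    have := (hasStrictFDerivAt_norm_sq θ).hasFDerivAt.sqrt (by simp [hθ])
    simp only [Real.sqrt_sq (norm_nonneg _), hθ] at this
    refine this.congr_fderiv ?_
    ext v
    simp
  have h2 : HasFDerivAt (fun x => (1 + f x)⁻¹) (-((1 + f θ) ^ 2)⁻¹ • fderiv ℝ f θ) θ :=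
    (hasDerivAt_inv h0).comp_hasFDerivAt θ (hd.hasFDerivAt.const_add 1)
  have h3 := h1.mul h2
  rw [hasGradientAt_iff_hasFDerivAt]
  refine h3.congr_fderiv ?_
  ext v
  simp only [hθ, add_apply, smul_apply, smul_eq_mul,
    innerSL_apply_apply, InnerProductSpace.toDual_apply_apply, inner_sub_left, inner_smul_left,
    inner_gradient_left]
  simp
  ring

/-- Pythagoras: the radial part `(1+f)⁻¹ θ` is orthogonal to `∇f`. -/
theorem norm_gradient_gauge_sq (hf : IsProfile f) {θ : 𝔼 N} (hθ : ‖θ‖ = 1) (h0 : 1 + f θ ≠ 0)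
    (hd : DifferentiableAt ℝ f θ) :
    ‖gradient (gauge f) θ‖ ^ 2 =
      ((1 + f θ) ^ 2)⁻¹ + ((1 + f θ) ^ 4)⁻¹ * ‖gradient f θ‖ ^ 2 := by
  rw [(hasGradientAt_gauge hθ h0 hd).gradient, norm_sub_sq_real, inner_smul_left, inner_smul_right,
    hf.inner_gradient, norm_smul, norm_smul, hθ]
  simp only [norm_inv, norm_pow, mul_pow, inv_pow, Real.norm_eq_abs, sq_abs]
  ring

end Gauge

end Homogeneous

/-! ### Integration by parts of Lipschitz functions against smooth fields -/

section IntegrationByParts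

theorem continuous_divergence {φ : (𝔼 N) → 𝔼 N} (hφ : ContDiff ℝ 1 φ) :
    Continuous (divergence φ) := by
  unfold divergence
  have h := hφ.continuous_fderiv one_ne_zero
  refine continuous_finsetSum _ fun i _ => ?_
  exact (EuclideanSpace.proj (𝕜 := ℝ) i).continuous.comp (h.clm_apply continuous_const)

theorem hasCompactSupport_divergence {φ : (𝔼 N) → 𝔼 N} (hc : HasCompactSupport φ) :
    HasCompactSupport (divergence φ) := by
  refine (hc.fderiv ℝ).mono' ?_
  intro x hx
  refine subset_tsupport _ ?_
  contrapose! hx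
  rw [Function.notMem_support] at hx ⊢
  simp [divergence, hx]

theorem integrable_divergence {φ : (𝔼 N) → 𝔼 N} (hφ : ContDiff ℝ 1 φ)
    (hc : HasCompactSupport φ) : Integrable (divergence φ) :=
  (continuous_divergence hφ).integrable_of_hasCompactSupport (hasCompactSupport_divergence hc)

theorem fderiv_apply_eq {φ : (𝔼 N) → 𝔼 N} {x : 𝔼 N} (hφ : DifferentiableAt ℝ φ x) (v : 𝔼 N)
    (i : Fin N) : (fderiv ℝ φ x v) i = fderiv ℝ (fun y => φ y i) x v := by
  have := ((EuclideanSpace.proj (𝕜 := ℝ) i).hasFDerivAt.comp x hφ.hasFDerivAt).fderiv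
  change _ = fderiv ℝ ((EuclideanSpace.proj (𝕜 := ℝ) i) ∘ φ) x v
  rw [this]; rfl

theorem inner_gradient_eq_sum (w : (𝔼 N) → ℝ) (x v : 𝔼 N) :
    inner ℝ (gradient w x) v = ∑ i, fderiv ℝ w x (EuclideanSpace.single i 1) * v i := by
  rw [inner_gradient_left]
  have : v = ∑ i, v i • EuclideanSpace.single i (1 : ℝ) := by
    ext j; simp [Pi.single_apply]
  conv_lhs => rw [this]
  rw [map_sum]
  refine Finset.sum_congr rfl fun i _ => ?_
  rw [map_smul, smul_eq_mul, mul_comm]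

/-- Coordinate by coordinate this is the integration by parts for line derivatives of two Lipschitz
functions, one with compact support; Rademacher's theorem identifies line derivatives with
components of the gradient. -/
theorem integral_inner_gradient_eq {w : (𝔼 N) → ℝ} {K : ℝ≥0} (hw : LipschitzWith K w)
    {φ : (𝔼 N) → 𝔼 N} (hφ : ContDiff ℝ 1 φ) (hc : HasCompactSupport φ) :
    ∫ x, inner ℝ (gradient w x) (φ x) = -∫ x, w x * divergence φ x := by
  have hφi : ∀ i, ContDiff ℝ 1 (fun x => φ x i) := fun i =>
    (EuclideanSpace.proj (𝕜 := ℝ) i).contDiff.comp hφ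
  have hci : ∀ i, HasCompactSupport (fun x => φ x i) := fun i =>
    hc.comp_left (g := fun v : 𝔼 N => v i) rfl
  have hint : ∀ i, Integrable (fun x => lineDeriv ℝ w x (EuclideanSpace.single i 1) * φ x i) := by
    intro i
    exact ((hφi i).continuous.integrable_of_hasCompactSupport (hci i)).mul_of_top_right
      (hw.memLp_lineDeriv _)
  have hint2 : ∀ i, Integrable (fun x => w x * (fderiv ℝ φ x (EuclideanSpace.single i 1)) i) := by
    intro i
    refine Continuous.integrable_of_hasCompactSupport ?_ ?_
    · exact hw.continuous.mul ((EuclideanSpace.proj (𝕜 := ℝ) i).continuous.comp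
        ((hφ.continuous_fderiv one_ne_zero).clm_apply continuous_const))
    · refine HasCompactSupport.mul_left ?_
      exact (hc.fderiv ℝ).comp_left
        (g := fun A : (𝔼 N) →L[ℝ] 𝔼 N => (A (EuclideanSpace.single i 1)) i) rfl
  have h1 : ∫ x, inner ℝ (gradient w x) (φ x) =
      ∫ x, ∑ i, lineDeriv ℝ w x (EuclideanSpace.single i 1) * φ x i := by
    refine integral_congr_ae ?_
    filter_upwards [hw.ae_differentiableAt] with x hx
    rw [inner_gradient_eq_sum]
    refine Finset.sum_congr rfl fun i _ => ?_
    rw [hx.lineDeriv_eq_fderiv]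
  rw [h1, integral_finsetSum _ (fun i _ => hint i)]
  simp only [divergence, Finset.mul_sum]
  rw [integral_finsetSum _ (fun i _ => hint2 i), ← Finset.sum_neg_distrib]
  refine Finset.sum_congr rfl fun i _ => ?_
  obtain ⟨D, hD⟩ := ContDiff.lipschitzWith_of_hasCompactSupport (hci i) (hφi i) one_ne_zero
  rw [hw.integral_lineDeriv_mul_eq hD (hci i), ← integral_neg]
  refine integral_congr_ae (Eventually.of_forall fun x => ?_)
  have hd := (hφi i).differentiable one_ne_zero x
  simp only
  rw [hd.lineDeriv_eq_fderiv, fderiv_apply_eq (hφ.differentiable one_ne_zero x), map_neg]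
  ring

end IntegrationByParts

/-! ### Cutoff functions and densities -/

section Cutoff

/-- A large bump minus a small one. It serves to cut off fields depending on `x / ‖x‖` only, which
are singular at the origin. -/
theorem exists_annulus_cutoff {r R : ℝ} (hr : 0 < r) (hR : 0 < R) :
    ∃ χ : (𝔼 N) → ℝ, ContDiff ℝ ∞ χ ∧ HasCompactSupport χ ∧ (∀ x, |χ x| ≤ 1) ∧
      (∀ x, r ≤ ‖x‖ → ‖x‖ ≤ R → χ x = 1) ∧ ∀ x, ‖x‖ < r / 4 → χ x = 0 := by
  let b₁ : ContDiffBump (0 : 𝔼 N) := ⟨R + r, R + r + 1, by positivity, by linarith⟩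
  let b₂ : ContDiffBump (0 : 𝔼 N) := ⟨r / 4, r / 2, by positivity, by linarith⟩
  refine ⟨fun x => b₁ x - b₂ x, b₁.contDiff.sub b₂.contDiff, ?_, fun x => ?_, fun x hx hxR => ?_,
    fun x hx => ?_⟩
  · exact b₁.hasCompactSupport.sub b₂.hasCompactSupport
  · have h1 := b₁.nonneg (x := x)
    have h2 := b₂.nonneg (x := x)
    have h3 := b₁.le_one (x := x)
    have h4 := b₂.le_one (x := x)
    rw [abs_le]
    constructor <;> linarith
  · have h1 : b₁ x = 1 := b₁.one_of_mem_closedBall (by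
      simp only [mem_closedBall_zero_iff, b₁]; linarith)
    have h2 : b₂ x = 0 := b₂.zero_of_le_dist (by
      simp only [dist_zero_right, b₂]; linarith)
    simp only [h1, h2, sub_zero]
  · have h1 : b₁ x = 1 := b₁.one_of_mem_closedBall (by
      simp only [mem_closedBall_zero_iff, b₁]; linarith)
    have h2 : b₂ x = 1 := b₂.one_of_mem_closedBall (by
      simp only [mem_closedBall_zero_iff, b₂]; linarith)
    simp only [h1, h2, sub_self]

theorem contDiff_cutoff_smul {χ : (𝔼 N) → ℝ} {F : (𝔼 N) → 𝔼 N} {δ : ℝ} (hδ : 0 < δ)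
    (hχ : ContDiff ℝ ∞ χ) (h0 : ∀ x, ‖x‖ < δ → χ x = 0)
    (hF : ∀ x, x ≠ 0 → ContDiffAt ℝ 1 F x) : ContDiff ℝ 1 (fun x => χ x • F x) := by
  rw [contDiff_iff_contDiffAt]
  intro x
  rcases eq_or_ne x 0 with rfl | hx
  · refine (contDiffAt_const (c := (0 : 𝔼 N))).congr_of_eventuallyEq ?_
    filter_upwards [Metric.ball_mem_nhds (0 : 𝔼 N) hδ] with y hy
    rw [h0 y (by simpa using hy), zero_smul]
  · exact (hχ.of_le (by simp)).contDiffAt.smul (hF x hx)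

/-- Such densities approximate the Dirac mass at `R` from below; minus `ρ` will be the derivative of
a cutoff falling from 1 to 0 inside `(a, R)`. -/
theorem exists_density {a R : ℝ} (haR : a < R) :
    ∃ ρ : ℝ → ℝ, Continuous ρ ∧ HasCompactSupport ρ ∧ (∀ t, 0 ≤ ρ t) ∧
      (∀ t, t ∉ Ioo a R → ρ t = 0) ∧ ∫ t, ρ t = 1 := by
  let b : ContDiffBump ((a + R) / 2 : ℝ) := ⟨(R - a) / 4, (R - a) / 2, by linarith, by linarith⟩
  refine ⟨b.normed volume, b.continuous_normed, b.hasCompactSupport_normed,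
    b.nonneg_normed, fun t ht => ?_, b.integral_normed⟩
  rw [← Function.notMem_support, b.support_normed_eq, Real.ball_eq_Ioo]
  simp only [b]
  convert ht using 3 <;> ring

end Cutoff

/-! ### Fluxes through level sets as limits of thin layers -/

section LayerLimit

variable {f : (𝔼 N) → ℝ}

/-- A continuous cutoff, with derivative `-ρ`. -/
theorem integral_cutoff_mul_divergence {s : (𝔼 N) → ℝ} {K : ℝ≥0} (hs : LipschitzWith K s)
    {φ : (𝔼 N) → 𝔼 N} (hφ : ContDiff ℝ 1 φ) (hc : HasCompactSupport φ) {ρ : ℝ → ℝ}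
    (hρ : Continuous ρ) (hρc : HasCompactSupport ρ) (c : ℝ) :
    ∫ x, (1 - ∫ t in c..s x, ρ t) * divergence φ x =
      ∫ x, ρ (s x) * inner ℝ (gradient s x) (φ x) := by
  set ζ : ℝ → ℝ := fun r => 1 - ∫ t in c..r, ρ t with hζ
  have hd : ∀ r, HasDerivAt ζ (-ρ r) r := fun r =>
    (intervalIntegral.integral_hasDerivAt_right (hρ.intervalIntegrable _ _)
      (hρ.stronglyMeasurableAtFilter _ _) hρ.continuousAt).const_sub 1
  obtain ⟨C, hC⟩ := hρc.exists_bound_of_continuous hρ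
  have hLip : LipschitzWith C.toNNReal ζ := by
    refine lipschitzWith_of_nnnorm_deriv_le (fun r => (hd r).differentiableAt) fun r => ?_
    rw [(hd r).deriv, nnnorm_neg, ← NNReal.coe_le_coe, coe_nnnorm]
    exact (hC r).trans (Real.le_coe_toNNReal C)
  have h1 := integral_inner_gradient_eq (hLip.comp hs) hφ hc
  have h2 : ∫ x, inner ℝ (gradient (ζ ∘ s) x) (φ x) =
      ∫ x, -(ρ (s x) * inner ℝ (gradient s x) (φ x)) := by
    refine integral_congr_ae ?_
    filter_upwards [hs.ae_differentiableAt] with x hx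
    have h3 : HasFDerivAt (ζ ∘ s) (-ρ (s x) • fderiv ℝ s x) x :=
      (hd (s x)).comp_hasFDerivAt x hx.hasFDerivAt
    simp only [inner_gradient_left]
    rw [h3.fderiv]
    simp
  rw [h2, integral_neg, neg_inj] at h1
  exact h1.symm

/-- The indicator of `{s < R}` is the bounded pointwise limit of Lipschitz cutoffs of `s` whose
transition layers shrink to `R` from below. A bound for the flux through all such layers therefore
passes to the limit, without boundary traces. -/
theorem setIntegral_divergence_le {s : (𝔼 N) → ℝ} {K : ℝ≥0} (hs : LipschitzWith K s)
    {φ : (𝔼 N) → 𝔼 N} (hφ : ContDiff ℝ 1 φ) (hc : HasCompactSupport φ) {a R M : ℝ}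
    (haR : a < R)
    (hM : ∀ ρ : ℝ → ℝ, Continuous ρ → HasCompactSupport ρ → (∀ t, 0 ≤ ρ t) →
      (∀ t, t ∉ Ioo a R → ρ t = 0) → ∫ t, ρ t = 1 →
      ∫ x, ρ (s x) * inner ℝ (gradient s x) (φ x) ≤ M) :
    ∫ x in {x | s x < R}, divergence φ x ≤ M := by
  have hδ : ∀ n : ℕ, 0 < (R - a) / ((n : ℝ) + 1) := fun n =>
    div_pos (by linarith) (by positivity)
  have hδ' : ∀ n : ℕ, (R - a) / ((n : ℝ) + 1) ≤ R - a := fun n =>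
    div_le_self (by linarith) (by linarith [n.cast_nonneg (α := ℝ)])
  -- The layer `(R - (R-a)/(n+1), R)` shrinks to `R` and stays inside `(a, R)`.
  choose ρ h1 h2 h3 h4 h5 using fun n : ℕ =>
    exists_density (a := R - (R - a) / ((n : ℝ) + 1)) (R := R) (by linarith [hδ n])
  have hle : ∀ n, ∫ x, (1 - ∫ t in a..s x, ρ n t) * divergence φ x ≤ M := by
    intro n
    rw [integral_cutoff_mul_divergence hs hφ hc (h1 n) (h2 n)]
    refine hM (ρ n) (h1 n) (h2 n) (h3 n) (fun t ht => h4 n t fun ht' => ht ⟨?_, ht'.2⟩) (h5 n)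
    have := ht'.1
    linarith [hδ' n]
  have hint : ∀ n, Integrable (ρ n) := fun n =>
    (h1 n).integrable_of_hasCompactSupport (h2 n)
  have habs : ∀ n r, |1 - ∫ t in a..r, ρ n t| ≤ 1 := by
    intro n r
    rcases le_total a r with har | har
    · rw [intervalIntegral.integral_of_le har]
      have e1 : 0 ≤ ∫ t in Ioc a r, ρ n t := integral_nonneg (h3 n)
      have e2 : ∫ t in Ioc a r, ρ n t ≤ 1 := by
        rw [← h5 n]; exact setIntegral_le_integral (hint n) (Eventually.of_forall (h3 n))
      rw [abs_le]; constructor <;> linarith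
    · have : ∫ t in a..r, ρ n t = 0 := by
        rw [intervalIntegral.integral_symm, intervalIntegral.integral_of_le har]
        rw [setIntegral_eq_zero_of_forall_eq_zero, neg_zero]
        intro t ht
        refine h4 n t fun ht' => ?_
        have := ht'.1
        have := ht.2
        linarith [hδ' n]
      rw [this]; simp
  have hlim : Tendsto (fun n => ∫ x, (1 - ∫ t in a..s x, ρ n t) * divergence φ x) atTop
      (𝓝 (∫ x, ({x | s x < R}.indicator (fun x => divergence φ x)) x)) := by
    refine tendsto_integral_of_dominated_convergence (fun x => ‖divergence φ x‖) ?_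
      (integrable_divergence hφ hc).norm ?_ ?_
    · intro n
      refine (Continuous.mul ?_ (continuous_divergence hφ)).aestronglyMeasurable
      refine continuous_const.sub ?_
      exact (intervalIntegral.continuous_primitive
        (fun u v => (h1 n).intervalIntegrable u v) a).comp hs.continuous
    · intro n
      refine Eventually.of_forall fun x => ?_
      rw [norm_mul]
      exact mul_le_of_le_one_left (norm_nonneg _) (habs n (s x))
    · refine Eventually.of_forall fun x => ?_
      by_cases hx : s x < R
      · rw [indicator_of_mem (by exact hx)]
        refine tendsto_const_nhds.congr' ?_
        have ht : Tendsto (fun n : ℕ => (R - a) / ((n : ℝ) + 1)) atTop (𝓝 0) := by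
          have := tendsto_one_div_add_atTop_nhds_zero_nat.const_mul (R - a)
          simpa [div_eq_mul_inv] using this
        filter_upwards [ht.eventually_lt_const (show 0 < R - s x by linarith)] with n hn
        have : ∫ t in a..s x, ρ n t = 0 := by
          rw [intervalIntegral.integral_zero_ae]
          refine Eventually.of_forall fun t ht => h4 n t fun ht' => ?_
          have e1 := ht'.1
          rcases le_total a (s x) with has | has
          · rw [uIoc_of_le has] at ht
            linarith [ht.2]
          · rw [uIoc_of_ge has] at ht
            linarith [ht.2, hδ' n]
        rw [this]; simp
      · rw [indicator_of_notMem (by exact hx)]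
        refine tendsto_const_nhds.congr fun n => ?_
        have : ∫ t in a..s x, ρ n t = 1 := by
          rw [intervalIntegral.integral_of_le (by linarith), ← h5 n]
          refine setIntegral_eq_integral_of_forall_compl_eq_zero fun t ht => h4 n t fun ht' => ?_
          refine ht ⟨?_, ?_⟩
          · have := ht'.1
            linarith [hδ' n]
          · linarith [ht'.2]
        rw [this]; simp
  rw [integral_indicator (measurableSet_lt hs.continuous.measurable measurable_const)] at hlim
  exact le_of_tendsto hlim (Eventually.of_forall hle)

end LayerLimit

/-! ### De Giorgi perimeter: upper bound for the ball, lower bound for gauge sublevel sets -/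

section Perimeter

theorem divergence_neg (φ : (𝔼 N) → 𝔼 N) (x : 𝔼 N) :
    divergence (fun y => -φ y) x = -divergence φ x := by
  simp [divergence, fderiv_fun_neg]

theorem moment_density_le {a R : ℝ} (ha : 0 ≤ a) {ρ : ℝ → ℝ} (hρ : Continuous ρ)
    (hc : HasCompactSupport ρ) (h0 : ∀ t, 0 ≤ ρ t) (hs : ∀ t, t ∉ Ioo a R → ρ t = 0)
    (h1 : ∫ t, ρ t = 1) (n : ℕ) :
    a ^ n ≤ ∫ t in Ioi (0 : ℝ), t ^ n * ρ t ∧ ∫ t in Ioi (0 : ℝ), t ^ n * ρ t ≤ R ^ n := by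
  have hi : Integrable ρ := hρ.integrable_of_hasCompactSupport hc
  have hi2 : Integrable (fun t => t ^ n * ρ t) :=
    ((continuous_id.pow n).mul hρ).integrable_of_hasCompactSupport hc.mul_left
  have e : ∫ t in Ioi (0 : ℝ), t ^ n * ρ t = ∫ t, t ^ n * ρ t := by
    refine setIntegral_eq_integral_of_forall_compl_eq_zero fun t ht => ?_
    rw [hs t (fun h => ht (lt_of_le_of_lt ha h.1)), mul_zero]
  rw [e]
  constructor
  · calc a ^ n = ∫ t, a ^ n * ρ t := by rw [integral_const_mul, h1, mul_one]
      _ ≤ _ := integral_mono (hi.const_mul _) hi2 fun t => by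
        by_cases ht : t ∈ Ioo a R
        · exact mul_le_mul_of_nonneg_right (pow_le_pow_left₀ ha ht.1.le n) (h0 t)
        · simp [hs t ht]
  · calc _ ≤ ∫ t, R ^ n * ρ t := integral_mono hi2 (hi.const_mul _) fun t => by
          by_cases ht : t ∈ Ioo a R
          · exact mul_le_mul_of_nonneg_right
              (pow_le_pow_left₀ (ha.trans ht.1.le) ht.2.le n) (h0 t)
          · simp [hs t ht]
      _ = _ := by rw [integral_const_mul, h1, mul_one]

theorem integrable_comp_mul_bounded {s G : (𝔼 N) → ℝ} {K : ℝ≥0} (hs : LipschitzWith K s)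
    (hle : ∀ x, ‖x‖ ≤ 2 * s x) {F : ℝ → ℝ} (hF : Continuous F) (hc : HasCompactSupport F)
    (hG : AEStronglyMeasurable G) {C : ℝ} (hb : ∀ x, |G x| ≤ C) :
    Integrable (fun x => F (s x) * G x) := by
  refine Integrable.mul_bdd (c := C) ?_ hG (Eventually.of_forall hb)
  refine (hF.comp hs.continuous).integrable_of_hasCompactSupport ?_
  obtain ⟨R, hR⟩ := hc.isCompact.isBounded.subset_closedBall 0
  refine HasCompactSupport.of_support_subset_isCompact (isCompact_closedBall (0 : 𝔼 N) (2 * R))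
    fun x hx => ?_
  have h1 := hR (subset_tsupport _ (show s x ∈ Function.support F from hx))
  rw [mem_closedBall_zero_iff, Real.norm_eq_abs] at h1
  rw [mem_closedBall_zero_iff]
  have := hle x
  have := le_abs_self (s x)
  linarith

theorem contDiff_regularized_normalize {g : (𝔼 N) → 𝔼 N} (hg : ContDiff ℝ ∞ g) {κ : ℝ}
    (hκ : 0 < κ) : ContDiff ℝ 1 (fun x => (Real.sqrt (κ ^ 2 + ‖g x‖ ^ 2))⁻¹ • g x) := by
  have h1 : ContDiff ℝ 1 g := hg.of_le (by simp)
  have h2 : ContDiff ℝ 1 (fun x => κ ^ 2 + ‖g x‖ ^ 2) := contDiff_const.add (h1.norm_sq ℝ)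
  have h3 : ∀ x, 0 < κ ^ 2 + ‖g x‖ ^ 2 := fun x => by positivity
  exact ((h2.sqrt fun x => (h3 x).ne').inv fun x => (Real.sqrt_pos.2 (h3 x)).ne').smul h1

/-- The smooth field `w / √(κ² + |w|²)`, of norm at most 1, nearly attains `‖v‖` when paired with
`v`: the regularization costs `κ`, and the replacement of `v` by `w` costs `‖v - w‖` twice. -/
theorem norm_sub_le_inner_regularized (v w : 𝔼 N) {κ : ℝ} (hκ : 0 < κ) :
    ‖v‖ - κ - 2 * ‖v - w‖ ≤ inner ℝ v ((Real.sqrt (κ ^ 2 + ‖w‖ ^ 2))⁻¹ • w) := by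
  set q := Real.sqrt (κ ^ 2 + ‖w‖ ^ 2) with hq
  have hq0 : 0 < q := Real.sqrt_pos.2 (by positivity)
  have hqq : q ^ 2 = κ ^ 2 + ‖w‖ ^ 2 := Real.sq_sqrt (by positivity)
  have hwq : ‖w‖ ≤ q := Real.le_sqrt_of_sq_le (by nlinarith)
  have hqw : q ≤ κ + ‖w‖ := by
    refine Real.sqrt_le_iff.2 ⟨by positivity, ?_⟩
    nlinarith [norm_nonneg w]
  have h1 : inner ℝ v (q⁻¹ • w) = q⁻¹ * ‖w‖ ^ 2 + q⁻¹ * inner ℝ (v - w) w := by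
    rw [inner_smul_right, inner_sub_left, real_inner_self_eq_norm_sq]; ring
  have h2 : -‖v - w‖ ≤ q⁻¹ * inner ℝ (v - w) w := by
    have h3 : |q⁻¹ * inner ℝ (v - w) w| ≤ ‖v - w‖ := by
      rw [abs_mul, abs_of_pos (inv_pos.2 hq0), inv_mul_le_iff₀ hq0]
      calc _ ≤ ‖v - w‖ * ‖w‖ := abs_real_inner_le_norm _ _
        _ ≤ q * ‖v - w‖ := by rw [mul_comm]; gcongr
    exact (abs_le.1 h3).1
  have h4 : ‖w‖ - κ ≤ q⁻¹ * ‖w‖ ^ 2 := by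
    rw [le_inv_mul_iff₀ hq0]
    nlinarith [norm_nonneg w]
  have h5 : ‖v‖ ≤ ‖w‖ + ‖v - w‖ := by
    have := norm_add_le w (v - w)
    rwa [add_sub_cancel] at this
  rw [h1]
  linarith

variable [NeZero N]

/-- Since `|∇‖x‖| ≤ 1` and `|φ| ≤ 1`, the flux through a layer is at most `∫ ρ(‖x‖)`, that is, the
area of the unit sphere times the moment of order `N - 1` of `ρ`. Equality is not needed for the
ball. -/
theorem perimeter_ball_le {R : ℝ} (hR : 0 < R) :
    perimeter (Metric.ball (0 : 𝔼 N) R) ≤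
      ENNReal.ofReal (R ^ (N - 1) * (surface N).real univ) := by
  refine iSup_le fun φ => iSup_le fun hφ => iSup_le fun hc => iSup_le fun hφ1 => ?_
  refine ENNReal.ofReal_le_ofReal ?_
  have hset : Metric.ball (0 : 𝔼 N) R = {x | ‖x‖ < R} := by ext; simp
  rw [hset]
  refine setIntegral_divergence_le lipschitzWith_one_norm hφ hc (a := 0) hR ?_
  intro ρ hρ hρc h0 hs h1
  have hle : ∀ x : 𝔼 N, ‖x‖ ≤ 2 * ‖x‖ := fun x => by linarith [norm_nonneg x]
  have hb : ∀ x : 𝔼 N, |inner ℝ (gradient (fun x : 𝔼 N => ‖x‖) x) (φ x)| ≤ 1 := by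
    intro x
    refine (abs_real_inner_le_norm _ _).trans ?_
    rw [norm_gradient]
    have h2 : ‖fderiv ℝ (fun x : 𝔼 N => ‖x‖) x‖ ≤ ((1 : ℝ≥0) : ℝ) :=
      norm_fderiv_le_of_lipschitz ℝ lipschitzWith_one_norm
    exact mul_le_one₀ h2 (norm_nonneg _) (hφ1 x)
  have hi : Integrable (fun x : 𝔼 N => ρ ‖x‖ * 1) :=
    integrable_comp_mul_bounded lipschitzWith_one_norm hle hρ hρc
      aestronglyMeasurable_const (C := 1) (by simp)
  have hmono : ∫ x, ρ ‖x‖ * inner ℝ (gradient (fun x : 𝔼 N => ‖x‖) x) (φ x) ≤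
      ∫ x : 𝔼 N, ρ ‖x‖ * 1 := by
    refine integral_mono (integrable_comp_mul_bounded lipschitzWith_one_norm hle hρ hρc ?_ hb) hi
      fun x => mul_le_mul_of_nonneg_left (abs_le.1 (hb x)).2 (h0 _)
    exact ((measurable_gradient _).inner hφ.continuous.measurable).aestronglyMeasurable
  refine hmono.trans ?_
  rw [integral_comp_gauge (s := fun x : 𝔼 N => ‖x‖) (G := fun _ => 1)
    (fun r x hr => by rw [norm_smul, Real.norm_of_nonneg hr.le]) (fun x hx => norm_pos_iff.2 hx)
    (fun _ _ _ => rfl) hi]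
  have : ∫ θ : Metric.sphere (0 : 𝔼 N) 1, 1 * (‖(θ : 𝔼 N)‖ ^ N)⁻¹ ∂(surface N) =
      (surface N).real univ := by simp
  rw [this, mul_comm]
  gcongr
  exact (moment_density_le le_rfl hρ hρc h0 hs h1 (N - 1)).2

variable {f : (𝔼 N) → ℝ}

/-- The field `Φ` on the sphere is extended along rays, so that its product with the 0-homogeneous
`∇s` separates in polar coordinates. Applying the layer estimate to the opposite field turns an
upper bound into a lower one. -/
theorem ofReal_flux_le_perimeter (hf : IsProfile f) (hb : ∀ x : 𝔼 N, x ≠ 0 → |f x| ≤ 1 / 2)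
    {R : ℝ} (hR : 0 < R) {Φ : (𝔼 N) → 𝔼 N} (hΦ : ContDiff ℝ 1 Φ) (hΦ1 : ∀ x, ‖Φ x‖ ≤ 1) :
    ENNReal.ofReal (R ^ (N - 1) * ∫ θ : Metric.sphere (0 : 𝔼 N) 1,
      inner ℝ (gradient (gauge f) (θ : 𝔼 N)) (Φ θ) * (gauge f (θ : 𝔼 N) ^ N)⁻¹ ∂(surface N)) ≤
      perimeter {x | gauge f x < R} := by
  set I := ∫ θ : Metric.sphere (0 : 𝔼 N) 1,
      inner ℝ (gradient (gauge f) (θ : 𝔼 N)) (Φ θ) * (gauge f (θ : 𝔼 N) ^ N)⁻¹ ∂(surface N) with hI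
  rcases le_or_gt I 0 with hI0 | hI0
  · rw [ENNReal.ofReal_of_nonpos (mul_nonpos_of_nonneg_of_nonpos (by positivity) hI0)]
    exact zero_le
  obtain ⟨K, hK⟩ := exists_lipschitzWith_gauge hf hb
  -- On layers with `R/2 < gauge < R`, the bounds `‖x‖/2 ≤ gauge ≤ 2‖x‖` place `x` in this annulus,
  -- where `χ = 1`.
  obtain ⟨χ, hχ, hχc, hχ1, hχa, hχ0⟩ :=
    exists_annulus_cutoff (N := N) (r := R / 4) (R := 2 * R) (by positivity) (by positivity)
  set φ : (𝔼 N) → 𝔼 N := fun x => χ x • Φ (‖x‖⁻¹ • x) with hφdef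
  have hφ : ContDiff ℝ 1 φ := by
    refine contDiff_cutoff_smul (δ := R / 4 / 4) (by positivity) hχ hχ0 fun x hx => ?_
    refine hΦ.contDiffAt.comp x ?_
    exact ((contDiffAt_norm ℝ hx).inv (norm_ne_zero_iff.2 hx)).smul contDiffAt_id
  have hφc : HasCompactSupport φ := hχc.smul_right
  have hφ1 : ∀ x, ‖φ x‖ ≤ 1 := fun x => by
    rw [hφdef, norm_smul]
    exact mul_le_one₀ (hχ1 x) (norm_nonneg _) (hΦ1 _)
  have key : ∀ a, R / 2 < a → a < R →
      a ^ (N - 1) * I ≤ ∫ x in {x | gauge f x < R}, divergence φ x := by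
    intro a ha haR
    have h := setIntegral_divergence_le hK (φ := fun x => -φ x) hφ.neg
      hφc.neg (M := -(a ^ (N - 1) * I)) haR ?_
    · simp only [divergence_neg] at h
      rw [integral_neg] at h
      linarith
    intro ρ hρ hρc h0 hs h1
    set G : (𝔼 N) → ℝ := fun x => inner ℝ (gradient (gauge f) x) (Φ (‖x‖⁻¹ • x)) with hG
    have e1 : ∀ x, ρ (gauge f x) * inner ℝ (gradient (gauge f) x) (-φ x) =
        -(ρ (gauge f x) * G x) := by
      intro x
      by_cases hx : gauge f x ∈ Ioo a R
      · have : χ x = 1 := hχa x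
          (by have := gauge_le hb x; have := hx.1; linarith)
          (by have := le_gauge hb x; have := hx.2; linarith)
        rw [hφdef]
        simp only [this, one_smul, inner_neg_right, hG]
        ring
      · rw [hs _ hx]; simp
    simp only [e1]
    rw [integral_neg, neg_le_neg_iff]
    have hGm : AEStronglyMeasurable G := by
      refine Measurable.aestronglyMeasurable ?_
      refine (measurable_gradient _).inner ?_
      exact hΦ.continuous.measurable.comp (measurable_norm.inv.smul measurable_id)
    have hGb : ∀ x, |G x| ≤ K := by
      intro x
      refine (abs_real_inner_le_norm _ _).trans ?_
      rw [norm_gradient]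
      calc _ ≤ (K : ℝ) * 1 := mul_le_mul (norm_fderiv_le_of_lipschitz ℝ hK) (hΦ1 _)
            (norm_nonneg _) K.coe_nonneg
        _ = K := mul_one _
    rw [integral_comp_gauge (gauge_smul hf) (gauge_pos hb) (G := G) ?_
      (integrable_comp_mul_bounded hK (fun x => by have := le_gauge hb x; linarith) hρ hρc
        hGm hGb)]
    · have e2 : ∫ θ : Metric.sphere (0 : 𝔼 N) 1,
          G θ * (gauge f (θ : 𝔼 N) ^ N)⁻¹ ∂(surface N) = I := by
        rw [hI]
        refine integral_congr_ae (Eventually.of_forall fun θ => ?_)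
        simp [hG]
      rw [e2, mul_comm]
      gcongr
      exact (moment_density_le (by linarith) hρ hρc h0 hs h1 (N - 1)).1
    · intro r x hr
      simp only [hG]
      rw [gradient_gauge_smul hf r x hr, norm_smul, Real.norm_of_nonneg hr.le, smul_smul,
        mul_inv_rev, inv_mul_cancel_right₀ hr.ne']
  have hlim : R ^ (N - 1) * I ≤ ∫ x in {x | gauge f x < R}, divergence φ x := by
    have ht : Tendsto (fun a : ℝ => a ^ (N - 1) * I) (𝓝[<] R) (𝓝 (R ^ (N - 1) * I)) :=
      ((continuous_pow (N - 1)).mul_const I).continuousAt.tendsto.mono_left nhdsWithin_le_nhds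
    refine le_of_tendsto ht ?_
    filter_upwards [Ioo_mem_nhdsLT (show R / 2 < R by linarith)] with a ha
    exact key a ha.1 ha.2
  refine (ENNReal.ofReal_le_ofReal hlim).trans ?_
  exact le_iSup_of_le φ (le_iSup_of_le hφ (le_iSup_of_le hφc (le_iSup_of_le hφ1 le_rfl)))

/-- The optimal field `∇s / |∇s|` is only measurable. It is replaced by the regularized
normalization of a smooth `L¹(sphere)` approximation of `∇s`, and the error tends to 0. -/
theorem ofReal_area_le_perimeter (hf : IsProfile f) (hb : ∀ x : 𝔼 N, x ≠ 0 → |f x| ≤ 1 / 2)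
    {R : ℝ} (hR : 0 < R) :
    ENNReal.ofReal (R ^ (N - 1) * ∫ θ : Metric.sphere (0 : 𝔼 N) 1,
      ‖gradient (gauge f) (θ : 𝔼 N)‖ * (gauge f (θ : 𝔼 N) ^ N)⁻¹ ∂(surface N)) ≤
      perimeter {x | gauge f x < R} := by
  obtain ⟨K, hK⟩ := exists_lipschitzWith_gauge hf hb
  set μ : Measure (𝔼 N) := (surface N).map Subtype.val with hμ
  have : IsFiniteMeasure μ := Measure.isFiniteMeasure_map _ _
  have hKn : ∀ x, ‖gradient (gauge f) x‖ ≤ K := fun x => by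
    rw [norm_gradient]; exact norm_fderiv_le_of_lipschitz ℝ hK
  have hmem : MemLp (gradient (gauge f)) 1 μ :=
    MemLp.of_bound (measurable_gradient _).aestronglyMeasurable K (Eventually.of_forall hKn)
  have hθ0 : ∀ θ : Metric.sphere (0 : 𝔼 N) 1, (θ : 𝔼 N) ≠ 0 := fun θ =>
    Metric.ne_of_mem_sphere θ.2 one_ne_zero
  have hw : ∀ θ : Metric.sphere (0 : 𝔼 N) 1, (gauge f (θ : 𝔼 N) ^ N)⁻¹ ≤ 2 ^ N ∧
      0 < (gauge f (θ : 𝔼 N) ^ N)⁻¹ := by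
    intro θ
    have h1 := le_gauge hb (θ : 𝔼 N)
    rw [norm_eq_of_mem_sphere] at h1
    have h2 := gauge_pos hb _ (hθ0 θ)
    refine ⟨?_, by positivity⟩
    rw [← inv_pow]
    refine pow_le_pow_left₀ (by positivity) ?_ N
    rw [inv_le_comm₀ h2 (by norm_num)]
    linarith
  have hwm : Measurable (fun θ : Metric.sphere (0 : 𝔼 N) 1 => (gauge f (θ : 𝔼 N) ^ N)⁻¹) :=
    ((hK.continuous.measurable.comp measurable_subtype_coe).pow_const N).inv
  set A := ∫ θ : Metric.sphere (0 : 𝔼 N) 1,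
      ‖gradient (gauge f) (θ : 𝔼 N)‖ * (gauge f (θ : 𝔼 N) ^ N)⁻¹ ∂(surface N) with hA
  set m := (surface N).real univ with hm
  have hgm : Measurable (fun θ : Metric.sphere (0 : 𝔼 N) 1 => gradient (gauge f) (θ : 𝔼 N)) :=
    (measurable_gradient _).comp measurable_subtype_coe
  have key : ∀ κ : ℝ, 0 < κ →
      ENNReal.ofReal (R ^ (N - 1) * (A - κ * (2 ^ N * (m + 2)))) ≤
        perimeter {x | gauge f x < R} := by
    intro κ hκ
    -- The same `κ` serves as `L¹` error and as regularization. The total loss is at most `2ᴺ (κ m +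
    -- 2κ)`, because the weight `s⁻ᴺ` is at most `2ᴺ`.
    obtain ⟨g, hgc, hg, hgε⟩ := hmem.exist_eLpNorm_sub_le ENNReal.one_ne_top le_rfl hκ
    refine le_trans (ENNReal.ofReal_le_ofReal ?_) (ofReal_flux_le_perimeter hf hb hR
      (contDiff_regularized_normalize hg hκ) fun x => ?_)
    · gcongr
      have hgd : Integrable (fun x => gradient (gauge f) x - g x) μ :=
        memLp_one_iff_integrable.1 (hmem.sub (hg.continuous.memLp_of_hasCompactSupport hgc))
      have e1 : ∫ θ : Metric.sphere (0 : 𝔼 N) 1, ‖gradient (gauge f) (θ : 𝔼 N) - g θ‖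
          ∂(surface N) ≤ κ := by
        have h2 : ∫ x, ‖gradient (gauge f) x - g x‖ ∂μ = ∫ θ : Metric.sphere (0 : 𝔼 N) 1,
            ‖gradient (gauge f) (θ : 𝔼 N) - g θ‖ ∂(surface N) :=
          integral_map measurable_subtype_coe.aemeasurable hgd.norm.aestronglyMeasurable
        rw [← h2, integral_norm_eq_lintegral_enorm hgd.aestronglyMeasurable]
        rw [eLpNorm_one_eq_lintegral_enorm] at hgε
        exact ENNReal.toReal_le_of_le_ofReal hκ.le hgε
      have hgd' : Integrable (fun θ : Metric.sphere (0 : 𝔼 N) 1 =>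
          ‖gradient (gauge f) (θ : 𝔼 N) - g θ‖) (surface N) :=
        (hgd.comp_measurable measurable_subtype_coe).norm
      have hi1 : Integrable (fun θ : Metric.sphere (0 : 𝔼 N) 1 =>
          ‖gradient (gauge f) (θ : 𝔼 N)‖ * (gauge f (θ : 𝔼 N) ^ N)⁻¹) (surface N) := by
        refine Integrable.of_bound (C := K * 2 ^ N) (hgm.norm.mul hwm).aestronglyMeasurable
          (Eventually.of_forall fun θ => ?_)
        rw [norm_mul, norm_norm, Real.norm_of_nonneg (hw θ).2.le]
        exact mul_le_mul (hKn _) (hw θ).1 (hw θ).2.le K.coe_nonneg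
      have hi2 : Integrable (fun θ : Metric.sphere (0 : 𝔼 N) 1 =>
          2 ^ N * (κ + 2 * ‖gradient (gauge f) (θ : 𝔼 N) - g θ‖)) (surface N) :=
        ((integrable_const κ).add (hgd'.const_mul 2)).const_mul _
      have hi3 : Integrable (fun θ : Metric.sphere (0 : 𝔼 N) 1 =>
          inner ℝ (gradient (gauge f) (θ : 𝔼 N)) ((Real.sqrt (κ ^ 2 + ‖g θ‖ ^ 2))⁻¹ • g θ) *
            (gauge f (θ : 𝔼 N) ^ N)⁻¹) (surface N) := by
        have hgc : Continuous (fun θ : Metric.sphere (0 : 𝔼 N) 1 =>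
            (Real.sqrt (κ ^ 2 + ‖g θ‖ ^ 2))⁻¹ • g θ) :=
          (contDiff_regularized_normalize hg hκ).continuous.comp continuous_subtype_val
        obtain ⟨C, hC⟩ := (HasCompactSupport.of_compactSpace
          _).exists_bound_of_continuous hgc
        refine Integrable.of_bound (C := K * C * 2 ^ N)
          ((hgm.inner hgc.measurable).mul hwm).aestronglyMeasurable
          (Eventually.of_forall fun θ => ?_)
        rw [norm_mul, Real.norm_of_nonneg (hw θ).2.le]
        have hC0 : 0 ≤ C := (norm_nonneg _).trans (hC θ)
        refine mul_le_mul ?_ (hw θ).1 (hw θ).2.le (by positivity)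
        exact (norm_inner_le_norm _ _).trans
          (mul_le_mul (hKn _) (hC θ) (norm_nonneg _) K.coe_nonneg)
      calc A - κ * (2 ^ N * (m + 2))
          ≤ A - ∫ θ : Metric.sphere (0 : 𝔼 N) 1,
              2 ^ N * (κ + 2 * ‖gradient (gauge f) (θ : 𝔼 N) - g θ‖) ∂(surface N) := by
            rw [integral_const_mul, integral_add (integrable_const κ) (hgd'.const_mul 2),
              integral_const_mul, integral_const, smul_eq_mul, ← hm]
            have : (0 : ℝ) < 2 ^ N := by positivity
            nlinarith
        _ = ∫ θ : Metric.sphere (0 : 𝔼 N) 1,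
              (‖gradient (gauge f) (θ : 𝔼 N)‖ * (gauge f (θ : 𝔼 N) ^ N)⁻¹ -
              2 ^ N * (κ + 2 * ‖gradient (gauge f) (θ : 𝔼 N) - g θ‖)) ∂(surface N) :=
            (integral_sub hi1 hi2).symm
        _ ≤ _ := integral_mono (hi1.sub hi2) hi3 fun θ => by
            have h3 := norm_sub_le_inner_regularized (gradient (gauge f) (θ : 𝔼 N)) (g θ) hκ
            have h4 := hw θ
            have h5 : 0 ≤ κ + 2 * ‖gradient (gauge f) (θ : 𝔼 N) - g θ‖ := by positivity
            simp only
            calc _ ≤ ‖gradient (gauge f) (θ : 𝔼 N)‖ * (gauge f (θ : 𝔼 N) ^ N)⁻¹ -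
                  (gauge f (θ : 𝔼 N) ^ N)⁻¹ *
                    (κ + 2 * ‖gradient (gauge f) (θ : 𝔼 N) - g θ‖) := by
                  gcongr; exact h4.1
              _ = (‖gradient (gauge f) (θ : 𝔼 N)‖ - κ -
                  2 * ‖gradient (gauge f) (θ : 𝔼 N) - g θ‖) * (gauge f (θ : 𝔼 N) ^ N)⁻¹ := by ring
              _ ≤ _ := mul_le_mul_of_nonneg_right h3 h4.2.le
    · rw [norm_smul, norm_inv, Real.norm_of_nonneg (Real.sqrt_nonneg _)]
      have h3 : 0 < κ ^ 2 + ‖g x‖ ^ 2 := by positivity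
      rw [inv_mul_le_iff₀ (Real.sqrt_pos.2 h3), mul_one]
      exact Real.le_sqrt_of_sq_le (by nlinarith)
  have ht : Tendsto (fun κ : ℝ => ENNReal.ofReal (R ^ (N - 1) * (A - κ * (2 ^ N * (m + 2)))))
      (𝓝[>] 0) (𝓝 (ENNReal.ofReal (R ^ (N - 1) * (A - 0 * (2 ^ N * (m + 2)))))) := by
    refine (ENNReal.continuous_ofReal.comp ?_).continuousAt.tendsto.mono_left nhdsWithin_le_nhds
    fun_prop
  rw [zero_mul, sub_zero] at ht
  exact le_of_tendsto ht (by filter_upwards [self_mem_nhdsWithin] with κ hκ using key κ hκ)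

end Perimeter

/-! ### Compactly supported Lipschitz functions belong to `H¹₀` -/

section SobolevApproximation

theorem tendsto_eLpNorm_two_of_dominated {V : Type*} [NormedAddCommGroup V]
    {F : ℕ → (𝔼 N) → V} {k : Set (𝔼 N)} (hk : IsCompact k) {C : ℝ}
    (hF : ∀ n, AEStronglyMeasurable (F n)) (hb : ∀ n x, ‖F n x‖ ≤ C)
    (h0 : ∀ n x, x ∉ k → F n x = 0) (hlim : ∀ᵐ x, Tendsto (fun n => F n x) atTop (𝓝 0)) :
    Tendsto (fun n => eLpNorm (F n) 2 volume) atTop (𝓝 0) := by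
  have h1 : Tendsto (fun n => ∫⁻ x, ‖F n x‖ₑ ^ 2) atTop (𝓝 (∫⁻ _ : 𝔼 N, 0)) := by
    refine tendsto_lintegral_of_dominated_convergence'
      (k.indicator fun _ => ENNReal.ofReal C ^ 2) (fun n => (hF n).enorm.pow_const 2)
      (fun n => Eventually.of_forall fun x => ?_) ?_ ?_
    · by_cases hx : x ∈ k
      · rw [indicator_of_mem hx]
        refine pow_le_pow_left' ?_ 2
        rw [← ofReal_norm]
        exact ENNReal.ofReal_le_ofReal (hb n x)
      · simp [h0 n x hx]
    · rw [lintegral_indicator_const hk.measurableSet]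
      exact ENNReal.mul_ne_top (by finiteness) hk.measure_lt_top.ne
    · filter_upwards [hlim] with x hx
      have h2 : Tendsto (fun n => ‖F n x‖ₑ ^ 2) atTop (𝓝 (‖(0 : V)‖ₑ ^ 2)) :=
        (((ENNReal.continuous_pow 2).comp continuous_enorm).tendsto (0 : V)).comp hx
      simpa using h2
  rw [lintegral_zero] at h1
  have h3 : ∀ n, eLpNorm (F n) 2 volume = (∫⁻ x, ‖F n x‖ₑ ^ 2) ^ (1 / 2 : ℝ) := by
    intro n
    rw [eLpNorm_eq_lintegral_rpow_enorm_toReal (by norm_num) (by norm_num)]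
    simp
  simp only [h3]
  have h4 : Tendsto (fun n => (∫⁻ x, ‖F n x‖ₑ ^ 2) ^ (1 / 2 : ℝ)) atTop
      (𝓝 ((0 : ℝ≥0∞) ^ (1 / 2 : ℝ))) :=
    ((ENNReal.continuous_rpow_const (y := (1 / 2 : ℝ))).tendsto 0).comp h1
  rwa [ENNReal.zero_rpow_of_pos (by norm_num)] at h4

/-- Differentiation under the integral falls on the Lipschitz factor: its difference quotients are
bounded by `K`, and its derivative exists almost everywhere. -/
theorem hasFDerivAt_normed_convolution {v : (𝔼 N) → ℝ} {K : ℝ≥0} (hv : LipschitzWith K v)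
    (b : ContDiffBump (0 : 𝔼 N)) (x : 𝔼 N) :
    HasFDerivAt (convolution (b.normed volume) v (ContinuousLinearMap.lsmul ℝ ℝ) volume)
      (convolution (b.normed volume) (fderiv ℝ v) (ContinuousLinearMap.lsmul ℝ ℝ) volume x) x := by
  have hbi : Integrable (b.normed (volume : Measure (𝔼 N))) := b.integrable_normed
  unfold convolution
  simp only [ContinuousLinearMap.lsmul_apply]
  have hcont : ∀ y, Continuous (fun t => b.normed volume t • v (y - t)) := fun y =>
    b.continuous_normed.smul (hv.continuous.comp (continuous_const.sub continuous_id))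
  refine (hasFDerivAt_integral_of_dominated_loc_of_lip (s := univ)
    (bound := fun t => K * b.normed volume t) univ_mem
    (Eventually.of_forall fun y => (hcont y).aestronglyMeasurable) ?_ ?_ ?_ ?_ ?_).2
  · exact (hcont x).integrable_of_hasCompactSupport b.hasCompactSupport_normed.smul_right
  · refine (b.continuous_normed.measurable.smul ?_).aestronglyMeasurable
    exact (measurable_fderiv ℝ v).comp (measurable_const.sub measurable_id)
  · refine Eventually.of_forall fun t => ?_
    refine LipschitzOnWith.of_dist_le_mul fun y _ z _ => ?_
    have h1 := hv.dist_le_mul (y - t) (z - t)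
    rw [dist_sub_right] at h1
    rw [Real.coe_nnabs, Real.dist_eq, ← smul_sub, smul_eq_mul, abs_mul, abs_mul, ← Real.dist_eq,
      NNReal.abs_eq]
    nlinarith [abs_nonneg (b.normed volume t)]
  · exact hbi.const_mul _
  · have h1 : ∀ᵐ y : 𝔼 N, DifferentiableAt ℝ v y := hv.ae_differentiableAt
    have h2 := ((volume : Measure (𝔼 N)).measurePreserving_sub_left
      x).quasiMeasurePreserving.ae h1
    filter_upwards [h2] with t ht
    have h3 : HasFDerivAt (fun y => v (y - t)) (fderiv ℝ v (x - t)) x := by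
      have := ht.hasFDerivAt.comp x ((hasFDerivAt_id x).sub_const t)
      exact this
    exact h3.const_smul (b.normed volume t)

/-- Mollification. Values and gradients stay bounded, supports stay in one compact subset of `Ω`,
and gradients converge almost everywhere by Lebesgue differentiation; dominated convergence gives
the `L²` limits. -/
theorem memH10_of_lipschitz {Ω : Set (𝔼 N)} (hΩ : IsOpen Ω) {v : (𝔼 N) → ℝ} {K : ℝ≥0}
    (hv : LipschitzWith K v) (hc : HasCompactSupport v) (hs : tsupport v ⊆ Ω) :
    MemH10 Ω v (gradient v) := by
  obtain ⟨δ, hδ, hδΩ⟩ := hc.isCompact.exists_cthickening_subset_open hΩ hs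
  have hk : IsCompact (Metric.cthickening δ (tsupport v)) := hc.isCompact.cthickening
  have hvk : ∀ x, x ∉ Metric.cthickening δ (tsupport v) → v x = 0 := fun x hx =>
    image_eq_zero_of_notMem_tsupport fun h => hx (Metric.self_subset_cthickening _ h)
  have hgK : ∀ x, ‖gradient v x‖ ≤ K := fun x => by
    rw [norm_gradient]; exact norm_fderiv_le_of_lipschitz ℝ hv
  have hgk : ∀ x, x ∉ Metric.cthickening δ (tsupport v) → gradient v x = 0 := fun x hx => by
    rw [← norm_eq_zero, norm_gradient, norm_eq_zero]
    exact fderiv_of_notMem_tsupport ℝ fun h => hx (Metric.self_subset_cthickening _ h)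
  have hδn : ∀ n : ℕ, 0 < δ / ((n : ℝ) + 1) := fun n => by positivity
  -- Outer radii at most `δ` keep the supports inside `Ω`; the fixed ratio 2 of the radii is what
  -- Lebesgue differentiation asks of the kernels.
  let b : ℕ → ContDiffBump (0 : 𝔼 N) := fun n =>
    ⟨δ / ((n : ℝ) + 1) / 2, δ / ((n : ℝ) + 1), half_pos (hδn n), half_lt_self (hδn n)⟩
  have hb0 : Tendsto (fun n => (b n).rOut) atTop (𝓝 0) := by
    have := tendsto_one_div_add_atTop_nhds_zero_nat.const_mul δ
    simpa [b, div_eq_mul_inv] using this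
  set φ : ℕ → (𝔼 N) → ℝ := fun n =>
    convolution ((b n).normed volume) v (ContinuousLinearMap.lsmul ℝ ℝ) volume with hφ
  have hsm : ∀ n, ContDiff ℝ ∞ (φ n) := fun n =>
    (b n).hasCompactSupport_normed.contDiff_convolution_left _ (b n).contDiff_normed
      hv.continuous.locallyIntegrable
  have hsub : ∀ n, Function.support (φ n) ⊆ Metric.cthickening δ (tsupport v) := by
    intro n x hx
    obtain ⟨y, hy, z, hz, rfl⟩ := (support_convolution_subset _ hx)
    rw [(b n).support_normed_eq, mem_ball_zero_iff] at hy
    refine Metric.mem_cthickening_of_dist_le _ z _ _ (subset_tsupport _ hz) ?_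
    rw [dist_eq_norm, add_sub_cancel_right]
    refine hy.le.trans (div_le_self hδ.le ?_)
    linarith [n.cast_nonneg (α := ℝ)]
  have htsub : ∀ n, tsupport (φ n) ⊆ Metric.cthickening δ (tsupport v) := fun n =>
    closure_minimal (hsub n) Metric.isClosed_cthickening
  have hφk : ∀ n x, x ∉ Metric.cthickening δ (tsupport v) → φ n x = 0 := fun n x hx =>
    image_eq_zero_of_notMem_tsupport fun h => hx (htsub n h)
  have hgφk : ∀ n x, x ∉ Metric.cthickening δ (tsupport v) → gradient (φ n) x = 0 :=
    fun n x hx => by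
      rw [← norm_eq_zero, norm_gradient, norm_eq_zero]
      exact fderiv_of_notMem_tsupport ℝ fun h => hx (htsub n h)
  have hgφK : ∀ n x, ‖gradient (φ n) x‖ ≤ K := by
    intro n x
    rw [norm_gradient, (hasFDerivAt_normed_convolution hv (b n) x).fderiv]
    have h1 : ∫ t, (b n).normed volume t * (K : ℝ) = K := by
      rw [integral_mul_const, (b n).integral_normed, one_mul]
    rw [← h1]
    refine norm_integral_le_of_norm_le ((b n).integrable_normed.mul_const _)
      (Eventually.of_forall fun t => ?_)
    rw [ContinuousLinearMap.lsmul_apply, norm_smul, Real.norm_of_nonneg ((b n).nonneg_normed t)]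
    exact mul_le_mul_of_nonneg_left (norm_fderiv_le_of_lipschitz ℝ hv) ((b n).nonneg_normed t)
  have hdist : ∀ n x, |φ n x - v x| ≤ K * δ := by
    intro n x
    rw [← Real.dist_eq]
    refine (b n).dist_normed_convolution_le hv.continuous.aestronglyMeasurable fun y hy => ?_
    refine (hv.dist_le_mul y x).trans (mul_le_mul_of_nonneg_left ?_ K.coe_nonneg)
    refine (Metric.mem_ball.1 hy).le.trans (div_le_self hδ.le ?_)
    linarith [n.cast_nonneg (α := ℝ)]
  refine ⟨hv.continuous.memLp_of_hasCompactSupport hc, ?_, φ, fun n => ⟨hsm n, ?_, ?_⟩, ?_, ?_⟩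
  · have h1 : MemLp ((Metric.cthickening δ (tsupport v)).indicator fun _ => (K : ℝ)) 2 volume :=
      memLp_indicator_const 2 hk.measurableSet _ (Or.inr hk.measure_lt_top.ne)
    refine h1.mono (measurable_gradient v).aestronglyMeasurable (Eventually.of_forall fun x => ?_)
    by_cases hx : x ∈ Metric.cthickening δ (tsupport v)
    · rw [indicator_of_mem hx, Real.norm_of_nonneg K.coe_nonneg]
      exact hgK x
    · rw [hgk x hx, norm_zero]; exact norm_nonneg _
  · exact HasCompactSupport.of_support_subset_isCompact hk (hsub n)
  · exact (htsub n).trans hδΩ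
  · refine tendsto_eLpNorm_two_of_dominated hk (C := K * δ)
      (fun n => ((hsm n).continuous.sub hv.continuous).aestronglyMeasurable)
      (fun n x => hdist n x) (fun n x hx => by simp [hφk n x hx, hvk x hx])
      (Eventually.of_forall fun x => ?_)
    have := ContDiffBump.convolution_tendsto_right_of_continuous (μ := volume) hb0 hv.continuous x
    simpa using this.sub_const (v x)
  · refine tendsto_eLpNorm_two_of_dominated hk (C := K + K)
      (fun n => ((measurable_gradient _).sub (measurable_gradient _)).aestronglyMeasurable)
      (fun n x => (norm_sub_le _ _).trans (add_le_add (hgφK n x) (hgK x)))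
      (fun n x hx => by simp [hgφk n x hx, hgk x hx]) ?_
    have hli : LocallyIntegrable (fderiv ℝ v) volume := by
      have h1 : MemLp (fderiv ℝ v) ∞ volume :=
        memLp_top_of_bound (measurable_fderiv ℝ v).aestronglyMeasurable K
          (Eventually.of_forall fun x => norm_fderiv_le_of_lipschitz ℝ hv)
      exact h1.locallyIntegrable le_top
    have h2 := ContDiffBump.ae_convolution_tendsto_right_of_locallyIntegrable (μ := volume)
      (K := 2) hb0 (Eventually.of_forall fun n => by simp only [b]; linarith) hli
    filter_upwards [h2] with x hx
    have h3 : ∀ n, fderiv ℝ (φ n) x = convolution ((b n).normed volume) (fderiv ℝ v)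
        (ContinuousLinearMap.lsmul ℝ ℝ) volume x := fun n =>
      (hasFDerivAt_normed_convolution hv (b n) x).fderiv
    have h4 : Tendsto (fun n => gradient (φ n) x) atTop (𝓝 (gradient v x)) := by
      unfold gradient
      simp only [h3]
      exact ((InnerProductSpace.toDual ℝ (𝔼 N)).symm.continuous.tendsto _).comp hx
    simpa using h4.sub_const (gradient v x)

end SobolevApproximation

/-! ### Variational bounds and comparison of the first eigenvalues -/

section Eigenvalue

theorem lpNorm_two_sq {V : Type*} [NormedAddCommGroup V] {μ : Measure (𝔼 N)} {F : (𝔼 N) → V}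
    (hF : AEStronglyMeasurable F μ) : lpNorm F 2 μ ^ 2 = ∫ x, ‖F x‖ ^ 2 ∂μ := by
  rw [lpNorm_eq_integral_norm_rpow_toReal (by norm_num) (by norm_num) hF]
  have h0 : 0 ≤ ∫ x, ‖F x‖ ^ 2 ∂μ := integral_nonneg fun x => by positivity
  simp only [ENNReal.toReal_ofNat, Real.rpow_ofNat]
  rw [← Real.rpow_natCast, ← Real.rpow_mul h0]
  norm_num

theorem tendsto_integral_norm_sq {V : Type*} [NormedAddCommGroup V] {μ : Measure (𝔼 N)}
    {F : ℕ → (𝔼 N) → V} {G : (𝔼 N) → V} (hF : ∀ n, MemLp (F n) 2 μ) (hG : MemLp G 2 μ)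
    (h : Tendsto (fun n => eLpNorm (F n - G) 2 μ) atTop (𝓝 0)) :
    Tendsto (fun n => ∫ x, ‖F n x‖ ^ 2 ∂μ) atTop (𝓝 (∫ x, ‖G x‖ ^ 2 ∂μ)) := by
  have h1 : Tendsto (fun n => lpNorm (F n - G) 2 μ) atTop (𝓝 0) := by
    have := (ENNReal.tendsto_toReal ENNReal.zero_ne_top).comp h
    refine (this.congr fun n => ?_)
    exact toReal_eLpNorm ((hF n).sub hG).aestronglyMeasurable
  have h2 : Tendsto (fun n => lpNorm (F n) 2 μ) atTop (𝓝 (lpNorm G 2 μ)) := by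
    rw [tendsto_iff_dist_tendsto_zero]
    refine squeeze_zero (fun n => dist_nonneg) (fun n => ?_) h1
    have e1 : lpNorm (F n) 2 μ ≤ lpNorm G 2 μ + lpNorm (F n - G) 2 μ := by
      have := lpNorm_add_le (p := 2) (μ := μ) hG (g := F n - G) (by norm_num)
      rwa [add_sub_cancel] at this
    have e2 : lpNorm G 2 μ ≤ lpNorm (F n) 2 μ + lpNorm (F n - G) 2 μ := by
      have := lpNorm_add_le (p := 2) (μ := μ) (hF n) (g := G - F n) (by norm_num)
      rwa [add_sub_cancel, lpNorm_sub_comm] at this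
    rw [Real.dist_eq, abs_le]
    constructor <;> linarith
  have h3 := h2.pow 2
  rw [lpNorm_two_sq hG.aestronglyMeasurable] at h3
  exact h3.congr fun n => lpNorm_two_sq (hF n).aestronglyMeasurable

theorem integrable_norm_sq_of_hasCompactSupport {V : Type*} [NormedAddCommGroup V]
    {G : (𝔼 N) → V} (hG : Continuous G) (hc : HasCompactSupport G) :
    Integrable (fun x => ‖G x‖ ^ 2) := by
  have h1 : Continuous fun x => ‖G x‖ ^ 2 := by fun_prop
  refine h1.integrable_of_hasCompactSupport (HasCompactSupport.intro hc fun x hx => ?_)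
  rw [image_eq_zero_of_notMem_tsupport hx, norm_zero, zero_pow two_ne_zero]

/-- The product form of the Rayleigh bound also covers `v = 0`, so it can be integrated over
families of test functions, some of which may vanish. -/
theorem lambda1_mul_integral_sq_le {Ω : Set (𝔼 N)} (hΩ : IsOpen Ω) {v : (𝔼 N) → ℝ} {K : ℝ≥0}
    (hv : LipschitzWith K v) (hc : HasCompactSupport v) (hs : tsupport v ⊆ Ω) :
    lambda1 Ω * ∫ x, v x ^ 2 ≤ ∫ x, ‖gradient v x‖ ^ 2 := by
  have h0 : 0 ≤ ∫ x, v x ^ 2 := integral_nonneg fun x => sq_nonneg _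
  have h0' : 0 ≤ ∫ x, ‖gradient v x‖ ^ 2 := integral_nonneg fun x => sq_nonneg _
  rcases h0.eq_or_lt with h | h
  · rw [← h, mul_zero]; exact h0'
  have e1 : ∫ x in Ω, v x ^ 2 = ∫ x, v x ^ 2 := by
    refine setIntegral_eq_integral_of_forall_compl_eq_zero fun x hx => ?_
    rw [image_eq_zero_of_notMem_tsupport fun h => hx (hs h)]; simp
  have e2 : ∫ x in Ω, ‖gradient v x‖ ^ 2 = ∫ x, ‖gradient v x‖ ^ 2 := by
    refine setIntegral_eq_integral_of_forall_compl_eq_zero fun x hx => ?_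
    rw [norm_gradient, fderiv_of_notMem_tsupport ℝ fun h => hx (hs h)]; simp
  rw [← le_div_iff₀ h]
  refine csInf_le ⟨0, ?_⟩ ⟨v, gradient v, memH10_of_lipschitz hΩ hv hc hs, fun hv0 => ?_, ?_⟩
  · rintro q ⟨u, g, -, -, rfl⟩
    exact div_nonneg (integral_nonneg fun x => sq_nonneg _) (integral_nonneg fun x => sq_nonneg _)
  · have : ∫ x, v x ^ 2 = ∫ _ : 𝔼 N, (0 : ℝ) := by
      refine integral_congr_ae ?_
      filter_upwards [hv0] with x hx
      simp [hx]
    rw [this, integral_zero] at h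
    exact lt_irrefl _ h
  · rw [e1, e2]

theorem continuous_gradient_of_contDiff {φ : (𝔼 N) → ℝ} (hφ : ContDiff ℝ ∞ φ)
    (hc : HasCompactSupport φ) : Continuous (gradient φ) ∧ HasCompactSupport (gradient φ) := by
  have h1 : Continuous (fderiv ℝ φ) := hφ.continuous_fderiv (by simp)
  refine ⟨(InnerProductSpace.toDual ℝ (𝔼 N)).symm.continuous.comp h1, ?_⟩
  exact (hc.fderiv ℝ).comp_left (map_zero _)

/-- The product inequality passes from test functions to `H¹₀` by `L²` convergence. Nonemptiness of
`Ω` makes the set of Rayleigh quotients nonempty; the infimum of the empty set would be 0. -/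
theorem le_lambda1 {Ω : Set (𝔼 N)} (hΩ : IsOpen Ω) (hne : Ω.Nonempty) {c : ℝ}
    (h : ∀ φ : (𝔼 N) → ℝ, ContDiff ℝ ∞ φ → HasCompactSupport φ → tsupport φ ⊆ Ω →
      c * ∫ x, φ x ^ 2 ≤ ∫ x, ‖gradient φ x‖ ^ 2) : c ≤ lambda1 Ω := by
  refine le_csInf ?_ ?_
  · obtain ⟨x₀, hx₀⟩ := hne
    obtain ⟨r, hr, hrΩ⟩ := Metric.isOpen_iff.1 hΩ x₀ hx₀
    let b : ContDiffBump x₀ := ⟨r / 4, r / 2, by positivity, by linarith⟩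
    have hbΩ : tsupport b ⊆ Ω := by
      rw [b.tsupport_eq]
      refine (Metric.closedBall_subset_ball ?_).trans hrΩ
      simp only [b]; linarith
    obtain ⟨K, hK⟩ := ContDiff.lipschitzWith_of_hasCompactSupport b.hasCompactSupport
      (b.contDiff (n := 1)) one_ne_zero
    refine ⟨_, b, gradient b, memH10_of_lipschitz hΩ hK b.hasCompactSupport hbΩ, fun h0 => ?_, rfl⟩
    have h1 : (b : (𝔼 N) → ℝ) = 0 :=
      (Continuous.ae_eq_iff_eq volume b.continuous continuous_const).1 h0
    have h2 := b.one_of_mem_closedBall (Metric.mem_closedBall_self b.rIn_pos.le)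
    rw [h1] at h2
    simp at h2
  · rintro q ⟨u, g, ⟨hu, hg, φ, hφ, hφu, hφg⟩, hu0, rfl⟩
    have m1 : ∀ n, MemLp (φ n) 2 (volume.restrict Ω) := fun n =>
      ((hφ n).1.continuous.memLp_of_hasCompactSupport (hφ n).2.1).restrict Ω
    have m2 : ∀ n, MemLp (gradient (φ n)) 2 (volume.restrict Ω) := fun n =>
      ((continuous_gradient_of_contDiff (hφ n).1 (hφ n).2.1).1.memLp_of_hasCompactSupport
        (continuous_gradient_of_contDiff (hφ n).1 (hφ n).2.1).2).restrict Ω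
    have t1 := tendsto_integral_norm_sq m1 (hu.restrict Ω) (tendsto_of_tendsto_of_tendsto_of_le_of_le
      tendsto_const_nhds hφu (fun _ => zero_le) (fun n => eLpNorm_restrict_le _ _ _ _))
    have t2 := tendsto_integral_norm_sq m2 (hg.restrict Ω) (tendsto_of_tendsto_of_tendsto_of_le_of_le
      tendsto_const_nhds hφg (fun _ => zero_le) (fun n => eLpNorm_restrict_le _ _ _ _))
    have hle : c * ∫ x in Ω, ‖u x‖ ^ 2 ≤ ∫ x in Ω, ‖g x‖ ^ 2 := by
      refine le_of_tendsto_of_tendsto' (t1.const_mul c) t2 fun n => ?_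
      have e1 : ∫ x in Ω, ‖φ n x‖ ^ 2 = ∫ x, φ n x ^ 2 := by
        simp only [Real.norm_eq_abs, sq_abs]
        refine setIntegral_eq_integral_of_forall_compl_eq_zero fun x hx => ?_
        rw [image_eq_zero_of_notMem_tsupport fun h => hx ((hφ n).2.2 h)]; simp
      have e2 : ∫ x in Ω, ‖gradient (φ n) x‖ ^ 2 = ∫ x, ‖gradient (φ n) x‖ ^ 2 := by
        refine setIntegral_eq_integral_of_forall_compl_eq_zero fun x hx => ?_
        rw [norm_gradient, fderiv_of_notMem_tsupport ℝ fun h => hx ((hφ n).2.2 h)]; simp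
      rw [e1, e2]
      exact h _ (hφ n).1 (hφ n).2.1 (hφ n).2.2
    simp only [Real.norm_eq_abs, sq_abs] at hle
    have hpos : 0 < ∫ x in Ω, u x ^ 2 := by
      refine lt_of_le_of_ne (integral_nonneg fun x => sq_nonneg _) fun hzero => hu0 ?_
      have hi : Integrable (fun x => u x ^ 2) (volume.restrict Ω) := (hu.restrict Ω).integrable_sq
      have z1 := (integral_eq_zero_iff_of_nonneg (fun x => sq_nonneg (u x)) hi).1 hzero.symm
      -- As a limit of functions supported in `Ω`, `u` vanishes almost everywhere outside `Ω`; hence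
      -- `∫_Ω u² = 0` would force `u = 0`.
      have z2 : eLpNorm u 2 (volume.restrict Ωᶜ) = 0 := by
        refine le_antisymm ?_ (zero_le)
        refine ge_of_tendsto hφu (Eventually.of_forall fun n => ?_)
        refine le_trans (le_of_eq ?_) (eLpNorm_restrict_le (φ n - u) 2 volume Ωᶜ)
        rw [← eLpNorm_neg]
        refine eLpNorm_congr_ae ?_
        filter_upwards [ae_restrict_mem hΩ.measurableSet.compl] with x hx
        have : φ n x = 0 := image_eq_zero_of_notMem_tsupport fun h => hx ((hφ n).2.2 h)
        simp [this]
      rw [eLpNorm_eq_zero_iff (hu.restrict _).aestronglyMeasurable (by norm_num)] at z2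
      have z3 := ae_restrict_iff' hΩ.measurableSet |>.1 z1
      have z4 := ae_restrict_iff' hΩ.measurableSet.compl |>.1 z2
      filter_upwards [z3, z4] with x hx1 hx2
      by_cases hx : x ∈ Ω
      · have := hx1 hx
        simpa using this
      · exact hx2 hx
    rwa [le_div_iff₀ hpos]

variable [NeZero N] {f : (𝔼 N) → ℝ}

/-- The profile of `φ` along the single direction `ξ` is transplanted to `{gauge f < R}` by means of
the gauge and used as a test function there. Both integrals then factor into a spherical and a
radial one. -/
theorem lambda1_mul_radial_integral_le (hf : IsProfile f)
    (hb : ∀ x : 𝔼 N, x ≠ 0 → |f x| ≤ 1 / 2) {r R A m : ℝ} (hrR : r < R)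
    (hm : ∫ θ : Metric.sphere (0 : 𝔼 N) 1, (gauge f (θ : 𝔼 N) ^ N)⁻¹ ∂(surface N) = m)
    (hA : ∫ θ : Metric.sphere (0 : 𝔼 N) 1, ‖gradient (gauge f) (θ : 𝔼 N)‖ ^ 2 *
      (gauge f (θ : 𝔼 N) ^ N)⁻¹ ∂(surface N) ≤ A) (hA0 : 0 < A)
    {φ : (𝔼 N) → ℝ} (hφ : ContDiff ℝ ∞ φ) (hφc : HasCompactSupport φ)
    (hφr : ∀ x, r < ‖x‖ → x ∉ tsupport φ) (ξ : Metric.sphere (0 : 𝔼 N) 1) :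
    lambda1 {x | gauge f x < R} * m * ∫ t in Ioi (0 : ℝ), t ^ (N - 1) * φ (t • (ξ : 𝔼 N)) ^ 2 ≤
      A * ∫ t in Ioi (0 : ℝ), t ^ (N - 1) * ‖gradient φ (t • (ξ : 𝔼 N))‖ ^ 2 := by
  obtain ⟨K, hK⟩ := exists_lipschitzWith_gauge hf hb
  have hΩ : IsOpen {x | gauge f x < R} := isOpen_lt hK.continuous continuous_const
  obtain ⟨hgc, hgs⟩ := continuous_gradient_of_contDiff hφ hφc
  have hle : ∀ x : 𝔼 N, ‖x‖ ≤ 2 * gauge f x := fun x => by have := le_gauge hb x; linarith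
  have hξ : ‖(ξ : 𝔼 N)‖ = 1 := norm_eq_of_mem_sphere ξ
  have hnorm : ∀ t : ℝ, ‖t • (ξ : 𝔼 N)‖ = |t| := fun t => by
    rw [norm_smul, hξ, mul_one, Real.norm_eq_abs]
  set v : (𝔼 N) → ℝ := fun x => φ (gauge f x • (ξ : 𝔼 N)) with hv
  set D : ℝ → ℝ := fun t => fderiv ℝ φ (t • (ξ : 𝔼 N)) ξ with hD
  have hφ0 : ∀ t : ℝ, r < |t| → φ (t • (ξ : 𝔼 N)) = 0 := fun t ht =>
    image_eq_zero_of_notMem_tsupport (hφr _ (by rwa [hnorm]))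
  have hD0 : ∀ t : ℝ, r < |t| → fderiv ℝ φ (t • (ξ : 𝔼 N)) = 0 := fun t ht =>
    fderiv_of_notMem_tsupport ℝ (hφr _ (by rwa [hnorm]))
  have hcs : ∀ F : ℝ → ℝ, (∀ t, r < |t| → F t = 0) → HasCompactSupport F := by
    intro F hF
    refine HasCompactSupport.intro (isCompact_Icc (a := -r) (b := r)) fun t ht => hF t ?_
    by_contra hcon
    exact ht (abs_le.1 (not_lt.1 hcon))
  have hline : Continuous fun t : ℝ => t • (ξ : 𝔼 N) := continuous_id.smul continuous_const
  have hDc : Continuous D := ((hφ.continuous_fderiv (by simp)).comp hline).clm_apply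
    continuous_const
  obtain ⟨L, hL⟩ := ContDiff.lipschitzWith_of_hasCompactSupport hφc hφ (by simp)
  have hξl : LipschitzWith 1 (fun t : ℝ => t • (ξ : 𝔼 N)) :=
    LipschitzWith.of_dist_le_mul fun a b => by
      rw [dist_eq_norm, ← sub_smul, hnorm, Real.dist_eq]; simp
  have hvL : LipschitzWith (L * (1 * K)) v := hL.comp (hξl.comp hK)
  have hvs : Function.support v ⊆ {x | gauge f x ≤ r} := by
    intro x hx
    by_contra hcon
    refine hx (hφ0 _ ?_)
    rw [abs_of_nonneg (gauge_nonneg hb x)]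
    exact not_le.1 hcon
  have hcl : IsClosed {x | gauge f x ≤ r} := isClosed_le hK.continuous continuous_const
  have hvt : tsupport v ⊆ {x | gauge f x ≤ r} := closure_minimal hvs hcl
  have hvc : HasCompactSupport v := by
    refine HasCompactSupport.of_support_subset_isCompact
      (isCompact_closedBall (0 : 𝔼 N) (2 * r)) fun x hx => ?_
    have h1 : gauge f x ≤ r := hvs hx
    rw [mem_closedBall_zero_iff]
    linarith [hle x]
  have hmain := lambda1_mul_integral_sq_le hΩ hvL hvc
    (hvt.trans fun x (hx : gauge f x ≤ r) => by exact hx.trans_lt hrR)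
  have e1 : ∫ x, v x ^ 2 = m * ∫ t in Ioi (0 : ℝ), t ^ (N - 1) * φ (t • (ξ : 𝔼 N)) ^ 2 := by
    have h1 := integral_comp_gauge (gauge_smul hf) (gauge_pos hb) (G := fun _ => 1)
      (F := fun t => φ (t • (ξ : 𝔼 N)) ^ 2) (fun _ _ _ => rfl)
      (integrable_comp_mul_bounded hK hle ((hφ.continuous.comp hline).pow 2)
        (hcs _ fun t ht => by simp [hφ0 t ht]) aestronglyMeasurable_const (C := 1) (by simp))
    simp only [mul_one, one_mul] at h1
    rw [← hm, ← h1]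
  have e2 : ∫ x, ‖gradient v x‖ ^ 2 =
      (∫ θ : Metric.sphere (0 : 𝔼 N) 1, ‖gradient (gauge f) (θ : 𝔼 N)‖ ^ 2 *
        (gauge f (θ : 𝔼 N) ^ N)⁻¹ ∂(surface N)) *
      ∫ t in Ioi (0 : ℝ), t ^ (N - 1) * D t ^ 2 := by
    have hgK : ∀ x, ‖gradient (gauge f) x‖ ≤ K := fun x => by
      rw [norm_gradient]; exact norm_fderiv_le_of_lipschitz ℝ hK
    rw [← integral_comp_gauge (gauge_smul hf) (gauge_pos hb)
      (G := fun x => ‖gradient (gauge f) x‖ ^ 2) (F := fun t => D t ^ 2)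
      (fun r x hr => by rw [gradient_gauge_smul hf r x hr])
      (integrable_comp_mul_bounded hK hle (hDc.pow 2)
        (hcs _ fun t ht => by simp [hD, hD0 t ht])
        ((measurable_gradient _).norm.pow_const 2).aestronglyMeasurable (C := K ^ 2)
        (fun x => by rw [abs_of_nonneg (sq_nonneg _)]; gcongr; exact hgK x))]
    refine integral_congr_ae ?_
    filter_upwards [hK.ae_differentiableAt] with x hx
    have h2 : HasFDerivAt v ((fderiv ℝ φ (gauge f x • (ξ : 𝔼 N))).comp
        ((fderiv ℝ (gauge f) x).smulRight (ξ : 𝔼 N))) x :=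
      ((hφ.differentiable (by simp) _).hasFDerivAt).comp x (hx.hasFDerivAt.smul_const (ξ : 𝔼 N))
    have h3 : gradient v x = D (gauge f x) • gradient (gauge f) x := by
      refine ext_inner_right ℝ fun y => ?_
      rw [inner_smul_left, inner_gradient_left, inner_gradient_left, h2.fderiv]
      simp [hD, mul_comm]
    rw [h3, norm_smul, mul_pow, Real.norm_eq_abs, sq_abs]
  rw [e1, e2, ← mul_assoc] at hmain
  have hi : ∀ F : ℝ → ℝ, Continuous F → (∀ t, r < |t| → F t = 0) →
      IntegrableOn (fun t => t ^ (N - 1) * F t) (Ioi 0) := fun F hF h0 =>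
    (((continuous_id.pow (N - 1)).mul hF).integrable_of_hasCompactSupport
      (hcs F h0).mul_left).integrableOn
  have hJ0 : 0 ≤ ∫ t in Ioi (0 : ℝ), t ^ (N - 1) * D t ^ 2 :=
    setIntegral_nonneg measurableSet_Ioi fun t ht => by
      have : (0 : ℝ) < t := ht
      positivity
  calc _ ≤ _ := hmain
    _ ≤ A * ∫ t in Ioi (0 : ℝ), t ^ (N - 1) * D t ^ 2 := mul_le_mul_of_nonneg_right hA hJ0
    _ ≤ _ := by
      refine mul_le_mul_of_nonneg_left ?_ hA0.le
      refine setIntegral_mono_on (hi _ (hDc.pow 2) fun t ht => by simp [hD, hD0 t ht])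
        (hi _ ((hgc.comp hline).norm.pow 2) fun t ht => by simp [norm_gradient, hD0 t ht])
        measurableSet_Ioi fun t ht => ?_
      have ht' : (0 : ℝ) < t := ht
      refine mul_le_mul_of_nonneg_left ?_ (by positivity)
      -- The derivative in the unit direction `ξ` is at most the full gradient.
      rw [norm_gradient, ← sq_abs (D t)]
      refine pow_le_pow_left₀ (abs_nonneg _) ?_ 2
      have := (fderiv ℝ φ (t • (ξ : 𝔼 N))).le_opNorm ξ
      rwa [hξ, mul_one] at this

/-- Integrating the one-direction inequality over `ξ` restores `∫ φ²` and `∫ |∇φ|²` in polar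
coordinates. Neither radial symmetry nor existence of an eigenfunction of the ball is involved. -/
theorem lambda1_mul_le_of_profile (hf : IsProfile f) (hb : ∀ x : 𝔼 N, x ≠ 0 → |f x| ≤ 1 / 2)
    {R A m : ℝ} (hR : 0 < R)
    (hm : ∫ θ : Metric.sphere (0 : 𝔼 N) 1, (gauge f (θ : 𝔼 N) ^ N)⁻¹ ∂(surface N) = m)
    (hA : ∫ θ : Metric.sphere (0 : 𝔼 N) 1, ‖gradient (gauge f) (θ : 𝔼 N)‖ ^ 2 *
      (gauge f (θ : 𝔼 N) ^ N)⁻¹ ∂(surface N) ≤ A) (hA0 : 0 < A) :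
    lambda1 {x | gauge f x < R} * m ≤ A * lambda1 (Metric.ball (0 : 𝔼 N) R) := by
  rw [← div_le_iff₀' hA0]
  refine le_lambda1 Metric.isOpen_ball ⟨0, Metric.mem_ball_self hR⟩ fun φ hφ hφc hφR => ?_
  obtain ⟨hgc, hgs⟩ := continuous_gradient_of_contDiff hφ hφc
  -- The support of `φ` is compact in the open ball, so a margin `r < R` exists; it places the
  -- transplanted supports inside the open sublevel set.
  obtain ⟨r, hr0, hrR, hφr⟩ : ∃ r, 0 < r ∧ r < R ∧ ∀ x, r < ‖x‖ → x ∉ tsupport φ := by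
    rcases (tsupport φ).eq_empty_or_nonempty with he | hne
    · exact ⟨R / 2, by positivity, by linarith, fun x _ => by rw [he]; exact notMem_empty x⟩
    · obtain ⟨x₀, hx₀, hmax⟩ := hφc.isCompact.exists_isMaxOn hne continuous_norm.continuousOn
      have h1 : ‖x₀‖ < R := by simpa using hφR hx₀
      refine ⟨max ‖x₀‖ (R / 2), lt_max_of_lt_right (by positivity), max_lt h1 (by linarith),
        fun x hx hx' => ?_⟩
      have := hmax hx'
      simp only [mem_ofPred_eq] at this
      exact absurd (hx.trans_le this) (not_lt.2 (le_max_left _ _))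
  have i1 : Integrable (fun x => φ x ^ 2) := by
    simpa using integrable_norm_sq_of_hasCompactSupport hφ.continuous hφc
  have i2 := integrable_norm_sq_of_hasCompactSupport hgc hgs
  have h := integral_mono
    ((integrable_radial_integral i1).const_mul (lambda1 {x | gauge f x < R} * m))
    ((integrable_radial_integral i2).const_mul A)
    (lambda1_mul_radial_integral_le hf hb hrR hm hA hA0 hφ hφc hφr)
  rw [integral_const_mul, integral_const_mul, ← integral_polar i1, ← integral_polar i2] at h
  rw [div_mul_eq_mul_div, div_le_iff₀ hA0, mul_comm _ A]
  exact h

end Eigenvalue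

/-! ### Polynomial functions and the spherical Laplacian in algebraic form -/

section Polynomials

open MvPolynomial

/-- The polynomial function on the Euclidean space. -/
def polyEval (p : ℙ N) (x : 𝔼 N) : ℝ := MvPolynomial.eval x.ofLp p

theorem polyEval_add (p q : ℙ N) (x : 𝔼 N) : polyEval (p + q) x = polyEval p x + polyEval q x :=
  map_add _ _ _

theorem polyEval_sub (p q : ℙ N) (x : 𝔼 N) : polyEval (p - q) x = polyEval p x - polyEval q x :=
  map_sub _ _ _

theorem polyEval_mul (p q : ℙ N) (x : 𝔼 N) : polyEval (p * q) x = polyEval p x * polyEval q x :=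
  map_mul _ _ _

theorem polyEval_smul (c : ℝ) (p : ℙ N) (x : 𝔼 N) : polyEval (c • p) x = c * polyEval p x :=
  MvPolynomial.smul_eval _ _ _

theorem polyEval_sum {ι : Type*} (s : Finset ι) (p : ι → ℙ N) (x : 𝔼 N) :
    polyEval (∑ i ∈ s, p i) x = ∑ i ∈ s, polyEval (p i) x :=
  map_sum _ _ _

theorem polyEval_zero (x : 𝔼 N) : polyEval (0 : ℙ N) x = 0 := map_zero _

theorem polyEval_one (x : 𝔼 N) : polyEval (1 : ℙ N) x = 1 := map_one _

theorem polyEval_X (i : Fin N) (x : 𝔼 N) : polyEval (X i) x = x i := eval_X i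

theorem polyEval_C (c : ℝ) (x : 𝔼 N) : polyEval (C c : ℙ N) x = c := eval_C c

/-- The derivative of a polynomial function, in terms of the formal partial derivatives. -/
def polyFDeriv (p : ℙ N) (x : 𝔼 N) : (𝔼 N) →L[ℝ] ℝ :=
  ∑ i, polyEval (pderiv i p) x • (EuclideanSpace.proj i : (𝔼 N) →L[ℝ] ℝ)

theorem polyFDeriv_apply (p : ℙ N) (x v : 𝔼 N) :
    polyFDeriv p x v = ∑ i, polyEval (pderiv i p) x * v i := by
  simp [polyFDeriv]

theorem hasFDerivAt_polyEval_C (a : ℝ) (x : 𝔼 N) :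
    HasFDerivAt (polyEval (C a : ℙ N)) (polyFDeriv (C a : ℙ N) x) x := by
  have h0 : polyFDeriv (C a : ℙ N) x = 0 := by
    ext v
    rw [polyFDeriv_apply]
    refine Finset.sum_eq_zero fun i _ => ?_
    rw [pderiv_C, polyEval_zero, zero_mul]
  rw [h0]
  refine HasFDerivAt.congr_of_eventuallyEq (hasFDerivAt_const a x) ?_
  exact Eventually.of_forall fun y => polyEval_C a y

theorem hasFDerivAt_polyEval_add {p q : ℙ N} {x : 𝔼 N}
    (hp : HasFDerivAt (polyEval p) (polyFDeriv p x) x)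
    (hq : HasFDerivAt (polyEval q) (polyFDeriv q x) x) :
    HasFDerivAt (polyEval (p + q)) (polyFDeriv (p + q) x) x := by
  have h0 : polyFDeriv (p + q) x = polyFDeriv p x + polyFDeriv q x := by
    ext v
    rw [add_apply]
    simp only [polyFDeriv_apply, map_add, polyEval_add, add_mul, Finset.sum_add_distrib]
  rw [h0]
  refine HasFDerivAt.congr_of_eventuallyEq (hp.add hq) ?_
  exact Eventually.of_forall fun y => polyEval_add p q y

theorem hasFDerivAt_polyEval_mul_X {p : ℙ N} {x : 𝔼 N} (j : Fin N)
    (hp : HasFDerivAt (polyEval p) (polyFDeriv p x) x) :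
    HasFDerivAt (polyEval (p * X j)) (polyFDeriv (p * X j) x) x := by
  have h1 : HasFDerivAt (fun y : 𝔼 N => y j) (EuclideanSpace.proj j : (𝔼 N) →L[ℝ] ℝ) x :=
    (EuclideanSpace.proj j : (𝔼 N) →L[ℝ] ℝ).hasFDerivAt
  have h2 : ∀ i, polyEval (pderiv i (p * X j)) x =
      polyEval p x * (if i = j then 1 else 0) + x j * polyEval (pderiv i p) x := by
    intro i
    rw [Derivation.leibniz, smul_eq_mul, smul_eq_mul, polyEval_add, polyEval_mul, polyEval_mul,
      polyEval_X, pderiv_X]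
    rcases eq_or_ne i j with h | h
    · subst h; rw [Pi.single_eq_same, if_pos rfl, polyEval_one]
    · rw [Pi.single_eq_of_ne' h, if_neg h, polyEval_zero]
  have h0 : polyFDeriv (p * X j) x = polyEval p x • (EuclideanSpace.proj j : (𝔼 N) →L[ℝ] ℝ) +
      x j • polyFDeriv p x := by
    ext v
    rw [add_apply, smul_apply, smul_apply, polyFDeriv_apply, polyFDeriv_apply]
    simp only [h2, add_mul, Finset.sum_add_distrib, mul_ite, mul_one, mul_zero, ite_mul, zero_mul,
      Finset.sum_ite_eq', Finset.mem_univ, if_true, mul_assoc, ← Finset.mul_sum, smul_eq_mul]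
    rfl
  rw [h0]
  refine HasFDerivAt.congr_of_eventuallyEq (hp.mul h1) ?_
  exact Eventually.of_forall fun y => by rw [polyEval_mul, polyEval_X]; rfl

theorem hasFDerivAt_polyEval (p : ℙ N) (x : 𝔼 N) :
    HasFDerivAt (polyEval p) (polyFDeriv p x) x :=
  MvPolynomial.induction_on (motive := fun p => HasFDerivAt (polyEval p) (polyFDeriv p x) x) p
    (fun a => hasFDerivAt_polyEval_C a x) (fun _ _ hp hq => hasFDerivAt_polyEval_add hp hq)
    (fun _ j hp => hasFDerivAt_polyEval_mul_X j hp)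

theorem continuous_polyEval (p : ℙ N) : Continuous (polyEval p) :=
  continuous_iff_continuousAt.2 fun x => (hasFDerivAt_polyEval p x).continuousAt

theorem fderiv_polyEval_single (p : ℙ N) (x : 𝔼 N) (i : Fin N) :
    fderiv ℝ (polyEval p) x (EuclideanSpace.single i 1) = polyEval (pderiv i p) x := by
  rw [(hasFDerivAt_polyEval p x).fderiv, polyFDeriv_apply]
  simp

theorem contDiff_polyEval (p : ℙ N) : ContDiff ℝ 1 (polyEval p) := by
  rw [contDiff_one_iff_fderiv]
  refine ⟨fun x => (hasFDerivAt_polyEval p x).differentiableAt, ?_⟩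
  have : fderiv ℝ (polyEval p) = fun x =>
      ∑ i, polyEval (pderiv i p) x • (EuclideanSpace.proj i : (𝔼 N) →L[ℝ] ℝ) :=
    funext fun x => (hasFDerivAt_polyEval p x).fderiv
  rw [this]
  exact continuous_finsetSum _ fun i _ => (continuous_polyEval _).smul continuous_const

theorem gradient_polyEval_apply (p : ℙ N) (x : 𝔼 N) (i : Fin N) :
    gradient (polyEval p) x i = polyEval (pderiv i p) x := by
  rw [← fderiv_polyEval_single, ← inner_gradient_left, EuclideanSpace.inner_single_right, one_mul,
    conj_trivial]

theorem continuous_gradient_polyEval (p : ℙ N) : Continuous (gradient (polyEval p)) :=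
  (InnerProductSpace.toDual ℝ (𝔼 N)).symm.continuous.comp
    ((contDiff_polyEval p).continuous_fderiv one_ne_zero)

theorem polyEval_smul_of_isHomogeneous {p : ℙ N} {k : ℕ} (hp : p.IsHomogeneous k) (r : ℝ)
    (x : 𝔼 N) : polyEval p (r • x) = r ^ k * polyEval p x := by
  unfold polyEval
  rw [MvPolynomial.eval_eq, MvPolynomial.eval_eq, Finset.mul_sum]
  refine Finset.sum_congr rfl fun d hd => ?_
  have h1 := hp.degree_eq_sum_deg_support hd
  simp only [PiLp.smul_apply, smul_eq_mul, mul_pow, Finset.prod_mul_distrib,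
    Finset.prod_pow_eq_pow_sum]
  rw [h1]
  ring

/-- The Euler operator `∑ Xᵢ ∂ᵢ`. -/
def euler (N : ℕ) : (ℙ N) →ₗ[ℝ] ℙ N :=
  ∑ i, (LinearMap.mulLeft ℝ (X i)) ∘ₗ ((pderiv i : Derivation ℝ (ℙ N) (ℙ N)) : (ℙ N) →ₗ[ℝ] ℙ N)

/-- The Laplacian on polynomials. -/
def lap (N : ℕ) : (ℙ N) →ₗ[ℝ] ℙ N :=
  ∑ i, ((pderiv i : Derivation ℝ (ℙ N) (ℙ N)) : (ℙ N) →ₗ[ℝ] ℙ N) ∘ₗ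
    ((pderiv i : Derivation ℝ (ℙ N) (ℙ N)) : (ℙ N) →ₗ[ℝ] ℙ N)

/-- An operator on polynomials that restricts to minus the Laplace-Beltrami operator of the unit
sphere. -/
def sphLap (N : ℕ) : (ℙ N) →ₗ[ℝ] ℙ N :=
  euler N ∘ₗ euler N + ((N : ℝ) - 2) • euler N - lap N

theorem euler_apply (p : ℙ N) : euler N p = ∑ i, X i * pderiv i p := by
  simp [euler]

theorem lap_apply (p : ℙ N) : lap N p = ∑ i, pderiv i (pderiv i p) := by
  simp [lap]

theorem euler_of_isHomogeneous {p : ℙ N} {k : ℕ} (hp : p.IsHomogeneous k) :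
    euler N p = (k : ℝ) • p := by
  rw [euler_apply, hp.sum_X_mul_pderiv, Nat.cast_smul_eq_nsmul]

theorem sphLap_of_isHomogeneous {p : ℙ N} {k : ℕ} (hp : p.IsHomogeneous k) :
    sphLap N p = ((k : ℝ) * (k + N - 2)) • p - lap N p := by
  simp only [sphLap, LinearMap.sub_apply, LinearMap.add_apply, LinearMap.comp_apply,
    LinearMap.smul_apply, euler_of_isHomogeneous hp, map_smul, smul_smul]
  rw [← add_smul]
  congr 2
  ring

theorem lap_isHomogeneous {p : ℙ N} {k : ℕ} (hp : p.IsHomogeneous k) :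
    (lap N p).IsHomogeneous (k - 1 - 1) := by
  rw [lap_apply]
  exact IsHomogeneous.sum _ _ _ fun i _ => hp.pderiv.pderiv

/-- The coordinates of the field `‖x‖² ∇p - k p x`, tangent to the spheres when `p` is
homogeneous of degree `k`. -/
def tangentField (p : ℙ N) (k : ℕ) (i : Fin N) : ℙ N :=
  (∑ j, X j * X j) * pderiv i p - (k : ℝ) • (X i * p)

theorem sum_X_mul_tangentField {p : ℙ N} {k : ℕ} (hp : p.IsHomogeneous k) :
    ∑ i, X i * tangentField p k i = 0 := by
  have h1 : ∑ i, X i * tangentField p k i =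
      (∑ j, X j * X j) * (∑ i, X i * pderiv i p) - (k : ℝ) • ((∑ j, X j * X j) * p) := by
    simp only [tangentField, mul_sub, Finset.sum_sub_distrib]
    rw [Finset.mul_sum, Finset.sum_mul _ _ p, Finset.smul_sum]
    congr 1
    · exact Finset.sum_congr rfl fun i _ => by ring
    · exact Finset.sum_congr rfl fun i _ => by rw [mul_smul_comm, mul_assoc]
  rw [h1, ← euler_apply, euler_of_isHomogeneous hp, mul_smul_comm, sub_self]

theorem pderiv_sum_X_mul_X (i : Fin N) :
    pderiv i (∑ j, X j * X j : ℙ N) = (2 : ℝ) • X i := by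
  rw [map_sum, Finset.sum_eq_single i]
  · rw [Derivation.leibniz, pderiv_X_self, smul_eq_mul, mul_one, two_smul]
  · intro j _ hj
    rw [Derivation.leibniz, pderiv_X_of_ne hj, smul_zero, add_zero]
  · simp

/-- On the unit sphere the right-hand side is the value of `-sphLap p`; this is the divergence that
produces Green's formula. -/
theorem sum_pderiv_tangentField {p : ℙ N} {k : ℕ} (hp : p.IsHomogeneous k) :
    ∑ i, pderiv i (tangentField p k i) =
      (∑ j, X j * X j) * lap N p - ((k : ℝ) * (k + N - 2)) • p := by
  have h1 : ∀ i, pderiv i (tangentField p k i) = (∑ j, X j * X j) * pderiv i (pderiv i p) +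
      (2 : ℝ) • (X i * pderiv i p) - (k : ℝ) • (X i * pderiv i p + p) := by
    intro i
    rw [tangentField, map_sub, (pderiv i).map_smul, Derivation.leibniz, Derivation.leibniz,
      pderiv_X_self, pderiv_sum_X_mul_X]
    simp only [smul_eq_mul, mul_one]
    rw [mul_smul_comm, mul_comm (pderiv i p)]
  simp only [h1, Finset.sum_sub_distrib, Finset.sum_add_distrib, ← Finset.smul_sum,
    ← Finset.mul_sum, ← euler_apply, ← lap_apply, euler_of_isHomogeneous hp]
  simp only [Finset.sum_const, Finset.card_univ, Fintype.card_fin, smul_add, smul_smul,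
    ← Nat.cast_smul_eq_nsmul ℝ]
  module

theorem norm_sq_eq_polyEval (x : 𝔼 N) : ‖x‖ ^ 2 = polyEval (∑ j, X j * X j : ℙ N) x := by
  rw [EuclideanSpace.norm_sq_eq, polyEval_sum]
  refine Finset.sum_congr rfl fun i _ => ?_
  rw [polyEval_mul, polyEval_X, Real.norm_eq_abs, sq_abs, sq]

/-- The field with coordinates `η(‖x‖²) qᵢ(x)`. -/
def radialField (η : ℝ → ℝ) (q : Fin N → ℙ N) (x : 𝔼 N) : 𝔼 N :=
  WithLp.toLp 2 fun i => η (‖x‖ ^ 2) * polyEval (q i) x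

theorem contDiff_radialField {η : ℝ → ℝ} (hη : ContDiff ℝ 1 η) (q : Fin N → ℙ N) :
    ContDiff ℝ 1 (radialField η q) := by
  rw [contDiff_euclidean]
  intro i
  exact (hη.comp (contDiff_norm_sq ℝ)).mul (contDiff_polyEval (q i))

/-- Differentiating the radial factor only yields multiples of `x · q`, which vanishes for a tangent
field. -/
theorem divergence_radialField {η : ℝ → ℝ} (hη : ContDiff ℝ 1 η) {q : Fin N → ℙ N}
    (hq : ∑ i, X i * q i = 0) (x : 𝔼 N) :
    divergence (radialField η q) x = η (‖x‖ ^ 2) * polyEval (∑ i, pderiv i (q i)) x := by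
  have h1 : ∀ i, fderiv ℝ (radialField η q) x (EuclideanSpace.single i 1) i =
      η (‖x‖ ^ 2) * polyEval (pderiv i (q i)) x +
        2 * deriv η (‖x‖ ^ 2) * polyEval (X i * q i) x := by
    intro i
    rw [fderiv_apply_eq ((contDiff_radialField hη q).differentiable one_ne_zero x)]
    have h2 : HasFDerivAt (fun y : 𝔼 N => η (‖y‖ ^ 2))
        (deriv η (‖x‖ ^ 2) • ((2 : ℝ) • innerSL ℝ x)) x := by
      have h3 := (hasStrictFDerivAt_norm_sq x).hasFDerivAt
      have h4 := ((hη.differentiable one_ne_zero) (‖x‖ ^ 2)).hasDerivAt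
      refine (h4.comp_hasFDerivAt x h3).congr_fderiv ?_
      ext v; simp
    have h5 : HasFDerivAt (fun y : 𝔼 N => η (‖y‖ ^ 2) * polyEval (q i) y) _ x :=
      h2.mul (hasFDerivAt_polyEval (q i) x)
    change fderiv ℝ (fun y : 𝔼 N => η (‖y‖ ^ 2) * polyEval (q i) y) x _ = _
    rw [h5.fderiv, polyEval_mul, polyEval_X]
    rw [add_apply, smul_apply, smul_apply, polyFDeriv_apply]
    simp [EuclideanSpace.inner_single_right]
    ring
  rw [divergence, Finset.sum_congr rfl fun i _ => h1 i, Finset.sum_add_distrib, ← Finset.mul_sum,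
    ← Finset.mul_sum, ← polyEval_sum, ← polyEval_sum, hq, polyEval_zero, mul_zero, add_zero]

end Polynomials

/-! ### Green's formula on the unit sphere -/

section Green

open MvPolynomial

theorem normalize_smul {r : ℝ} (hr : 0 < r) (x : 𝔼 N) : ‖r • x‖⁻¹ • r • x = ‖x‖⁻¹ • x := by
  rw [norm_smul, Real.norm_of_nonneg hr.le, smul_smul, mul_inv_rev, inv_mul_cancel_right₀ hr.ne']

theorem gradient_polyEval_smul {p : ℙ N} {k : ℕ} (hp : p.IsHomogeneous k) {r : ℝ} (hr : r ≠ 0)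
    (x : 𝔼 N) : gradient (polyEval p) (r • x) = (r ^ k / r) • gradient (polyEval p) x :=
  gradient_smul_of_homogeneous hr (fun y => polyEval_smul_of_isHomogeneous hp r y) x

theorem polyEval_lap_smul {p : ℙ N} {k : ℕ} (hp : p.IsHomogeneous k) {r : ℝ} (hr : r ≠ 0)
    (x : 𝔼 N) : polyEval (lap N p) (r • x) = r ^ k / r / r * polyEval (lap N p) x := by
  rw [lap_apply, polyEval_sum, polyEval_sum, Finset.mul_sum]
  refine Finset.sum_congr rfl fun i _ => ?_
  have h1 : ∀ y : 𝔼 N, polyEval (pderiv i p) (r • y) = r ^ k / r * polyEval (pderiv i p) y := by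
    intro y
    rw [← gradient_polyEval_apply, ← gradient_polyEval_apply, gradient_polyEval_smul hp hr]
    rfl
  rw [← gradient_polyEval_apply, ← gradient_polyEval_apply, gradient_smul_of_homogeneous hr h1]
  rfl

theorem IsProfile.measurable {f : (𝔼 N) → ℝ} (hf : IsProfile f) : Measurable f :=
  measurable_of_continuousOn_compl_singleton 0 fun _ hx => (hf.continuousAt hx).continuousWithinAt

theorem gradient_congr_of_eventuallyEq {f g : (𝔼 N) → ℝ} {x : 𝔼 N} (h : f =ᶠ[𝓝 x] g) :
    gradient f x = gradient g x := by
  rw [gradient, gradient, h.fderiv_eq]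

variable {f : (𝔼 N) → ℝ}

theorem setIntegral_Ioi_pos {F : ℝ → ℝ} (hF : Continuous F) (hFs : HasCompactSupport F)
    (h0 : ∀ t, 0 < t → 0 ≤ F t) {a : ℝ} (ha : 0 < a) (hFa : F a ≠ 0) :
    0 < ∫ t in Ioi (0 : ℝ), t ^ (N - 1) * F t := by
  have hc : Continuous fun t : ℝ => t ^ (N - 1) * F t := (continuous_pow _).mul hF
  rw [setIntegral_pos_iff_support_of_nonneg_ae]
  · refine (hc.isOpen_support.inter isOpen_Ioi).measure_pos _ ⟨a, ?_, ha⟩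
    exact mul_ne_zero (pow_ne_zero _ ha.ne') hFa
  · refine (ae_restrict_mem measurableSet_Ioi).mono fun t ht => ?_
    exact mul_nonneg (pow_nonneg (le_of_lt ht) _) (h0 t ht)
  · exact (hc.integrable_of_hasCompactSupport hFs.mul_left).integrableOn

theorem exists_abs_le_of_continuous {g : (𝔼 N) → ℝ} (hg : Continuous g) :
    ∃ C, ∀ θ : Metric.sphere (0 : 𝔼 N) 1, |g θ| ≤ C := by
  obtain ⟨C, hC⟩ := (isCompact_sphere (0 : 𝔼 N) 1).exists_bound_of_continuousOn hg.continuousOn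
  exact ⟨C, fun θ => hC θ θ.2⟩

theorem IsProfile.exists_abs_le (hf : IsProfile f) :
    ∃ C, ∀ θ : Metric.sphere (0 : 𝔼 N) 1, |f θ| ≤ C := by
  obtain ⟨C, hC⟩ := (isCompact_sphere (0 : 𝔼 N) 1).exists_bound_of_continuousOn (f := f)
    fun x hx => (hf.continuousAt (Metric.ne_of_mem_sphere hx one_ne_zero)).continuousWithinAt
  exact ⟨C, fun θ => hC θ θ.2⟩

variable [NeZero N]

theorem integral_radial_mul {F : ℝ → ℝ} (hF : Continuous F) (hFs : HasCompactSupport F)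
    {g : (𝔼 N) → ℝ} (hg : Measurable g) {C : ℝ}
    (hb : ∀ θ : Metric.sphere (0 : 𝔼 N) 1, |g θ| ≤ C) :
    ∫ x : 𝔼 N, F ‖x‖ * g (‖x‖⁻¹ • x) =
      (∫ θ : Metric.sphere (0 : 𝔼 N) 1, g θ ∂(surface N)) *
        ∫ t in Ioi (0 : ℝ), t ^ (N - 1) * F t := by
  have hm : Measurable fun x : 𝔼 N => g (‖x‖⁻¹ • x) :=
    hg.comp (measurable_norm.inv.smul measurable_id)
  have hi : Integrable (fun x : 𝔼 N => F ‖x‖ * g (‖x‖⁻¹ • x)) := by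
    refine integrable_comp_mul_bounded (lipschitzWith_one_norm (E := 𝔼 N))
      (fun x => by linarith [norm_nonneg x]) hF hFs hm.aestronglyMeasurable
      (C := max C |g 0|) fun x => ?_
    rcases eq_or_ne x 0 with rfl | hx
    · simp
    · exact (hb ⟨_, normalize_mem_sphere hx⟩).trans (le_max_left _ _)
  have h := integral_comp_gauge (s := fun x : 𝔼 N => ‖x‖)
    (fun r x hr => by rw [norm_smul, Real.norm_of_nonneg hr.le]) (fun x hx => norm_pos_iff.2 hx)
    (G := fun x => g (‖x‖⁻¹ • x)) (fun r x hr => by rw [normalize_smul hr]) hi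
  simpa using h

/-- Integration by parts in the whole space against `η(|x|²)(|x|² ∇p - k p x)`. By homogeneity both
sides are a spherical integral times the same positive radial factor `∫ tᴺ⁻¹ F(t)`, which cancels.
Surface calculus is not needed. -/
theorem green_sphere_of_isHomogeneous (hf : IsProfile f) {p : ℙ N} {k : ℕ}
    (hp : p.IsHomogeneous k) :
    ∫ θ : Metric.sphere (0 : 𝔼 N) 1, inner ℝ (gradient f (θ : 𝔼 N))
      (gradient (polyEval p) (θ : 𝔼 N)) ∂(surface N) =
    ∫ θ : Metric.sphere (0 : 𝔼 N) 1, f θ * polyEval (sphLap N p) θ ∂(surface N) := by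
  -- A bump in the variable `t²`, vanishing for `0 ≤ t ≤ 1/2` and for `t ≥ 2`, and nonzero at `t =
  -- 1`.
  let b : ContDiffBump (1 : ℝ) := ⟨1 / 4, 1 / 2, by norm_num, by norm_num⟩
  have hb : b.rOut = 1 / 2 := rfl
  set η : ℝ → ℝ := fun t => b t with hη
  have hηd : ContDiff ℝ 1 η := b.contDiff
  have hη0 : ∀ t : ℝ, 0 ≤ t → t ≤ 1 / 2 → η (t ^ 2) = 0 := by
    intro t ht0 ht
    refine b.zero_of_le_dist ?_
    rw [hb, Real.dist_eq, abs_sub_comm, abs_of_nonneg] <;> nlinarith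
  have hη1 : ∀ t : ℝ, 2 ≤ |t| → η (t ^ 2) = 0 := by
    intro t ht
    refine b.zero_of_le_dist ?_
    rw [hb, Real.dist_eq, ← sq_abs, abs_of_nonneg] <;> nlinarith
  set φ := radialField η (tangentField p k) with hφ
  have hφd : ContDiff ℝ 1 φ := contDiff_radialField hηd _
  have hφ0 : ∀ x : 𝔼 N, η (‖x‖ ^ 2) = 0 → φ x = 0 := by
    intro x hx
    ext i
    simp only [hφ, radialField, hx, zero_mul, PiLp.zero_apply]
  have hφc : HasCompactSupport φ := by
    refine HasCompactSupport.intro (isCompact_closedBall (0 : 𝔼 N) 2) fun x hx => ?_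
    rw [mem_closedBall_zero_iff, not_le] at hx
    exact hφ0 x (hη1 ‖x‖ (by rw [abs_norm]; exact hx.le))
  -- The extension equals `f` for `‖x‖ ≥ 1/4`, hence near every point where the cutoff is nonzero.
  obtain ⟨K, w, hw, hfw⟩ := hf.exists_lipschitz_extension (δ := 1 / 4) (by norm_num)
  have hibp := integral_inner_gradient_eq hw hφd hφc
  set F : ℝ → ℝ := fun t => η (t ^ 2) * t ^ k with hF
  have hFc : Continuous F := (b.continuous.comp (continuous_pow 2)).mul (continuous_pow k)
  have hFs : HasCompactSupport F := by
    refine HasCompactSupport.intro (isCompact_Icc (a := (-2 : ℝ)) (b := 2)) fun t ht => ?_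
    have : 2 ≤ |t| := by
      by_contra hcon
      exact ht (abs_le.1 (not_le.1 hcon).le)
    simp only [hF, hη1 t this, zero_mul]
  have hpos : 0 < ∫ t in Ioi (0 : ℝ), t ^ (N - 1) * F t := by
    refine setIntegral_Ioi_pos hFc hFs
      (fun t ht => mul_nonneg b.nonneg (pow_nonneg ht.le _)) one_pos ?_
    have : η 1 = 1 := b.one_of_mem_closedBall (Metric.mem_closedBall_self b.rIn_pos.le)
    simp only [hF, one_pow, mul_one, this]
    exact one_ne_zero
  have e1 : ∀ x, inner ℝ (gradient w x) (φ x) =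
      F ‖x‖ * (fun y => inner ℝ (gradient f y) (gradient (polyEval p) y)) (‖x‖⁻¹ • x) := by
    intro x
    rcases le_or_gt ‖x‖ (1 / 2) with hx | hx
    · have h0 := hη0 ‖x‖ (norm_nonneg x) hx
      simp only [hφ0 x h0, inner_zero_right, hF, h0, zero_mul]
    · have hr : 0 < ‖x‖ := by linarith
      have hwx : gradient w x = gradient f x := by
        refine gradient_congr_of_eventuallyEq ?_
        filter_upwards [(IsProfile.isOpen_lt_norm (1 / 2)).mem_nhds hx] with y (hy : 1 / 2 < ‖y‖)
        exact (hfw y (by linarith)).symm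
      have hφx : φ x = η (‖x‖ ^ 2) • (‖x‖ ^ 2 • gradient (polyEval p) x -
          (k * polyEval p x) • x) := by
        ext i
        simp only [hφ, radialField, tangentField, polyEval_sub, polyEval_mul, polyEval_smul,
          ← norm_sq_eq_polyEval, polyEval_X, PiLp.smul_apply, PiLp.sub_apply, smul_eq_mul,
          gradient_polyEval_apply]
        ring
      have hxn : x = ‖x‖ • (‖x‖⁻¹ • x) := by rw [smul_smul, mul_inv_cancel₀ hr.ne', one_smul]
      have hgf : gradient f x = ‖x‖⁻¹ • gradient f (‖x‖⁻¹ • x) := by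
        conv_lhs => rw [hxn]
        exact hf.gradient_smul hr _
      have hgp : gradient (polyEval p) x =
          (‖x‖ ^ k / ‖x‖) • gradient (polyEval p) (‖x‖⁻¹ • x) := by
        conv_lhs => rw [hxn]
        exact gradient_polyEval_smul hp hr.ne' _
      rw [hwx, hφx, inner_smul_right, inner_sub_right, inner_smul_right, inner_smul_right,
        real_inner_comm x, hf.inner_gradient, hgf, hgp, inner_smul_left, inner_smul_right,
        conj_trivial]
      simp only [hF]
      field_simp
      ring
  have e2 : ∀ x, w x * divergence φ x = F ‖x‖ *
      (fun y => f y * (-polyEval (sphLap N p) y)) (‖x‖⁻¹ • x) := by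
    intro x
    rw [hφ, divergence_radialField hηd (sum_X_mul_tangentField hp), sum_pderiv_tangentField hp,
      sphLap_of_isHomogeneous hp]
    rcases le_or_gt ‖x‖ (1 / 2) with hx | hx
    · have h0 := hη0 ‖x‖ (norm_nonneg x) hx
      simp only [hF, h0, zero_mul, mul_zero]
    · have hr : 0 < ‖x‖ := by linarith
      have hx0 : x ≠ 0 := norm_pos_iff.1 hr
      have hxn : x = ‖x‖ • (‖x‖⁻¹ • x) := by rw [smul_smul, mul_inv_cancel₀ hr.ne', one_smul]
      have hp1 : polyEval p x = ‖x‖ ^ k * polyEval p (‖x‖⁻¹ • x) := by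
        conv_lhs => rw [hxn]
        exact polyEval_smul_of_isHomogeneous hp _ _
      have hp2 : polyEval (lap N p) x =
          ‖x‖ ^ k / ‖x‖ / ‖x‖ * polyEval (lap N p) (‖x‖⁻¹ • x) := by
        conv_lhs => rw [hxn]
        exact polyEval_lap_smul hp hr.ne' _
      simp only [hF]
      rw [← hfw x (by linarith), polyEval_sub, polyEval_sub, polyEval_mul, polyEval_smul,
        polyEval_smul, ← norm_sq_eq_polyEval, hf.apply_normalize hx0, hp1, hp2]
      field_simp
      ring
  obtain ⟨C1, hC1⟩ := hf.exists_norm_gradient_le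
  obtain ⟨C2, hC2⟩ := exists_abs_le_of_continuous (continuous_gradient_polyEval p).norm
  obtain ⟨C3, hC3⟩ := hf.exists_abs_le
  obtain ⟨C4, hC4⟩ := exists_abs_le_of_continuous (continuous_polyEval (sphLap N p))
  rw [integral_congr_ae (Eventually.of_forall e1), integral_congr_ae (Eventually.of_forall e2),
    integral_radial_mul hFc hFs ((measurable_gradient f).inner (measurable_gradient _))
      (C := C1 * C2), integral_radial_mul hFc hFs
      (g := fun y => f y * (-polyEval (sphLap N p) y))
      (hf.measurable.mul (continuous_polyEval _).measurable.neg) (C := C3 * C4), ← neg_mul] at hibp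
  · have := mul_right_cancel₀ hpos.ne' hibp
    rw [this, ← integral_neg]
    simp only [mul_neg, neg_neg]
  · intro θ
    rw [abs_mul, abs_neg]
    exact mul_le_mul (hC3 θ) (hC4 θ) (abs_nonneg _) ((abs_nonneg _).trans (hC3 θ))
  · intro θ
    refine (abs_real_inner_le_norm _ _).trans ?_
    have h2 := hC2 θ
    rw [abs_norm] at h2
    exact mul_le_mul (hC1 θ) h2 (norm_nonneg _) ((norm_nonneg _).trans (hC1 θ))

end Green

/-! ### The `L²` product and the Dirichlet form on polynomials -/

section SphericalForm

open MvPolynomial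

variable {f : (𝔼 N) → ℝ}

theorem integrable_sphere_of_bound {g : (𝔼 N) → ℝ} (hg : Measurable g) {C : ℝ}
    (hb : ∀ θ : Metric.sphere (0 : 𝔼 N) 1, |g θ| ≤ C) :
    Integrable (fun θ : Metric.sphere (0 : 𝔼 N) 1 => g θ) (surface N) :=
  Integrable.of_bound (hg.comp measurable_subtype_coe).aestronglyMeasurable C
    (Eventually.of_forall hb)

theorem IsProfile.integrable_inner_gradient (hf : IsProfile f) {v : (𝔼 N) → 𝔼 N}
    (hv : Measurable v) {C : ℝ} (hb : ∀ θ : Metric.sphere (0 : 𝔼 N) 1, ‖v θ‖ ≤ C) :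
    Integrable (fun θ : Metric.sphere (0 : 𝔼 N) 1 => inner ℝ (gradient f (θ : 𝔼 N)) (v θ))
      (surface N) := by
  obtain ⟨K, hK⟩ := hf.exists_norm_gradient_le
  refine integrable_sphere_of_bound (g := fun x => inner ℝ (gradient f x) (v x))
    ((measurable_gradient f).inner hv) (C := K * C) fun θ => ?_
  exact (abs_real_inner_le_norm _ _).trans
    (mul_le_mul (hK θ) (hb θ) (norm_nonneg _) ((norm_nonneg _).trans (hK θ)))

theorem IsProfile.integrable_inner_gradient_polyEval (hf : IsProfile f) (p : ℙ N) :
    Integrable (fun θ : Metric.sphere (0 : 𝔼 N) 1 => inner ℝ (gradient f (θ : 𝔼 N))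
      (gradient (polyEval p) θ)) (surface N) := by
  obtain ⟨C, hC⟩ := exists_abs_le_of_continuous (continuous_gradient_polyEval p).norm
  exact hf.integrable_inner_gradient (measurable_gradient _) (C := C)
    fun θ => (le_abs_self _).trans (hC θ)

theorem IsProfile.integrable_mul_polyEval (hf : IsProfile f) (p : ℙ N) :
    Integrable (fun θ : Metric.sphere (0 : 𝔼 N) 1 => f θ * polyEval p θ) (surface N) :=
  integrable_sphere_of_continuous
    (hf.continuous_sphere.mul ((continuous_polyEval p).comp continuous_subtype_val))

theorem gradient_polyEval_add (p q : ℙ N) (x : 𝔼 N) :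
    gradient (polyEval (p + q)) x = gradient (polyEval p) x + gradient (polyEval q) x := by
  ext i
  rw [PiLp.add_apply, gradient_polyEval_apply, gradient_polyEval_apply, gradient_polyEval_apply,
    map_add, polyEval_add]

theorem gradient_polyEval_zero (x : 𝔼 N) : gradient (polyEval (0 : ℙ N)) x = 0 := by
  ext i
  rw [gradient_polyEval_apply, map_zero, polyEval_zero, PiLp.zero_apply]

theorem green_sphere [NeZero N] (hf : IsProfile f) (p : ℙ N) :
    ∫ θ : Metric.sphere (0 : 𝔼 N) 1, inner ℝ (gradient f (θ : 𝔼 N))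
      (gradient (polyEval p) (θ : 𝔼 N)) ∂(surface N) =
    ∫ θ : Metric.sphere (0 : 𝔼 N) 1, f θ * polyEval (sphLap N p) θ ∂(surface N) := by
  have key : ∀ q r : ℙ N,
      (∫ θ : Metric.sphere (0 : 𝔼 N) 1, inner ℝ (gradient f (θ : 𝔼 N))
        (gradient (polyEval q) (θ : 𝔼 N)) ∂(surface N) =
      ∫ θ : Metric.sphere (0 : 𝔼 N) 1, f θ * polyEval (sphLap N q) θ ∂(surface N)) →
      (∫ θ : Metric.sphere (0 : 𝔼 N) 1, inner ℝ (gradient f (θ : 𝔼 N))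
        (gradient (polyEval r) (θ : 𝔼 N)) ∂(surface N) =
      ∫ θ : Metric.sphere (0 : 𝔼 N) 1, f θ * polyEval (sphLap N r) θ ∂(surface N)) →
      (∫ θ : Metric.sphere (0 : 𝔼 N) 1, inner ℝ (gradient f (θ : 𝔼 N))
        (gradient (polyEval (q + r)) (θ : 𝔼 N)) ∂(surface N) =
      ∫ θ : Metric.sphere (0 : 𝔼 N) 1, f θ * polyEval (sphLap N (q + r)) θ ∂(surface N)) := by
    intro q r hq hr
    simp only [gradient_polyEval_add, inner_add_right, map_add, polyEval_add, mul_add]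
    rw [integral_add (hf.integrable_inner_gradient_polyEval q)
      (hf.integrable_inner_gradient_polyEval r), integral_add (hf.integrable_mul_polyEval _)
      (hf.integrable_mul_polyEval _), hq, hr]
  rw [← sum_homogeneousComponent p]
  refine Finset.sum_induction _ (fun q : ℙ N =>
    ∫ θ : Metric.sphere (0 : 𝔼 N) 1, inner ℝ (gradient f (θ : 𝔼 N))
      (gradient (polyEval q) (θ : 𝔼 N)) ∂(surface N) =
    ∫ θ : Metric.sphere (0 : 𝔼 N) 1, f θ * polyEval (sphLap N q) θ ∂(surface N)) key ?_ ?_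
  · simp only [gradient_polyEval_zero, inner_zero_right, map_zero, polyEval_zero, mul_zero]
  · intro i _
    exact green_sphere_of_isHomogeneous hf (homogeneousComponent_isHomogeneous i p)

/-- The extension, constant on rays, of the restriction of a polynomial to the unit sphere. -/
def polyProfile (p : ℙ N) (x : 𝔼 N) : ℝ := polyEval p (‖x‖⁻¹ • x)

theorem polyProfile_sphere (p : ℙ N) (θ : Metric.sphere (0 : 𝔼 N) 1) :
    polyProfile p (θ : 𝔼 N) = polyEval p θ := by
  rw [polyProfile, norm_eq_of_mem_sphere, inv_one, one_smul]

/-- This lets a polynomial play the role of `f` in Green's formula, which yields the symmetry and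
positivity of `sphLap` for the spherical product. -/
theorem isProfile_polyProfile (p : ℙ N) : IsProfile (polyProfile p) := by
  refine ⟨fun r x hr => by rw [polyProfile, normalize_smul hr, polyProfile], ?_⟩
  obtain ⟨K, hK⟩ := (contDiff_polyEval p).contDiffOn.exists_lipschitzOnWith one_ne_zero
    (convex_closedBall (0 : 𝔼 N) 1) (isCompact_closedBall 0 1)
  refine ⟨K, fun x hx y hy => ?_⟩
  have h1 := hK (Metric.sphere_subset_closedBall hx) (Metric.sphere_subset_closedBall hy)
  rwa [← polyProfile_sphere p ⟨x, hx⟩, ← polyProfile_sphere p ⟨y, hy⟩] at h1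

theorem gradient_polyProfile (p : ℙ N) (θ : Metric.sphere (0 : 𝔼 N) 1) :
    gradient (polyProfile p) (θ : 𝔼 N) = gradient (polyEval p) (θ : 𝔼 N) -
      inner ℝ (θ : 𝔼 N) (gradient (polyEval p) (θ : 𝔼 N)) • (θ : 𝔼 N) := by
  have hθ : ‖(θ : 𝔼 N)‖ = 1 := norm_eq_of_mem_sphere θ
  have h1 : HasFDerivAt (fun x : 𝔼 N => ‖x‖) (innerSL ℝ (θ : 𝔼 N)) (θ : 𝔼 N) := by
    have := (hasStrictFDerivAt_norm_sq (θ : 𝔼 N)).hasFDerivAt.sqrt (by simp [hθ])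
    simp only [Real.sqrt_sq (norm_nonneg _), hθ] at this
    refine this.congr_fderiv ?_
    ext v
    simp
  have h2 : HasFDerivAt (fun x : 𝔼 N => ‖x‖⁻¹) (-innerSL ℝ (θ : 𝔼 N)) (θ : 𝔼 N) := by
    refine ((hasDerivAt_inv (by rw [hθ]; exact one_ne_zero)).comp_hasFDerivAt (θ : 𝔼 N)
      h1).congr_fderiv ?_
    ext v
    simp [hθ]
  have h3 : HasFDerivAt (fun x : 𝔼 N => ‖x‖⁻¹ • x) _ (θ : 𝔼 N) :=
    h2.smul (hasFDerivAt_id (θ : 𝔼 N))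
  have h4 : HasFDerivAt (polyEval p) (fderiv ℝ (polyEval p) θ) (‖(θ : 𝔼 N)‖⁻¹ • (θ : 𝔼 N)) := by
    rw [hθ, inv_one, one_smul]
    exact ((contDiff_polyEval p).differentiable one_ne_zero _).hasFDerivAt
  have h5 : HasFDerivAt (polyProfile p) _ (θ : 𝔼 N) :=
    HasFDerivAt.comp (f := fun x : 𝔼 N => ‖x‖⁻¹ • x) (θ : 𝔼 N) h4 h3
  refine HasGradientAt.gradient ?_
  rw [hasGradientAt_iff_hasFDerivAt]
  refine h5.congr_fderiv ?_
  ext v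
  rw [InnerProductSpace.toDual_apply_apply, inner_sub_left, inner_smul_left, inner_gradient_left]
  rw [real_inner_comm, inner_gradient_left]
  simp [hθ]
  ring

theorem inner_gradient_polyProfile {v : 𝔼 N} (p : ℙ N) (θ : Metric.sphere (0 : 𝔼 N) 1)
    (hv : inner ℝ (θ : 𝔼 N) v = 0) :
    inner ℝ v (gradient (polyProfile p) (θ : 𝔼 N)) =
      inner ℝ v (gradient (polyEval p) (θ : 𝔼 N)) := by
  rw [gradient_polyProfile, inner_sub_right, inner_smul_right, real_inner_comm (θ : 𝔼 N) v, hv,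
    mul_zero, sub_zero]

theorem integrable_mul_polyEval (p q : ℙ N) :
    Integrable (fun θ : Metric.sphere (0 : 𝔼 N) 1 => polyEval p θ * polyEval q θ) (surface N) :=
  integrable_sphere_of_continuous (((continuous_polyEval p).mul (continuous_polyEval q)).comp
    continuous_subtype_val)

/-- The scalar product of `L²` of the unit sphere on polynomials. -/
def sphInner (N : ℕ) : (ℙ N) →ₗ[ℝ] (ℙ N) →ₗ[ℝ] ℝ :=
  LinearMap.mk₂ ℝ
    (fun p q => ∫ θ : Metric.sphere (0 : 𝔼 N) 1, polyEval p θ * polyEval q θ ∂(surface N))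
    (fun p q r => by
      simp only [polyEval_add, add_mul]
      exact integral_add (integrable_mul_polyEval _ _) (integrable_mul_polyEval _ _))
    (fun c p q => by
      simp only [polyEval_smul, mul_assoc]
      exact integral_const_mul _ _)
    (fun p q r => by
      simp only [polyEval_add, mul_add]
      exact integral_add (integrable_mul_polyEval _ _) (integrable_mul_polyEval _ _))
    (fun c p q => by
      simp only [polyEval_smul, mul_left_comm _ c]
      exact integral_const_mul _ _)

theorem sphInner_apply (p q : ℙ N) : sphInner N p q =
    ∫ θ : Metric.sphere (0 : 𝔼 N) 1, polyEval p θ * polyEval q θ ∂(surface N) := rfl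

theorem sphInner_comm (p q : ℙ N) : sphInner N p q = sphInner N q p := by
  simp only [sphInner_apply, mul_comm]

theorem sphInner_self_nonneg (p : ℙ N) : 0 ≤ sphInner N p p :=
  integral_nonneg fun _ => mul_self_nonneg _

variable [NeZero N]

theorem sphInner_sphLap (p q : ℙ N) : sphInner N p (sphLap N q) =
    ∫ θ : Metric.sphere (0 : 𝔼 N) 1, (inner ℝ (gradient (polyEval p) (θ : 𝔼 N))
      (gradient (polyEval q) (θ : 𝔼 N)) - inner ℝ (θ : 𝔼 N) (gradient (polyEval p) (θ : 𝔼 N)) *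
        inner ℝ (θ : 𝔼 N) (gradient (polyEval q) (θ : 𝔼 N))) ∂(surface N) := by
  have h := green_sphere (isProfile_polyProfile p) q
  simp only [polyProfile_sphere, gradient_polyProfile, inner_sub_left, inner_smul_left,
    conj_trivial] at h
  exact h.symm

theorem sphInner_sphLap_comm (p q : ℙ N) :
    sphInner N p (sphLap N q) = sphInner N q (sphLap N p) := by
  rw [sphInner_sphLap, sphInner_sphLap]
  refine integral_congr_ae (Eventually.of_forall fun θ => ?_)
  simp only
  rw [real_inner_comm (gradient (polyEval q) (θ : 𝔼 N)), mul_comm]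

theorem integral_norm_gradient_polyProfile_sq (p : ℙ N) :
    ∫ θ : Metric.sphere (0 : 𝔼 N) 1, ‖gradient (polyProfile p) (θ : 𝔼 N)‖ ^ 2 ∂(surface N) =
      sphInner N p (sphLap N p) := by
  have h := green_sphere (isProfile_polyProfile p) p
  simp only [polyProfile_sphere] at h
  rw [sphInner_apply, ← h]
  refine integral_congr_ae (Eventually.of_forall fun θ => ?_)
  simp only
  rw [← inner_gradient_polyProfile p θ ((isProfile_polyProfile p).inner_gradient _),
    real_inner_self_eq_norm_sq]

theorem sphInner_sphLap_self_nonneg (p : ℙ N) : 0 ≤ sphInner N p (sphLap N p) := by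
  rw [← integral_norm_gradient_polyProfile_sq]
  exact integral_nonneg fun _ => by positivity

/-- Green's formula and `2 u·v ≤ |u|² + |v|²`. When `p` is an `L²` projection of `f`, this becomes a
Bessel inequality for the Dirichlet energy. -/
theorem two_mul_integral_mul_sphLap_le (hf : IsProfile f) (p : ℙ N) :
    2 * ∫ θ : Metric.sphere (0 : 𝔼 N) 1, f θ * polyEval (sphLap N p) θ ∂(surface N) ≤
      (∫ θ : Metric.sphere (0 : 𝔼 N) 1, ‖gradient f (θ : 𝔼 N)‖ ^ 2 ∂(surface N)) +
        sphInner N p (sphLap N p) := by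
  rw [← green_sphere hf, ← integral_norm_gradient_polyProfile_sq, ← integral_const_mul,
    ← integral_add hf.integrable_norm_gradient_sq
      (isProfile_polyProfile p).integrable_norm_gradient_sq]
  refine integral_mono ((hf.integrable_inner_gradient_polyEval p).const_mul 2)
    (hf.integrable_norm_gradient_sq.add (isProfile_polyProfile p).integrable_norm_gradient_sq)
    fun θ => ?_
  have h := norm_sub_sq_real (gradient f (θ : 𝔼 N)) (gradient (polyProfile p) (θ : 𝔼 N))
  rw [inner_gradient_polyProfile p θ (hf.inner_gradient _)] at h
  have h2 : 0 ≤ ‖gradient f (θ : 𝔼 N) - gradient (polyProfile p) (θ : 𝔼 N)‖ ^ 2 := by positivity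
  simp only
  linarith

end SphericalForm

/-! ### The filtration by degree -/

section Filtration

open MvPolynomial

theorem map_mem_of_forall_isHomogeneous {p : ℙ N} {d : ℕ} {L : (ℙ N) →ₗ[ℝ] ℙ N}
    {V : Submodule ℝ (ℙ N)} (hp : p.totalDegree ≤ d)
    (h : ∀ k ≤ d, ∀ q : ℙ N, q.IsHomogeneous k → L q ∈ V) : L p ∈ V := by
  rw [← sum_homogeneousComponent p, map_sum]
  refine Submodule.sum_mem _ fun k hk => h k ?_ _ (homogeneousComponent_isHomogeneous k p)
  have := Finset.mem_range.1 hk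
  omega

theorem mem_restrictTotalDegree_of_isHomogeneous {p : ℙ N} {k d : ℕ}
    (hp : p.IsHomogeneous k) (h : k ≤ d) : p ∈ restrictTotalDegree (Fin N) ℝ d :=
  (mem_restrictTotalDegree _ _ _).2 (hp.totalDegree_le.trans h)

theorem sphLap_mem {p : ℙ N} {d : ℕ} (hp : p ∈ restrictTotalDegree (Fin N) ℝ d) :
    sphLap N p ∈ restrictTotalDegree (Fin N) ℝ d := by
  refine map_mem_of_forall_isHomogeneous ((mem_restrictTotalDegree _ _ _).1 hp) fun k hk q hq => ?_
  rw [sphLap_of_isHomogeneous hq]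
  exact Submodule.sub_mem _ (Submodule.smul_mem _ _ (mem_restrictTotalDegree_of_isHomogeneous hq hk))
    (mem_restrictTotalDegree_of_isHomogeneous (lap_isHomogeneous hq) (by omega))

/-- The operator is triangular for the filtration: it multiplies the component of degree `d + 1` by
`(d+1)(d+N-1)`, and the Laplacian lowers degrees. -/
theorem sphLap_sub_smul_mem {p : ℙ N} {d : ℕ} (hp : p ∈ restrictTotalDegree (Fin N) ℝ (d + 1)) :
    sphLap N p - (((d + 1 : ℕ) : ℝ) * ((d + 1 : ℕ) + N - 2)) • p ∈
      restrictTotalDegree (Fin N) ℝ d := by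
  refine map_mem_of_forall_isHomogeneous
    (L := sphLap N - (((d + 1 : ℕ) : ℝ) * ((d + 1 : ℕ) + N - 2)) • LinearMap.id)
    ((mem_restrictTotalDegree _ _ _).1 hp) fun k hk q hq => ?_
  rw [LinearMap.sub_apply, sphLap_of_isHomogeneous hq, LinearMap.smul_apply, LinearMap.id_apply,
    sub_right_comm, ← sub_smul]
  refine Submodule.sub_mem _ ?_ (mem_restrictTotalDegree_of_isHomogeneous (lap_isHomogeneous hq) (by omega))
  rcases hk.lt_or_eq with h | h
  · exact Submodule.smul_mem _ _ (mem_restrictTotalDegree_of_isHomogeneous hq (by omega))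
  · subst h
    rw [sub_self, zero_smul]
    exact Submodule.zero_mem _

/-- The restriction of a polynomial to the unit sphere. -/
def polySphere (N : ℕ) : (ℙ N) →ₗ[ℝ] C(Metric.sphere (0 : 𝔼 N) 1, ℝ) where
  toFun p := ⟨fun θ => polyEval p θ, (continuous_polyEval p).comp continuous_subtype_val⟩
  map_add' p q := by ext θ; exact polyEval_add p q θ
  map_smul' c p := by ext θ; exact polyEval_smul c p θ

/-- Orthogonal projection in `L²` of the sphere onto the restrictions of polynomials of degree at
most `d`. The polynomial `q` is a representative, polynomials vanishing on the sphere being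
invisible. -/
theorem exists_projection {F : Metric.sphere (0 : 𝔼 N) 1 → ℝ} (hF : Continuous F) (d : ℕ) :
    ∃ q ∈ restrictTotalDegree (Fin N) ℝ d, ∀ r ∈ restrictTotalDegree (Fin N) ℝ d,
      ∫ θ, F θ * polyEval r θ ∂(surface N) = sphInner N q r := by
  let T : (ℙ N) →ₗ[ℝ] Lp ℝ 2 (surface N) :=
    (ContinuousMap.toLp 2 (surface N) ℝ).toLinearMap ∘ₗ polySphere N
  let W : Submodule ℝ (Lp ℝ 2 (surface N)) := (restrictTotalDegree (Fin N) ℝ d).map T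
  let u : Lp ℝ 2 (surface N) := ContinuousMap.toLp 2 (surface N) ℝ ⟨F, hF⟩
  obtain ⟨q, hq, hqu⟩ := W.starProjection_apply_mem u
  refine ⟨q, hq, fun r hr => ?_⟩
  have h1 := W.sub_starProjection_mem_orthogonal u
  rw [← hqu, Submodule.mem_orthogonal] at h1
  have h2 := h1 (T r) ⟨r, hr, rfl⟩
  rw [inner_sub_right, sub_eq_zero] at h2
  have h3 := ContinuousMap.inner_toLp (𝕜 := ℝ) (μ := surface N) (polySphere N r) ⟨F, hF⟩
  have h4 := ContinuousMap.inner_toLp (𝕜 := ℝ) (μ := surface N) (polySphere N r) (polySphere N q)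
  exact h3.symm.trans (h2.trans h4)

end Filtration

/-! ### Spectral gap and Poincaré inequality on the sphere -/

section Poincare

open MvPolynomial

theorem restrictTotalDegree_mono {d e : ℕ} (h : d ≤ e) {p : ℙ N}
    (hp : p ∈ restrictTotalDegree (Fin N) ℝ d) : p ∈ restrictTotalDegree (Fin N) ℝ e :=
  (mem_restrictTotalDegree _ _ _).2 (((mem_restrictTotalDegree _ _ _).1 hp).trans h)

theorem IsProfile.integrable_sq {f : (𝔼 N) → ℝ} (hf : IsProfile f) :
    Integrable (fun θ : Metric.sphere (0 : 𝔼 N) 1 => f θ ^ 2) (surface N) :=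
  integrable_sphere_of_continuous (hf.continuous_sphere.pow 2)

theorem sphLap_C (c : ℝ) : sphLap N (C c) = 0 := by
  simp [sphLap, euler_apply, lap_apply]

theorem sphLap_X (i : Fin N) : sphLap N (X i) = ((N : ℝ) - 1) • X i := by
  have h : lap N (X i) = 0 := by
    rw [lap_apply]
    refine Finset.sum_eq_zero fun j _ => ?_
    rcases eq_or_ne i j with rfl | hij
    · rw [pderiv_X_self, pderiv_one]
    · rw [pderiv_X_of_ne hij, map_zero]
  rw [sphLap_of_isHomogeneous (isHomogeneous_X ℝ i), h, sub_zero]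
  congr 1
  push_cast
  ring

theorem sphInner_one_one : sphInner N 1 1 = (surface N).real univ := by
  simp [sphInner_apply, polyEval_one]

/-- The component of degree 1 is recovered from its partial derivatives, which are constants, by
Euler's identity. -/
theorem exists_affine_of_mem {r : ℙ N} (hr : r ∈ restrictTotalDegree (Fin N) ℝ 1) :
    ∃ (c : ℝ) (b : Fin N → ℝ), r = c • 1 + ∑ i, b i • X i := by
  have h1 := sum_homogeneousComponent r
  have h2 : ∀ k, 1 < k → homogeneousComponent k r = 0 := fun k hk =>
    homogeneousComponent_eq_zero _ _ (((mem_restrictTotalDegree _ _ _).1 hr).trans_lt hk)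
  have h3 : r = homogeneousComponent 0 r + homogeneousComponent 1 r := by
    conv_lhs => rw [← h1]
    have h5 : r.totalDegree + 1 ≤ 2 := by
      have := (mem_restrictTotalDegree _ _ _).1 hr
      omega
    rw [Finset.sum_subset (Finset.range_mono h5), Finset.sum_range_succ, Finset.sum_range_one]
    intro k _ hk
    refine homogeneousComponent_eq_zero _ _ ?_
    rw [Finset.mem_range] at hk
    omega
  have h6 := euler_of_isHomogeneous (homogeneousComponent_isHomogeneous 1 r)
  rw [euler_apply, Nat.cast_one, one_smul] at h6
  have h7 : ∀ i, ∃ b : ℝ, pderiv i (homogeneousComponent 1 r) = C b := fun i =>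
    ⟨_, totalDegree_eq_zero_iff_eq_C.1 ((totalDegree_zero_iff_isHomogeneous _).2
      (homogeneousComponent_isHomogeneous 1 r).pderiv)⟩
  choose b hb using h7
  refine ⟨coeff 0 r, b, ?_⟩
  conv_lhs => rw [h3, homogeneousComponent_zero, ← h6]
  congr 1
  · rw [smul_eq_C_mul, mul_one]
  · refine Finset.sum_congr rfl fun i _ => ?_
    rw [hb, smul_eq_C_mul, mul_comm]

/-- Stone-Weierstrass: the coordinates separate the points of the sphere. -/
theorem exists_polyEval_near {F : Metric.sphere (0 : 𝔼 N) 1 → ℝ} (hF : Continuous F) {ε : ℝ}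
    (hε : 0 < ε) : ∃ p : ℙ N, ∀ θ : Metric.sphere (0 : 𝔼 N) 1, |polyEval p θ - F θ| < ε := by
  let X' : Fin N → C(Metric.sphere (0 : 𝔼 N) 1, ℝ) := fun i => polySphere N (X i)
  have hA : ∀ (p : ℙ N) (θ : Metric.sphere (0 : 𝔼 N) 1), aeval X' p θ = polyEval p θ := by
    intro p θ
    induction p using MvPolynomial.induction_on with
    | C a => rw [polyEval_C, aeval_C]; rfl
    | add p q hp hq => rw [map_add, polyEval_add, ContinuousMap.add_apply, hp, hq]
    | mul_X p i hp =>
      rw [map_mul, polyEval_mul, ContinuousMap.mul_apply, hp, aeval_X]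
      rfl
  let A : Subalgebra ℝ C(Metric.sphere (0 : 𝔼 N) 1, ℝ) := (aeval (R := ℝ) X').range
  have hsep : A.SeparatesPoints := by
    intro x y hxy
    obtain ⟨i, hi⟩ : ∃ i, (x : 𝔼 N) i ≠ (y : 𝔼 N) i := by
      by_contra! hcon
      exact hxy (Subtype.ext (PiLp.ext hcon))
    refine ⟨_, ⟨aeval X' (X i : ℙ N), ⟨X i, rfl⟩, rfl⟩, ?_⟩
    change aeval X' (X i : ℙ N) x ≠ aeval X' (X i : ℙ N) y
    rw [hA, hA, polyEval_X, polyEval_X]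
    exact hi
  obtain ⟨⟨g, p, rfl⟩, hg⟩ :=
    ContinuousMap.exists_mem_subalgebra_near_continuousMap_of_separatesPoints A hsep ⟨F, hF⟩ ε hε
  refine ⟨p, fun θ => ?_⟩
  have h1 := (ContinuousMap.norm_coe_le_norm _ θ).trans_lt hg
  rw [ContinuousMap.sub_apply, Real.norm_eq_abs] at h1
  rw [← hA]
  exact h1

variable [NeZero N]

/-- Write `p = q + s` with `s` orthogonal to all polynomials of lower degree. Modulo these, `sphLap
s` is a multiple of `s`, so the form at `s` is that multiple of its norm; by symmetry the cross
terms vanish, and `q` falls under the induction hypothesis. In degree at most 1, `p` is orthogonal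
to itself and to `sphLap p`. -/
theorem sphLap_gap (d : ℕ) : ∀ p ∈ restrictTotalDegree (Fin N) ℝ (d + 1),
    (∀ r ∈ restrictTotalDegree (Fin N) ℝ 1, sphInner N p r = 0) →
      2 * N * sphInner N p p ≤ sphInner N p (sphLap N p) := by
  induction d with
  | zero =>
    intro p hp h
    rw [h p hp, h _ (sphLap_mem hp), mul_zero]
  | succ d ih =>
    intro p hp h
    obtain ⟨q, hq, hqp⟩ := exists_projection (N := N) (F := fun θ => polyEval p θ)
      ((continuous_polyEval p).comp continuous_subtype_val) (d + 1)
    have hort : ∀ r ∈ restrictTotalDegree (Fin N) ℝ (d + 1), sphInner N (p - q) r = 0 := by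
      intro r hr
      rw [map_sub, LinearMap.sub_apply, ← hqp r hr, sphInner_apply, sub_self]
    have hq1 : ∀ r ∈ restrictTotalDegree (Fin N) ℝ 1, sphInner N q r = 0 := by
      intro r hr
      rw [← hqp r (restrictTotalDegree_mono (by omega) hr)]
      exact h r hr
    have hpq : p - q ∈ restrictTotalDegree (Fin N) ℝ (d + 1 + 1) :=
      Submodule.sub_mem _ hp (restrictTotalDegree_mono (by omega) hq)
    obtain ⟨s, hs⟩ : ∃ s, s = p - q := ⟨_, rfl⟩
    have hps : p = q + s := by rw [hs]; abel
    rw [← hs] at hort hpq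
    have e1 : sphInner N s (sphLap N s) =
        (((d + 1 + 1 : ℕ) : ℝ) * ((d + 1 + 1 : ℕ) + N - 2)) * sphInner N s s := by
      have := hort _ (sphLap_sub_smul_mem hpq)
      rw [map_sub, map_smul, smul_eq_mul, sub_eq_zero] at this
      exact this
    have e2 : sphInner N s (sphLap N q) = 0 := hort _ (sphLap_mem hq)
    have e3 : sphInner N q (sphLap N s) = 0 := by rw [sphInner_sphLap_comm, e2]
    have e4 : sphInner N s q = 0 := hort _ hq
    have e5 : sphInner N q s = 0 := by rw [sphInner_comm, e4]
    -- With `k = d + 2` the multiple is `(d+2)(d+N)`, least for `d = 0`.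
    have h6 : 2 * (N : ℝ) ≤ ((d + 1 + 1 : ℕ) : ℝ) * ((d + 1 + 1 : ℕ) + N - 2) := by
      push_cast
      have hd : (0 : ℝ) ≤ d := Nat.cast_nonneg d
      have hN : (0 : ℝ) ≤ N := Nat.cast_nonneg N
      nlinarith [mul_nonneg hd hN]
    have h7 := ih q hq hq1
    have h8 := mul_le_mul_of_nonneg_right h6 (sphInner_self_nonneg s)
    rw [hps]
    simp only [map_add, LinearMap.add_apply, e1, e2, e3, e4, e5]
    linarith

/-- The Poincaré inequality on the sphere for functions, with the affine part removed. -/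
theorem poincare_sphere {f : (𝔼 N) → ℝ} (hf : IsProfile f) {a : ℙ N}
    (ha : a ∈ restrictTotalDegree (Fin N) ℝ 1)
    (hfa : ∀ r ∈ restrictTotalDegree (Fin N) ℝ 1,
      ∫ θ : Metric.sphere (0 : 𝔼 N) 1, f θ * polyEval r θ ∂(surface N) = sphInner N a r) :
    2 * N * ((∫ θ : Metric.sphere (0 : 𝔼 N) 1, f θ ^ 2 ∂(surface N)) - sphInner N a a) ≤
      ∫ θ : Metric.sphere (0 : 𝔼 N) 1, ‖gradient f (θ : 𝔼 N)‖ ^ 2 ∂(surface N) := by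
  set m := (surface N).real univ with hm
  have hm0 : 0 ≤ m := measureReal_nonneg
  have hN0 : (0 : ℝ) ≤ N := Nat.cast_nonneg N
  refine le_of_forall_pos_le_add fun δ hδ => ?_
  obtain ⟨ε, hε, hεδ⟩ : ∃ ε : ℝ, 0 < ε ∧ 2 * N * (ε ^ 2 * m) ≤ δ := by
    refine ⟨Real.sqrt (δ / (2 * N * m + 1)), Real.sqrt_pos.2 (by positivity), ?_⟩
    rw [Real.sq_sqrt (by positivity)]
    have : 0 < 2 * N * m + 1 := by positivity
    calc 2 * N * (δ / (2 * N * m + 1) * m) = δ * (2 * N * m / (2 * N * m + 1)) := by ring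
      _ ≤ δ * 1 := by
        gcongr
        rw [div_le_one this]
        linarith
      _ = δ := mul_one δ
  obtain ⟨P, hP⟩ := exists_polyEval_near hf.continuous_sphere hε
  -- The projection is at least as close to `f` in `L²` as the uniform approximant `P`, and Bessel's
  -- inequality controls its energy; no approximation of gradients is needed. The `+ 1` matches the
  -- form of `sphLap_gap`.
  obtain ⟨p, hp, hfp⟩ := exists_projection hf.continuous_sphere (P.totalDegree + 1)
  have hP' : P ∈ restrictTotalDegree (Fin N) ℝ (P.totalDegree + 1) :=
    (mem_restrictTotalDegree _ _ _).2 (Nat.le_succ _)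
  have hV1 : ∀ r ∈ restrictTotalDegree (Fin N) ℝ 1, r ∈ restrictTotalDegree (Fin N) ℝ
      (P.totalDegree + 1) := fun r hr => restrictTotalDegree_mono (by omega) hr
  -- the distance to the projection
  have happ : (∫ θ : Metric.sphere (0 : 𝔼 N) 1, f θ ^ 2 ∂(surface N)) - sphInner N p p ≤
      ε ^ 2 * m := by
    have h1 : ∫ θ : Metric.sphere (0 : 𝔼 N) 1, (f θ - polyEval P θ) ^ 2 ∂(surface N) =
        (∫ θ : Metric.sphere (0 : 𝔼 N) 1, f θ ^ 2 ∂(surface N)) - 2 * sphInner N p P +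
          sphInner N P P := by
      have hi2 : Integrable (fun θ : Metric.sphere (0 : 𝔼 N) 1 => 2 * (f θ * polyEval P θ))
        (surface N) := (hf.integrable_mul_polyEval P).const_mul 2
      have hi : Integrable (fun θ : Metric.sphere (0 : 𝔼 N) 1 =>
        f θ ^ 2 - 2 * (f θ * polyEval P θ)) (surface N) := hf.integrable_sq.sub hi2
      rw [← hfp P hP', sphInner_apply, ← integral_const_mul, ← integral_sub hf.integrable_sq hi2,
        ← integral_add hi (integrable_mul_polyEval P P)]
      exact integral_congr_ae (Eventually.of_forall fun θ => by simp only; ring)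
    have h2 : ∫ θ : Metric.sphere (0 : 𝔼 N) 1, (f θ - polyEval P θ) ^ 2 ∂(surface N) ≤
        ε ^ 2 * m := by
      calc _ ≤ ∫ θ : Metric.sphere (0 : 𝔼 N) 1, ε ^ 2 ∂(surface N) := by
            refine integral_mono (integrable_sphere_of_continuous ((hf.continuous_sphere.sub
              ((continuous_polyEval P).comp continuous_subtype_val)).pow 2))
              (integrable_const _) fun θ => ?_
            have := hP θ
            rw [abs_sub_comm] at this
            exact sq_le_sq.2 (this.le.trans (le_abs_self _))
        _ = ε ^ 2 * m := by rw [integral_const, smul_eq_mul, mul_comm]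
    have h3 := sphInner_self_nonneg (p - P)
    simp only [map_sub, LinearMap.sub_apply, sphInner_comm P p] at h3
    linarith
  -- Since `sphLap p` has no larger degree bound than `p`, pairing it with `f` or with the
  -- projection `p` gives the same value.
  have h1 : sphInner N p (sphLap N p) ≤
      ∫ θ : Metric.sphere (0 : 𝔼 N) 1, ‖gradient f (θ : 𝔼 N)‖ ^ 2 ∂(surface N) := by
    have := two_mul_integral_mul_sphLap_le hf p
    rw [hfp _ (sphLap_mem hp)] at this
    linarith
  have hort : ∀ r ∈ restrictTotalDegree (Fin N) ℝ 1, sphInner N (p - a) r = 0 := by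
    intro r hr
    rw [map_sub, LinearMap.sub_apply, ← hfp r (hV1 r hr), hfa r hr, sub_self]
  have h2 := sphLap_gap P.totalDegree (p - a) (Submodule.sub_mem _ hp (hV1 a ha)) hort
  obtain ⟨s, hs⟩ : ∃ s, s = p - a := ⟨_, rfl⟩
  have hps : p = a + s := by rw [hs]; abel
  rw [← hs] at hort h2
  have e2 : sphInner N s (sphLap N a) = 0 := hort _ (sphLap_mem ha)
  have e3 : sphInner N a (sphLap N s) = 0 := by rw [sphInner_sphLap_comm, e2]
  have e4 : sphInner N s a = 0 := hort _ ha
  have e5 : sphInner N a s = 0 := by rw [sphInner_comm, e4]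
  rw [hps] at h1 happ
  simp only [map_add, LinearMap.add_apply, e2, e3, e4, e5] at h1 happ
  have h3 := sphInner_sphLap_self_nonneg a
  nlinarith [mul_le_mul_of_nonneg_left happ (show 0 ≤ 2 * (N : ℝ) by positivity)]

/-- The polynomials `1` and `X i` are eigenvectors of a symmetric operator with eigenvalues `0` and
`N - 1`, distinct because `N ≥ 2`. -/
theorem sphInner_X_one (hN : 2 ≤ N) (i : Fin N) : sphInner N (X i) 1 = 0 := by
  have h := sphInner_sphLap_comm (N := N) 1 (X i)
  have hc : (1 : ℙ N) = C 1 := C_1.symm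
  rw [sphLap_X, map_smul, smul_eq_mul, sphInner_comm, hc, sphLap_C, map_zero,
    mul_eq_zero] at h
  have hN' : (2 : ℝ) ≤ N := by exact_mod_cast hN
  rcases h with h | h
  · linarith
  · rwa [hc]

/-- Green's formula for two coordinates reads `(N-1) ∫ θᵢ θⱼ = ∫ (δᵢⱼ - θᵢ θⱼ)`. -/
theorem sphInner_X_X (i j : Fin N) :
    N * sphInner N (X i) (X j) = if i = j then (surface N).real univ else 0 := by
  have hg : ∀ (k : Fin N) (x : 𝔼 N), gradient (polyEval (X k)) x = EuclideanSpace.single k 1 := by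
    intro k x
    ext l
    rw [gradient_polyEval_apply, pderiv_X]
    rcases eq_or_ne l k with rfl | h
    · simp [polyEval_one]
    · simp [h, h.symm, polyEval_zero]
  have h := sphInner_sphLap (N := N) (X i) (X j)
  simp only [sphLap_X, map_smul, hg, smul_eq_mul, EuclideanSpace.inner_single_right,
    one_mul, conj_trivial] at h
  have h2 : ∀ θ : Metric.sphere (0 : 𝔼 N) 1, (θ : 𝔼 N) i * (θ : 𝔼 N) j =
      polyEval (X i) (θ : 𝔼 N) * polyEval (X j) (θ : 𝔼 N) := fun θ => by
    rw [polyEval_X, polyEval_X]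
  simp only [h2] at h
  rw [integral_sub (integrable_const _) (integrable_mul_polyEval _ _), ← sphInner_apply,
    integral_const] at h
  have h3 : (N : ℝ) * sphInner N (X i) (X j) =
      (surface N).real univ • (EuclideanSpace.single i (1 : ℝ) : 𝔼 N) j := by linarith
  rw [h3]
  rcases eq_or_ne i j with rfl | hij
  · simp
  · simp [hij, hij.symm]

theorem surface_real_univ_pos : 0 < (surface N).real univ := by
  have : Nonempty (Metric.sphere (0 : 𝔼 N) 1) := by
    have : Nontrivial (𝔼 N) := inferInstance
    exact (NormedSpace.sphere_nonempty.2 zero_le_one).to_subtype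
  exact ENNReal.toReal_pos (isOpen_univ.measure_pos (surface N) univ_nonempty).ne'
    (measure_ne_top _ _)

theorem poincare_sphere_moments (hN : 2 ≤ N) {f : (𝔼 N) → ℝ} (hf : IsProfile f) :
    2 * N * ((∫ θ : Metric.sphere (0 : 𝔼 N) 1, f θ ^ 2 ∂(surface N)) -
      ((surface N).real univ)⁻¹ * ((∫ θ : Metric.sphere (0 : 𝔼 N) 1, f θ ∂(surface N)) ^ 2 +
        N * ∑ i, (∫ θ : Metric.sphere (0 : 𝔼 N) 1, f θ * (θ : 𝔼 N) i ∂(surface N)) ^ 2)) ≤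
      ∫ θ : Metric.sphere (0 : 𝔼 N) 1, ‖gradient f (θ : 𝔼 N)‖ ^ 2 ∂(surface N) := by
  have hm : (surface N).real univ ≠ 0 := surface_real_univ_pos.ne'
  set m := (surface N).real univ
  have hN0 : (N : ℝ) ≠ 0 := Nat.cast_ne_zero.2 (NeZero.ne N)
  set I0 := ∫ θ : Metric.sphere (0 : 𝔼 N) 1, f θ ∂(surface N) with hI0
  set I1 : Fin N → ℝ := fun i => ∫ θ : Metric.sphere (0 : 𝔼 N) 1, f θ * (θ : 𝔼 N) i ∂(surface N)
    with hI1
  -- The orthogonal projection of `f` onto affine functions: `1` and the coordinates are orthogonal,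
  -- with squared norms `m` and `m / N`.
  obtain ⟨a, ha⟩ : ∃ a : ℙ N, a = (m⁻¹ * I0) • 1 + ∑ i, (N * m⁻¹ * I1 i) • X i := ⟨_, rfl⟩
  have haV : a ∈ restrictTotalDegree (Fin N) ℝ 1 := by
    rw [ha]
    exact Submodule.add_mem _ (Submodule.smul_mem _ _ (mem_restrictTotalDegree_of_isHomogeneous
      (isHomogeneous_one _ _) zero_le_one)) (Submodule.sum_mem _ fun i _ =>
      Submodule.smul_mem _ _ (mem_restrictTotalDegree_of_isHomogeneous (isHomogeneous_X _ _) le_rfl))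
  have ha1 : sphInner N a 1 = I0 := by
    rw [ha, map_add, map_sum, LinearMap.add_apply, LinearMap.sum_apply, map_smul,
      LinearMap.smul_apply, sphInner_one_one, Finset.sum_eq_zero, smul_eq_mul, add_zero]
    · change m⁻¹ * I0 * m = I0
      field_simp
    · intro i _
      rw [map_smul, LinearMap.smul_apply, sphInner_X_one hN, smul_zero]
  have haX : ∀ j, sphInner N a (X j) = I1 j := by
    intro j
    rw [ha, map_add, map_sum, LinearMap.add_apply, LinearMap.sum_apply, map_smul,
      LinearMap.smul_apply, sphInner_comm 1, sphInner_X_one hN, Finset.sum_eq_single j, smul_zero,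
      zero_add, map_smul, LinearMap.smul_apply, smul_eq_mul]
    · have := sphInner_X_X (N := N) j j
      rw [if_pos rfl] at this
      calc N * m⁻¹ * I1 j * sphInner N (X j) (X j) =
          m⁻¹ * (N * sphInner N (X j) (X j)) * I1 j := by ring
        _ = I1 j := by rw [this, inv_mul_cancel₀ hm, one_mul]
    · intro i _ hij
      have := sphInner_X_X (N := N) i j
      rw [if_neg hij, mul_eq_zero, or_iff_right hN0] at this
      rw [map_smul, LinearMap.smul_apply, this, smul_zero]
    · simp
  have haff : ∀ (c : ℝ) (b : Fin N → ℝ), sphInner N a (c • 1 + ∑ i, b i • X i) =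
      c * I0 + ∑ i, b i * I1 i := by
    intro c b
    rw [map_add, map_sum, map_smul, ha1, smul_eq_mul]
    simp only [map_smul, haX, smul_eq_mul]
  have hfa : ∀ r ∈ restrictTotalDegree (Fin N) ℝ 1,
      ∫ θ : Metric.sphere (0 : 𝔼 N) 1, f θ * polyEval r θ ∂(surface N) = sphInner N a r := by
    intro r hr
    obtain ⟨c, b, rfl⟩ := exists_affine_of_mem hr
    rw [haff]
    have hi : ∀ i, Integrable (fun θ : Metric.sphere (0 : 𝔼 N) 1 => b i * (f θ * (θ : 𝔼 N) i))
        (surface N) := fun i => by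
      simpa only [polyEval_X] using (hf.integrable_mul_polyEval (X i)).const_mul (b i)
    have hi0 : Integrable (fun θ : Metric.sphere (0 : 𝔼 N) 1 => c * f θ) (surface N) :=
      (integrable_sphere_of_continuous hf.continuous_sphere).const_mul c
    have hi1 : Integrable (fun θ : Metric.sphere (0 : 𝔼 N) 1 => ∑ i, b i * (f θ * (θ : 𝔼 N) i))
        (surface N) := integrable_finsetSum _ fun i _ => hi i
    simp only [hI0, hI1, ← integral_const_mul]
    rw [← integral_finsetSum _ fun i _ => hi i, ← integral_add hi0 hi1]
    refine integral_congr_ae (Eventually.of_forall fun θ => ?_)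
    simp only [polyEval_add, polyEval_smul, polyEval_sum, polyEval_one, polyEval_X, mul_add,
      Finset.mul_sum]
    congr 1
    · ring
    · exact Finset.sum_congr rfl fun i _ => by ring
  have h := poincare_sphere hf haV hfa
  have haa : sphInner N a a = m⁻¹ * (I0 ^ 2 + N * ∑ i, I1 i ^ 2) := by
    conv_lhs => rw [show sphInner N a a = sphInner N a ((m⁻¹ * I0) • 1 +
      ∑ i, (N * m⁻¹ * I1 i) • X i) by rw [← ha], haff]
    rw [mul_add, Finset.mul_sum, Finset.mul_sum]
    congr 1
    · ring
    · exact Finset.sum_congr rfl fun i _ => by ring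
  rwa [haa] at h

end Poincare

/-! ### From the sphere of radius `R` to profiles on the unit sphere -/

section Translation

variable {R : ℝ} {h : (𝔼 N) → ℝ}

theorem radialExtension_apply_smul (θ : Metric.sphere (0 : 𝔼 N) 1) :
    radialExtension R h (θ : 𝔼 N) = h (R • (θ : 𝔼 N)) := by
  rw [radialExtension, norm_eq_of_mem_sphere, div_one]

theorem isProfile_radialExtension (hR : 0 < R) (hh : MemW1Inf R h) :
    IsProfile (radialExtension R h) := by
  refine ⟨fun r x hr => ?_, ?_⟩
  · rw [radialExtension, radialExtension, norm_smul, Real.norm_of_nonneg hr.le, smul_smul]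
    congr 2
    rcases eq_or_ne ‖x‖ 0 with hx | hx
    · rw [hx]; simp
    · field_simp
  · obtain ⟨K, hK⟩ := hh
    refine ⟨K * ⟨R, hR.le⟩, LipschitzOnWith.of_dist_le_mul fun x hx y hy => ?_⟩
    have hS : ∀ z ∈ Metric.sphere (0 : 𝔼 N) 1, R • z ∈ Metric.sphere (0 : 𝔼 N) R := by
      intro z hz
      rw [mem_sphere_zero_iff_norm] at hz ⊢
      rw [norm_smul, hz, mul_one, Real.norm_of_nonneg hR.le]
    rw [radialExtension_apply_smul ⟨x, hx⟩, radialExtension_apply_smul ⟨y, hy⟩]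
    refine (hK.dist_le_mul _ (hS x hx) _ (hS y hy)).trans (le_of_eq ?_)
    rw [dist_smul₀, Real.norm_of_nonneg hR.le, ← mul_assoc]
    rfl

theorem tangentialGradient_smul (hR : 0 < R) (hh : MemW1Inf R h) (θ : Metric.sphere (0 : 𝔼 N) 1) :
    tangentialGradient R h (R • (θ : 𝔼 N)) = R⁻¹ • gradient (radialExtension R h) (θ : 𝔼 N) :=
  (isProfile_radialExtension hR hh).gradient_smul hR _

theorem measurableEmbedding_smul_sphere (hR : 0 < R) :
    MeasurableEmbedding fun θ : Metric.sphere (0 : 𝔼 N) 1 => R • (θ : 𝔼 N) :=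
  (measurableEmbedding_const_smul₀ hR.ne').comp
    (MeasurableEmbedding.subtype_coe Metric.isClosed_sphere.measurableSet)

theorem integral_sphereMeasure (hR : 0 < R) (F : (𝔼 N) → ℝ) :
    ∫ x, F x ∂(sphereMeasure N R) =
      R ^ (N - 1) * ∫ θ : Metric.sphere (0 : 𝔼 N) 1, F (R • (θ : 𝔼 N)) ∂(surface N) := by
  rw [sphereMeasure, integral_smul_measure, (measurableEmbedding_smul_sphere hR).integral_map,
    ENNReal.toReal_ofReal (pow_nonneg hR.le _), smul_eq_mul]

theorem ae_norm_le_of_eLpNorm_sphereMeasure_le {E : Type*} [NormedAddCommGroup E] (hR : 0 < R)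
    {F : (𝔼 N) → E} {c : ℝ} (hc : 0 ≤ c)
    (hF : eLpNorm F ∞ (sphereMeasure N R) ≤ ENNReal.ofReal c) :
    ∀ᵐ θ : Metric.sphere (0 : 𝔼 N) 1 ∂(surface N), ‖F (R • (θ : 𝔼 N))‖ ≤ c := by
  rw [eLpNorm_exponent_top] at hF
  have h1 : ∀ᵐ x ∂(sphereMeasure N R), ‖F x‖ ≤ c := by
    filter_upwards [ae_le_eLpNormEssSup (f := F) (μ := sphereMeasure N R)] with x hx
    have h2 := hx.trans hF
    rw [← ofReal_norm, ENNReal.ofReal_le_ofReal_iff hc] at h2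
    exact h2
  rw [sphereMeasure, Measure.ae_ennreal_smul_measure_iff
    (ENNReal.ofReal_pos.2 (pow_pos hR _)).ne', (measurableEmbedding_smul_sphere hR).ae_map_iff] at h1
  exact h1

theorem ball_eq_gauge {f : (𝔼 N) → ℝ} (hf0 : ∀ x, x ≠ 0 → f x = 0) :
    Metric.ball (0 : 𝔼 N) R = {x | gauge f x < R} := by
  ext x
  rw [mem_ball_zero_iff, Set.mem_ofPred_eq]
  rcases eq_or_ne x 0 with rfl | hx
  · rw [gauge_zero, norm_zero]
  · rw [gauge, hf0 x hx, add_zero, div_one]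

/-- A continuous function bounded almost everywhere on the sphere is bounded everywhere, nonempty
open sets having positive surface measure. -/
theorem forall_abs_le_of_normLInf_le (hR : 0 < R) (hh : MemW1Inf R h) {c : ℝ} (hc : 0 ≤ c)
    (hF : normLInf R h ≤ ENNReal.ofReal c) (x : 𝔼 N) (hx : x ≠ 0) :
    |radialExtension R h x| ≤ c := by
  have hf := isProfile_radialExtension hR hh
  have h1 := ae_norm_le_of_eLpNorm_sphereMeasure_le hR hc hF
  have h2 : IsOpen {θ : Metric.sphere (0 : 𝔼 N) 1 | c < |radialExtension R h (θ : 𝔼 N)|} :=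
    isOpen_lt continuous_const hf.continuous_sphere.abs
  have h3 : {θ : Metric.sphere (0 : 𝔼 N) 1 | c < |radialExtension R h (θ : 𝔼 N)|} = ∅ := by
    refine h2.eq_empty_of_measure_zero (μ := surface N) ?_
    rw [measure_eq_zero_iff_ae_notMem]
    filter_upwards [h1] with θ hθ
    rw [← radialExtension_apply_smul (h := h)] at hθ
    exact not_lt.2 hθ
  rw [← hf.apply_normalize hx]
  by_contra! hcon
  have : (⟨_, normalize_mem_sphere hx⟩ : Metric.sphere (0 : 𝔼 N) 1) ∈
    {θ : Metric.sphere (0 : 𝔼 N) 1 | c < |radialExtension R h (θ : 𝔼 N)|} := hcon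
  rw [h3] at this
  exact this

variable [NeZero N]

theorem perturbedBall_eq (hR : 0 < R) (hh : MemW1Inf R h)
    (hb : ∀ x : 𝔼 N, x ≠ 0 → |radialExtension R h x| ≤ 1 / 2) :
    perturbedBall R h = {x | gauge (radialExtension R h) x < R} := by
  have hf := isProfile_radialExtension hR hh
  ext y
  constructor
  · rintro ⟨t, ht, x, hx, rfl⟩
    rw [mem_sphere_zero_iff_norm] at hx
    have hx0 : x ≠ 0 := norm_pos_iff.1 (hx ▸ hR)
    have hfx : radialExtension R h x = h x := by
      rw [radialExtension, hx, div_self hR.ne', one_smul]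
    have hpos := one_add_pos hb hx0
    rw [hfx] at hpos
    rw [Set.mem_ofPred_eq]
    rcases ht.1.eq_or_lt with h0 | h0
    · rw [← h0, zero_mul, zero_smul, gauge_zero]
      exact hR
    · rw [gauge_smul hf _ _ (mul_pos h0 hpos), gauge, hfx, hx, mul_div_assoc', mul_right_comm,
        mul_div_cancel_right₀ _ hpos.ne']
      nlinarith [ht.2]
  · intro hy
    rw [Set.mem_ofPred_eq] at hy
    rcases eq_or_ne y 0 with rfl | hy0
    · obtain ⟨x, hx⟩ := NormedSpace.sphere_nonempty (x := (0 : 𝔼 N)).2 hR.le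
      exact ⟨0, ⟨le_rfl, one_pos⟩, x, hx, by simp⟩
    · have hpos := one_add_pos hb hy0
      have hyn : ‖y‖ ≠ 0 := norm_ne_zero_iff.2 hy0
      refine ⟨gauge (radialExtension R h) y / R, ⟨div_nonneg (gauge_nonneg hb y) hR.le,
        (div_lt_one hR).2 hy⟩, (R / ‖y‖) • y, ?_, ?_⟩
      · rw [mem_sphere_zero_iff_norm, norm_smul, norm_div, norm_norm, Real.norm_of_nonneg hR.le,
          div_mul_cancel₀ _ hyn]
      · change y = (_ * (1 + radialExtension R h y)) • _
        rw [smul_smul, gauge]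
        have : ‖y‖ / (1 + radialExtension R h y) / R * (1 + radialExtension R h y) * (R / ‖y‖) =
            1 := by
          field_simp
        rw [this, one_smul]

end Translation

/-! ### Volume and barycenter as spherical moments -/

section Moments

variable {f : (𝔼 N) → ℝ} {R : ℝ}

theorem measurableSet_gauge_lt (hf : IsProfile f) (hb : ∀ x : 𝔼 N, x ≠ 0 → |f x| ≤ 1 / 2) :
    MeasurableSet {x | gauge f x < R} := by
  obtain ⟨K, hK⟩ := exists_lipschitzWith_gauge hf hb
  exact measurableSet_lt hK.continuous.measurable measurable_const

theorem gauge_lt_subset (hb : ∀ x : 𝔼 N, x ≠ 0 → |f x| ≤ 1 / 2) :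
    {x | gauge f x < R} ⊆ Metric.ball (0 : 𝔼 N) (2 * R) := by
  intro x hx
  rw [Set.mem_ofPred_eq] at hx
  rw [mem_ball_zero_iff]
  linarith [le_gauge hb x]

theorem inv_gauge_pow (θ : Metric.sphere (0 : 𝔼 N) 1) (k : ℕ) :
    (gauge f (θ : 𝔼 N) ^ k)⁻¹ = (1 + f θ) ^ k := by
  rw [gauge, norm_eq_of_mem_sphere, one_div, inv_pow, inv_inv]

theorem setIntegral_Ioi_indicator (hR : 0 < R) (k : ℕ) :
    ∫ t in Ioi (0 : ℝ), t ^ (N - 1) * (Iio R).indicator (fun t => t ^ k) t =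
      R ^ (N - 1 + k + 1) / (N - 1 + k + 1 : ℕ) := by
  have h1 : ∀ t : ℝ, t ^ (N - 1) * (Iio R).indicator (fun t => t ^ k) t =
      (Iio R).indicator (fun t => t ^ (N - 1 + k)) t := by
    intro t
    by_cases ht : t ∈ Iio R
    · rw [indicator_of_mem ht, indicator_of_mem ht, pow_add]
    · rw [indicator_of_notMem ht, indicator_of_notMem ht, mul_zero]
  simp only [h1]
  rw [setIntegral_indicator measurableSet_Iio, Ioi_inter_Iio, ← integral_Ioc_eq_integral_Ioo,
    ← intervalIntegral.integral_of_le hR.le, integral_pow]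
  push_cast
  rw [zero_pow (Nat.succ_ne_zero _), sub_zero]

variable [NeZero N]

/-- Integrals over `{gauge f < R}` of functions that are homogeneous of degree `k`. -/
theorem setIntegral_gauge_lt (hf : IsProfile f) (hb : ∀ x : 𝔼 N, x ≠ 0 → |f x| ≤ 1 / 2)
    (hR : 0 < R) {k : ℕ} {G : (𝔼 N) → ℝ} (hG : Continuous G)
    (hom : ∀ (r : ℝ) (x : 𝔼 N), 0 < r → G (r • x) = r ^ k * G x) :
    ∫ x in {x | gauge f x < R}, G x =
      (∫ θ : Metric.sphere (0 : 𝔼 N) 1, G θ * (1 + f θ) ^ (N + k) ∂(surface N)) *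
        (R ^ (N - 1 + k + 1) / (N - 1 + k + 1 : ℕ)) := by
  have hms := measurableSet_gauge_lt (R := R) hf hb
  have h1 : ∀ x : 𝔼 N, x ≠ 0 → {x | gauge f x < R}.indicator G x =
      (Iio R).indicator (fun t => t ^ k) (gauge f x) * (G x * (gauge f x ^ k)⁻¹) := by
    intro x hx
    have hg := gauge_pos hb x hx
    by_cases hxR : gauge f x < R
    · rw [indicator_of_mem (show x ∈ {x | gauge f x < R} from hxR),
        indicator_of_mem (show gauge f x ∈ Iio R from hxR)]
      field_simp
    · rw [indicator_of_notMem (show x ∉ {x | gauge f x < R} from hxR),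
        indicator_of_notMem (show gauge f x ∉ Iio R from hxR), zero_mul]
  -- Dividing `G` by the `k`-th power of the gauge makes it constant on rays, as
  -- `integral_comp_gauge` requires; only the origin is exceptional.
  have h2 : {x | gauge f x < R}.indicator G =ᵐ[volume] fun x =>
      (Iio R).indicator (fun t => t ^ k) (gauge f x) * (G x * (gauge f x ^ k)⁻¹) := by
    filter_upwards [Measure.ae_ne volume (0 : 𝔼 N)] with x hx using h1 x hx
  have hi : Integrable ({x | gauge f x < R}.indicator G) := by
    rw [integrable_indicator_iff hms]
    exact (hG.continuousOn.integrableOn_compact (isCompact_closedBall (0 : 𝔼 N) (2 * R))).mono_set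
      ((gauge_lt_subset hb).trans Metric.ball_subset_closedBall)
  rw [← integral_indicator hms, integral_congr_ae h2, integral_comp_gauge
    (fun r x hr => gauge_smul hf r x hr) (gauge_pos hb) (F := (Iio R).indicator (fun t => t ^ k))
    (G := fun x => G x * (gauge f x ^ k)⁻¹) (fun r x hr => ?_) (hi.congr h2),
    setIntegral_Ioi_indicator hR]
  · congr 1
    refine integral_congr_ae (Eventually.of_forall fun θ => ?_)
    simp only [inv_gauge_pow]
    rw [pow_add]
    ring
  · rw [hom r x hr, gauge_smul hf r x hr, mul_pow, mul_inv_rev]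
    field_simp

/-- The homogeneous formula of degree 0, applied to `f` and to the zero profile, which represents
the ball. -/
theorem integral_one_add_pow_eq (hf : IsProfile f) (hb : ∀ x : 𝔼 N, x ≠ 0 → |f x| ≤ 1 / 2)
    (hR : 0 < R) (hv : volume {x | gauge f x < R} = volume (Metric.ball (0 : 𝔼 N) R)) :
    ∫ θ : Metric.sphere (0 : 𝔼 N) 1, (1 + f θ) ^ N ∂(surface N) = (surface N).real univ := by
  have h0 : IsProfile (fun _ : 𝔼 N => (0 : ℝ)) := ⟨fun _ _ _ => rfl, 0, by simp [LipschitzOnWith]⟩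
  have h1 := setIntegral_gauge_lt hf hb hR (k := 0) (G := fun _ => 1) continuous_const
    (fun r x hr => by simp)
  have h2 := setIntegral_gauge_lt h0 (fun x hx => by norm_num) hR (k := 0) (G := fun _ => 1)
    continuous_const (fun r x hr => by simp)
  rw [← ball_eq_gauge fun _ _ => rfl] at h2
  have h3 : ∫ x in {x | gauge f x < R}, (1 : ℝ) = ∫ x in Metric.ball (0 : 𝔼 N) R, (1 : ℝ) := by
    simp only [integral_const, smul_eq_mul, mul_one, measureReal_def, Measure.restrict_apply_univ, hv]
  rw [h1, h2] at h3
  have h4 := mul_right_cancel₀ (by positivity) h3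
  simpa using h4

theorem integral_one_add_pow_mul_eq (hf : IsProfile f) (hb : ∀ x : 𝔼 N, x ≠ 0 → |f x| ≤ 1 / 2)
    (hR : 0 < R) (hv : volume {x | gauge f x < R} = volume (Metric.ball (0 : 𝔼 N) R))
    (hbar : barycenter {x | gauge f x < R} = 0) (i : Fin N) :
    ∫ θ : Metric.sphere (0 : 𝔼 N) 1, (θ : 𝔼 N) i * (1 + f θ) ^ (N + 1) ∂(surface N) = 0 := by
  have hi : IntegrableOn (fun x : 𝔼 N => x) {x | gauge f x < R} :=
    (continuous_id.continuousOn.integrableOn_compact (isCompact_closedBall (0 : 𝔼 N) (2 * R))).mono_set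
      ((gauge_lt_subset hb).trans Metric.ball_subset_closedBall)
  have h1 : ∫ x in {x | gauge f x < R}, x = 0 := by
    rw [barycenter, setAverage_eq, smul_eq_zero, inv_eq_zero, measureReal_def, hv] at hbar
    refine hbar.resolve_left (ENNReal.toReal_pos ?_ measure_ball_lt_top.ne).ne'
    exact (Metric.measure_ball_pos volume _ hR).ne'
  have h2 : ∫ x in {x | gauge f x < R}, (x : 𝔼 N) i = 0 := by
    have := (EuclideanSpace.proj i : (𝔼 N) →L[ℝ] ℝ).integral_comp_comm hi
    rw [h1, map_zero] at this
    exact this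
  rw [setIntegral_gauge_lt hf hb hR (k := 1) (G := fun x => x i)
    (EuclideanSpace.proj i : (𝔼 N) →L[ℝ] ℝ).continuous (fun r x hr => by simp), mul_eq_zero] at h2
  exact h2.resolve_right (by positivity)

end Moments

/-! ### One-variable inequalities -/

section Scalar

/-- A weighted arithmetic-geometric inequality. For `k = N - 2` it bounds `aᴺ⁻²` by `2/N + (N-2)/N
aᴺ`, whose integral the volume constraint fixes. -/
theorem add_two_mul_pow_le (k : ℕ) {a : ℝ} (ha : 0 ≤ a) :
    ((k : ℝ) + 2) * a ^ k ≤ 2 + k * a ^ (k + 2) := by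
  induction k with
  | zero => simp
  | succ k ih =>
    have h1 : 0 ≤ (a - 1) * (a ^ (k + 1) * (a + 1) - 2) := by
      rcases le_total 1 a with h | h
      · have h2 : 1 ≤ a ^ (k + 1) := one_le_pow₀ h
        exact mul_nonneg (by linarith) (by nlinarith)
      · have h2 : a ^ (k + 1) ≤ 1 := pow_le_one₀ ha h
        have h3 : 0 ≤ a ^ (k + 1) := pow_nonneg ha _
        exact mul_nonneg_of_nonpos_of_nonpos (by linarith) (by nlinarith)
    have h2 := mul_le_mul_of_nonneg_left ih ha
    push_cast
    have e1 : a ^ (k + 1 + 2) = a ^ (k + 1) * a ^ 2 := by ring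
    have e2 : a * (((k : ℝ) + 2) * a ^ k) = (k + 2) * a ^ (k + 1) := by ring
    have e3 : a * (2 + (k : ℝ) * a ^ (k + 2)) = 2 * a + k * (a ^ (k + 1) * a ^ 2) := by ring
    rw [e2, e3] at h2
    rw [e1]
    nlinarith

theorem abs_one_add_pow_sub_le (n : ℕ) {x : ℝ} (hx : |x| ≤ 1) :
    |(1 + x) ^ n - 1 - n * x| ≤ 4 ^ n * x ^ 2 := by
  induction n with
  | zero => simpa using sq_nonneg x
  | succ n ih =>
    have h1 : (1 + x) ^ (n + 1) - 1 - ((n + 1 : ℕ) : ℝ) * x =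
        (1 + x) * ((1 + x) ^ n - 1 - n * x) + n * x ^ 2 := by
      push_cast; ring
    have h2 : |1 + x| ≤ 2 := by
      rw [abs_le] at hx ⊢
      constructor <;> linarith
    have h3 : (n : ℝ) ≤ 4 ^ n := by exact_mod_cast (Nat.lt_pow_self (by norm_num)).le
    have hx2 := sq_nonneg x
    have h4 : (0 : ℝ) ≤ 4 ^ n := by positivity
    calc _ ≤ |1 + x| * |(1 + x) ^ n - 1 - n * x| + |(n : ℝ) * x ^ 2| := by
          rw [h1, ← abs_mul]; exact abs_add_le _ _
      _ ≤ 2 * (4 ^ n * x ^ 2) + 4 ^ n * x ^ 2 := by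
          rw [abs_of_nonneg (by positivity : 0 ≤ (n : ℝ) * x ^ 2)]
          gcongr
      _ ≤ _ := by rw [pow_succ (4 : ℝ) n]; nlinarith [mul_nonneg h4 hx2]

/-- The left side is the sum of `(j+1) aʲ (a-1)²` over `j < n`; bounding each `aʲ` by `3/2` gives
`(3/2) · n(n+1)/2`. Divided by `n + 1 = N`, it bounds `aᴺ⁻¹` from below through `aᴺ`, with a
quadratic loss. -/
theorem one_add_mul_pow_sub_le (n : ℕ) {a : ℝ} (h : ∀ j ≤ n, a ^ j ≤ 3 / 2) :
    1 + n * a ^ (n + 1) - (n + 1) * a ^ n ≤ 3 / 4 * n * (n + 1) * (a - 1) ^ 2 := by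
  induction n with
  | zero => simp
  | succ n ih =>
    have h1 := ih fun j hj => h j (by omega)
    have h2 := mul_le_mul_of_nonneg_right (h n (by omega)) (mul_nonneg
      (show (0 : ℝ) ≤ n + 1 by positivity) (sq_nonneg (a - 1)))
    push_cast
    have e : 1 + ((n : ℝ) + 1) * a ^ (n + 1 + 1) - ((n : ℝ) + 1 + 1) * a ^ (n + 1) =
        (1 + n * a ^ (n + 1) - (n + 1) * a ^ n) + a ^ n * ((n + 1) * (a - 1) ^ 2) := by ring
    rw [e]
    linarith

theorem pow_bounds {n j : ℕ} {x : ℝ} (hx : n * |x| ≤ 1 / 16) (hj : j ≤ n) :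
    15 / 16 ≤ (1 + x) ^ j ∧ (1 + x) ^ j ≤ 3 / 2 := by
  rcases Nat.eq_zero_or_pos j with rfl | hj0
  · norm_num
  have hj' : (j : ℝ) ≤ n := by exact_mod_cast hj
  have hj1 : (1 : ℝ) ≤ j := by exact_mod_cast hj0
  have hx1 : j * |x| ≤ 1 / 16 := (mul_le_mul_of_nonneg_right hj' (abs_nonneg x)).trans hx
  have hx2 : |x| ≤ 1 / 16 := by nlinarith [abs_nonneg x]
  obtain ⟨h1, h2⟩ := abs_le.1 hx2
  have h3 := one_add_mul_le_pow (show (-2 : ℝ) ≤ x by linarith) j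
  have h4 := one_add_mul_le_pow (show (-2 : ℝ) ≤ -x by linarith) j
  have h5 := mul_le_mul_of_nonneg_left (neg_abs_le x) (show (0 : ℝ) ≤ j by positivity)
  have h6 := mul_le_mul_of_nonneg_left (le_abs_self x) (show (0 : ℝ) ≤ j by positivity)
  refine ⟨by linarith, ?_⟩
  -- Bernoulli bounds `(1 - x)ʲ` from below, so this product bounds `(1 + x)ʲ` from above.
  have h7 : (1 + x) ^ j * (1 + -x) ^ j ≤ 1 := by
    rw [← mul_pow]
    exact pow_le_one₀ (by nlinarith) (by nlinarith [sq_nonneg x])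
  have h8 : 0 ≤ (1 + x) ^ j := pow_nonneg (by linarith) _
  nlinarith

theorem le_of_sq_eq_inv_sq_add {a g s : ℝ} (ha : 0 < a) (ha2 : a ≤ 17 / 16) (hg : |g| ≤ 1 / 2)
    (hs : 0 ≤ s) (h : s ^ 2 = (a ^ 2)⁻¹ + (a ^ 4)⁻¹ * g ^ 2) :
    a⁻¹ * (1 + 2 / 5 * g ^ 2) ≤ s := by
  have hb : 16 / 17 ≤ a⁻¹ := by
    rw [le_inv_comm₀ (by norm_num) ha]; linarith
  have e : s ^ 2 = (a⁻¹) ^ 2 + (a⁻¹) ^ 4 * g ^ 2 := by rw [h, inv_pow, inv_pow]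
  set b := a⁻¹
  have hg2 : g ^ 2 ≤ 1 / 4 := by rw [← sq_abs]; nlinarith [abs_nonneg g]
  refine le_of_sq_le_sq ?_ hs
  rw [e]
  -- Squaring the claim and dividing by `b²` and `g²` leaves this inequality. It holds since `b² ≥
  -- (16/17)²` exceeds `21/25` and `g² ≤ 1/4`.
  have h1 : 4 / 5 + 4 / 25 * g ^ 2 ≤ b ^ 2 := by nlinarith
  have h2 := mul_le_mul_of_nonneg_right h1 (mul_nonneg (sq_nonneg b) (sq_nonneg g))
  nlinarith

end Scalar

/-! ### Eigenvalue bound under the volume constraint -/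

section Eigenvalue

variable {f : (𝔼 N) → ℝ} {R : ℝ}

theorem IsProfile.integrable_one_add_pow (hf : IsProfile f) (k : ℕ) :
    Integrable (fun θ : Metric.sphere (0 : 𝔼 N) 1 => (1 + f θ) ^ k) (surface N) :=
  integrable_sphere_of_continuous ((continuous_const.add hf.continuous_sphere).pow k)

theorem lambda1_nonneg (Ω : Set (𝔼 N)) : 0 ≤ lambda1 Ω := by
  refine Real.sInf_nonneg ?_
  rintro q ⟨u, g, -, -, rfl⟩
  exact div_nonneg (integral_nonneg fun _ => by positivity) (integral_nonneg fun _ => by positivity)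

variable [NeZero N]

/-- In `∫ |∇s|² s⁻ᴺ` the term `∫ (1+f)ᴺ⁻²` is at most `m` by convexity and the volume constraint.
Neither a linear term nor an `L²` term in `f` survives, only its gradient. -/
theorem lambda1_gauge_sub_le (hN : 2 ≤ N) (hf : IsProfile f)
    (hb : ∀ x : 𝔼 N, x ≠ 0 → |f x| ≤ 1 / 2) (hR : 0 < R)
    (hm : ∫ θ : Metric.sphere (0 : 𝔼 N) 1, (1 + f θ) ^ N ∂(surface N) = (surface N).real univ) :
    lambda1 {x | gauge f x < R} - lambda1 (Metric.ball (0 : 𝔼 N) R) ≤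
      lambda1 (Metric.ball (0 : 𝔼 N) R) * (16 * (3 / 2) ^ N / (surface N).real univ) *
        ∫ θ : Metric.sphere (0 : 𝔼 N) 1, ‖gradient f (θ : 𝔼 N)‖ ^ 2 ∂(surface N) := by
  have hm0 := surface_real_univ_pos (N := N)
  set m := (surface N).real univ with hmdef
  set G := ∫ θ : Metric.sphere (0 : 𝔼 N) 1, ‖gradient f (θ : 𝔼 N)‖ ^ 2 ∂(surface N) with hG
  have hG0 : 0 ≤ G := integral_nonneg fun _ => by positivity
  have hN0 : (0 : ℝ) < N := by exact_mod_cast (by omega : 0 < N)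
  obtain ⟨k, hk⟩ : ∃ k, N = k + 2 := ⟨N - 2, by omega⟩
  have hkN : (N : ℝ) = k + 2 := by exact_mod_cast hk
  have hi1 : Integrable (fun θ : Metric.sphere (0 : 𝔼 N) 1 => 2 / (N : ℝ) + k / N * (1 + f θ) ^ N)
      (surface N) := (integrable_const _).add ((hf.integrable_one_add_pow N).const_mul _)
  have hi2 : Integrable (fun θ : Metric.sphere (0 : 𝔼 N) 1 =>
      16 * (3 / 2 : ℝ) ^ N * ‖gradient f (θ : 𝔼 N)‖ ^ 2) (surface N) :=
    hf.integrable_norm_gradient_sq.const_mul _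
  have hA : ∫ θ : Metric.sphere (0 : 𝔼 N) 1, ‖gradient (gauge f) (θ : 𝔼 N)‖ ^ 2 *
      (gauge f (θ : 𝔼 N) ^ N)⁻¹ ∂(surface N) ≤ m + 16 * (3 / 2) ^ N * G := by
    have h1 : m + 16 * (3 / 2) ^ N * G = ∫ θ : Metric.sphere (0 : 𝔼 N) 1,
        (2 / (N : ℝ) + k / N * (1 + f θ) ^ N + 16 * (3 / 2 : ℝ) ^ N * ‖gradient f (θ : 𝔼 N)‖ ^ 2)
          ∂(surface N) := by
      rw [integral_add hi1 hi2, integral_const_mul, integral_add (integrable_const _)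
        ((hf.integrable_one_add_pow N).const_mul _), integral_const_mul, hm,
        integral_const, smul_eq_mul, ← hmdef, hG]
      congr 1
      field_simp
      rw [hkN]
      ring
    rw [h1]
    refine integral_mono_of_nonneg (Eventually.of_forall fun θ => ?_) (hi1.add hi2) ?_
    · exact mul_nonneg (by positivity) (inv_nonneg.2 (pow_nonneg (gauge_nonneg hb _) _))
    filter_upwards [hf.ae_differentiableAt] with θ hθ
    have hθ0 : (θ : 𝔼 N) ≠ 0 := Metric.ne_of_mem_sphere θ.2 one_ne_zero
    have hpos := one_add_pos hb hθ0
    obtain ⟨hl, hu⟩ := abs_le.1 (hb θ hθ0)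
    rw [inv_gauge_pow, norm_gradient_gauge_sq hf (norm_eq_of_mem_sphere θ) hpos.ne' hθ]
    set a := 1 + f (θ : 𝔼 N) with ha
    set g := ‖gradient f (θ : 𝔼 N)‖
    have e1 : (a ^ 2)⁻¹ * a ^ N = a ^ k := by
      rw [hk, pow_add]; field_simp
    have h2 : a ^ k ≤ 2 / N + k / N * a ^ N := by
      have h3 := add_two_mul_pow_le k hpos.le
      rw [← hkN, ← hk] at h3
      rw [div_mul_eq_mul_div, ← add_div, le_div_iff₀ hN0]
      linarith
    -- The constant `16 (3/2)ᴺ` comes from `1/2 ≤ a ≤ 3/2`.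
    have h4 : (a ^ 4)⁻¹ ≤ 16 := by
      rw [inv_le_comm₀ (by positivity) (by norm_num)]
      calc (16 : ℝ)⁻¹ = (1 / 2) ^ 4 := by norm_num
        _ ≤ a ^ 4 := pow_le_pow_left₀ (by norm_num) (by linarith) 4
    have h5 : a ^ N ≤ (3 / 2) ^ N := pow_le_pow_left₀ hpos.le (by linarith) N
    calc ((a ^ 2)⁻¹ + (a ^ 4)⁻¹ * g ^ 2) * a ^ N =
          (a ^ 2)⁻¹ * a ^ N + ((a ^ 4)⁻¹ * a ^ N) * g ^ 2 := by ring
      _ ≤ (2 / N + k / N * a ^ N) + (16 * (3 / 2) ^ N) * g ^ 2 := by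
        rw [e1]
        gcongr
  have h := lambda1_mul_le_of_profile hf hb hR (m := m) (A := m + 16 * (3 / 2) ^ N * G)
    (by simpa only [inv_gauge_pow] using hm) hA (by positivity)
  rw [← le_div_iff₀ hm0] at h
  calc _ ≤ (m + 16 * (3 / 2) ^ N * G) * lambda1 (Metric.ball (0 : 𝔼 N) R) / m -
        lambda1 (Metric.ball (0 : 𝔼 N) R) := by linarith
    _ = _ := by field_simp; ring

end Eigenvalue

/-! ### Quantitative isoperimetric inequality for nearly spherical sets -/

section Perimeter

variable {f : (𝔼 N) → ℝ}

/-- Expand `w (1+f)ᵏ` to second order: the constraint cancels the term of order zero, so the linear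
moment equals a quadratic remainder. -/
theorem abs_moment_le (hf : IsProfile f) (hb : ∀ x : 𝔼 N, x ≠ 0 → |f x| ≤ 1 / 2)
    {w : (𝔼 N) → ℝ} (hw : Continuous w) (hw1 : ∀ θ : Metric.sphere (0 : 𝔼 N) 1, |w θ| ≤ 1) {k : ℕ}
    (hk : 1 ≤ k) (hz : ∫ θ : Metric.sphere (0 : 𝔼 N) 1, w θ * (1 + f θ) ^ k ∂(surface N) =
      ∫ θ : Metric.sphere (0 : 𝔼 N) 1, w θ ∂(surface N)) :
    |∫ θ : Metric.sphere (0 : 𝔼 N) 1, f θ * w θ ∂(surface N)| ≤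
      4 ^ k * ∫ θ : Metric.sphere (0 : 𝔼 N) 1, f θ ^ 2 ∂(surface N) := by
  have hw' : Continuous fun θ : Metric.sphere (0 : 𝔼 N) 1 => w θ := hw.comp continuous_subtype_val
  have hfc := hf.continuous_sphere
  have i1 : Integrable (fun θ : Metric.sphere (0 : 𝔼 N) 1 => w θ * (1 + f θ) ^ k) (surface N) :=
    integrable_sphere_of_continuous (hw'.mul ((continuous_const.add hfc).pow k))
  have i2 : Integrable (fun θ : Metric.sphere (0 : 𝔼 N) 1 => w θ) (surface N) :=
    integrable_sphere_of_continuous hw'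
  have i3 : Integrable (fun θ : Metric.sphere (0 : 𝔼 N) 1 => k * (f θ * w θ)) (surface N) :=
    integrable_sphere_of_continuous (continuous_const.mul (hfc.mul hw'))
  have i12 : Integrable (fun θ : Metric.sphere (0 : 𝔼 N) 1 => w θ * (1 + f θ) ^ k - w θ)
    (surface N) := i1.sub i2
  have h1 : ∫ θ : Metric.sphere (0 : 𝔼 N) 1,
      (w θ * (1 + f θ) ^ k - w θ - k * (f θ * w θ)) ∂(surface N) =
      -(k * ∫ θ : Metric.sphere (0 : 𝔼 N) 1, f θ * w θ ∂(surface N)) := by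
    rw [integral_sub i12 i3, integral_sub i1 i2, hz, sub_self, zero_sub, integral_const_mul]
  have h2 : |∫ θ : Metric.sphere (0 : 𝔼 N) 1,
      (w θ * (1 + f θ) ^ k - w θ - k * (f θ * w θ)) ∂(surface N)| ≤
      4 ^ k * ∫ θ : Metric.sphere (0 : 𝔼 N) 1, f θ ^ 2 ∂(surface N) := by
    rw [← integral_const_mul]
    refine (abs_integral_le_integral_abs).trans (integral_mono (i12.sub i3).abs
      (hf.integrable_sq.const_mul _) fun θ => ?_)
    have hθ := hb θ (Metric.ne_of_mem_sphere θ.2 one_ne_zero)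
    have h3 := abs_one_add_pow_sub_le k (hθ.trans (by norm_num))
    have e : w θ * (1 + f θ) ^ k - w θ - k * (f θ * w θ) =
        w θ * ((1 + f θ) ^ k - 1 - k * f θ) := by ring
    simp only
    rw [e, abs_mul]
    calc _ ≤ 1 * (4 ^ k * f (θ : 𝔼 N) ^ 2) :=
          mul_le_mul (hw1 θ) h3 (abs_nonneg _) zero_le_one
      _ = _ := one_mul _
  rw [h1, abs_neg, abs_mul, Nat.abs_cast] at h2
  have hk' : (1 : ℝ) ≤ k := by exact_mod_cast hk
  nlinarith [abs_nonneg (∫ θ : Metric.sphere (0 : 𝔼 N) 1, f θ * w θ ∂(surface N))]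

/-- The pointwise inequality behind the stability of the perimeter. -/
theorem le_norm_gradient_gauge_mul (hf : IsProfile f) {n : ℕ} (hn : N = n + 1)
    {θ : Metric.sphere (0 : 𝔼 N) 1} (hx : N * |f θ| ≤ 1 / 16)
    (hg : ‖gradient f (θ : 𝔼 N)‖ ≤ 1 / 2) (hd : DifferentiableAt ℝ f (θ : 𝔼 N)) :
    1 / N + n / N * (1 + f θ) ^ N - 3 / 4 * n * f θ ^ 2 + 3 / 8 * ‖gradient f (θ : 𝔼 N)‖ ^ 2 ≤
      ‖gradient (gauge f) (θ : 𝔼 N)‖ * (gauge f (θ : 𝔼 N) ^ N)⁻¹ := by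
  have hnN : (N : ℝ) = n + 1 := by exact_mod_cast hn
  have hN1 : (1 : ℝ) ≤ N := by rw [hnN]; linarith [n.cast_nonneg (α := ℝ)]
  have hN0 : (0 : ℝ) < N := by linarith
  have hx1 : |f (θ : 𝔼 N)| ≤ 1 / 16 := by nlinarith [abs_nonneg (f (θ : 𝔼 N))]
  obtain ⟨hl, hu⟩ := abs_le.1 hx1
  have hpos : 0 < 1 + f (θ : 𝔼 N) := by linarith
  have hsq := norm_gradient_gauge_sq hf (norm_eq_of_mem_sphere θ) hpos.ne' hd
  have h1 := le_of_sq_eq_inv_sq_add hpos (by linarith) (by rwa [abs_norm]) (norm_nonneg _) hsq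
  have h2 := one_add_mul_pow_sub_le n (a := 1 + f (θ : 𝔼 N))
    fun j hj => (pow_bounds hx (by omega)).2
  have h3 := (pow_bounds hx (show n ≤ N by omega)).1
  rw [inv_gauge_pow]
  have hfa : f (θ : 𝔼 N) = (1 + f (θ : 𝔼 N)) - 1 := by ring
  generalize hadef : 1 + f (θ : 𝔼 N) = a at *
  generalize ‖gradient f (θ : 𝔼 N)‖ = g at *
  generalize ‖gradient (gauge f) (θ : 𝔼 N)‖ = s at *
  have e1 : a⁻¹ * a ^ N = a ^ n := by rw [hn, pow_succ]; field_simp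
  rw [← hnN, ← hn] at h2
  have h4 : 1 / N + n / N * a ^ N - 3 / 4 * n * (a - 1) ^ 2 ≤ a ^ n := by
    have : 1 / (N : ℝ) + n / N * a ^ N - 3 / 4 * n * (a - 1) ^ 2 =
        (1 + n * a ^ N - 3 / 4 * n * N * (a - 1) ^ 2) / N := by field_simp
    rw [this, div_le_iff₀ hN0]
    linarith
  have h5 : a ^ n * (1 + 2 / 5 * g ^ 2) ≤ s * a ^ N := by
    have := mul_le_mul_of_nonneg_right h1 (pow_nonneg hpos.le N)
    calc _ = a⁻¹ * (1 + 2 / 5 * g ^ 2) * a ^ N := by rw [← e1]; ring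
      _ ≤ _ := this
  -- The coefficient `3/8` is `(15/16) · (2/5)`.
  have h6 := mul_le_mul_of_nonneg_right h3 (sq_nonneg g)
  rw [hfa]
  linarith

theorem integrable_norm_gradient_gauge_mul (hf : IsProfile f)
    (hb : ∀ x : 𝔼 N, x ≠ 0 → |f x| ≤ 1 / 2) :
    Integrable (fun θ : Metric.sphere (0 : 𝔼 N) 1 => ‖gradient (gauge f) (θ : 𝔼 N)‖ *
      (gauge f (θ : 𝔼 N) ^ N)⁻¹) (surface N) := by
  obtain ⟨K, hK⟩ := exists_lipschitzWith_gauge hf hb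
  have hgm : Measurable (gauge f) := hK.continuous.measurable
  refine integrable_sphere_of_bound (g := fun x => ‖gradient (gauge f) x‖ * (gauge f x ^ N)⁻¹)
    ((measurable_gradient _).norm.mul (hgm.pow_const N).inv) (C := K * (3 / 2) ^ N) fun θ => ?_
  have hθ0 : (θ : 𝔼 N) ≠ 0 := Metric.ne_of_mem_sphere θ.2 one_ne_zero
  have hpos := one_add_pos hb hθ0
  rw [inv_gauge_pow, abs_mul, abs_norm, abs_of_nonneg (pow_nonneg hpos.le N), norm_gradient]
  refine mul_le_mul (norm_fderiv_le_of_lipschitz ℝ hK) (pow_le_pow_left₀ hpos.le ?_ N)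
    (pow_nonneg hpos.le N) K.coe_nonneg
  linarith [(abs_le.1 (hb θ hθ0)).2]

variable [NeZero N]

theorem integral_coord_sphere (hN : 2 ≤ N) (i : Fin N) :
    ∫ θ : Metric.sphere (0 : 𝔼 N) 1, (θ : 𝔼 N) i ∂(surface N) = 0 := by
  have := sphInner_X_one hN i
  simpa only [sphInner_apply, polyEval_X, polyEval_one, mul_one] using this

/-- The Poincaré inequality with almost optimal constant for functions with nearly vanishing
moments. -/
theorem poincare_sphere_of_constraints (hN : 2 ≤ N) (hf : IsProfile f) {η : ℝ} (hη : η ≤ 1 / 2)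
    (hη2 : (1 + (N : ℝ) ^ 2) * 16 ^ (N + 1) * η ≤ 1 / (16 * N))
    (hb : ∀ x : 𝔼 N, x ≠ 0 → |f x| ≤ η)
    (hm : ∫ θ : Metric.sphere (0 : 𝔼 N) 1, (1 + f θ) ^ N ∂(surface N) = (surface N).real univ)
    (hbar : ∀ i, ∫ θ : Metric.sphere (0 : 𝔼 N) 1, (θ : 𝔼 N) i * (1 + f θ) ^ (N + 1) ∂(surface N) =
      0) :
    (2 * N - 1 / 8) * (∫ θ : Metric.sphere (0 : 𝔼 N) 1, f θ ^ 2 ∂(surface N)) ≤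
      ∫ θ : Metric.sphere (0 : 𝔼 N) 1, ‖gradient f (θ : 𝔼 N)‖ ^ 2 ∂(surface N) := by
  have hm0 := surface_real_univ_pos (N := N)
  have hpoin := poincare_sphere_moments hN hf
  have hQ0 : 0 ≤ ∫ θ : Metric.sphere (0 : 𝔼 N) 1, f θ ^ 2 ∂(surface N) :=
    integral_nonneg fun _ => by positivity
  have hN0 : (0 : ℝ) < N := by exact_mod_cast (by omega : 0 < N)
  have hb2 : ∀ x : 𝔼 N, x ≠ 0 → |f x| ≤ 1 / 2 := fun x hx => (hb x hx).trans hη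
  have hI0 := abs_moment_le hf hb2 (w := fun _ => 1) continuous_const (by simp) (k := N)
    (by omega) (by simp only [one_mul, hm]; simp)
  simp only [mul_one] at hI0
  have hI1 : ∀ i, |∫ θ : Metric.sphere (0 : 𝔼 N) 1, f θ * (θ : 𝔼 N) i ∂(surface N)| ≤
      4 ^ (N + 1) * ∫ θ : Metric.sphere (0 : 𝔼 N) 1, f θ ^ 2 ∂(surface N) := by
    intro i
    refine abs_moment_le hf hb2 (w := fun x => x i)
      (EuclideanSpace.proj i : (𝔼 N) →L[ℝ] ℝ).continuous (fun θ => ?_) (by omega) ?_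
    · exact (PiLp.norm_apply_le (θ : 𝔼 N) i).trans_eq (norm_eq_of_mem_sphere θ)
    · rw [hbar i, integral_coord_sphere hN]
  -- The squared moments are of order `Q²`; this bound turns one factor `Q` into the small number
  -- `η`.
  have hQη : ∫ θ : Metric.sphere (0 : 𝔼 N) 1, f θ ^ 2 ∂(surface N) ≤
      η * (surface N).real univ := by
    calc _ ≤ ∫ θ : Metric.sphere (0 : 𝔼 N) 1, η ∂(surface N) := by
          refine integral_mono hf.integrable_sq (integrable_const _) fun θ => ?_
          have := hb θ (Metric.ne_of_mem_sphere θ.2 one_ne_zero)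
          simp only
          rw [← sq_abs]
          nlinarith [abs_nonneg (f (θ : 𝔼 N))]
      _ = η * (surface N).real univ := by rw [integral_const, smul_eq_mul, mul_comm]
  generalize (∫ θ : Metric.sphere (0 : 𝔼 N) 1, f θ ∂(surface N)) = I0 at *
  generalize (∫ θ : Metric.sphere (0 : 𝔼 N) 1, f θ ^ 2 ∂(surface N)) = Q at *
  generalize hI1' : (fun i => ∫ θ : Metric.sphere (0 : 𝔼 N) 1, f θ * (θ : 𝔼 N) i ∂(surface N)) =
    I1 at *
  replace hI1 : ∀ i, |I1 i| ≤ 4 ^ (N + 1) * Q := fun i => by rw [← hI1']; exact hI1 i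
  have hsum : ∑ i, (∫ θ : Metric.sphere (0 : 𝔼 N) 1, f θ * (θ : 𝔼 N) i ∂(surface N)) ^ 2 =
      ∑ i, I1 i ^ 2 := by rw [← hI1']
  rw [hsum] at hpoin
  generalize (surface N).real univ = m at *
  have hsq : ∀ x : ℝ, |x| ≤ 4 ^ (N + 1) * Q → x ^ 2 ≤ 16 ^ (N + 1) * Q ^ 2 := by
    intro x hx
    rw [← sq_abs]
    calc |x| ^ 2 ≤ (4 ^ (N + 1) * Q) ^ 2 := pow_le_pow_left₀ (abs_nonneg x) hx 2
      _ = (4 ^ 2) ^ (N + 1) * Q ^ 2 := by rw [mul_pow, ← pow_mul, ← pow_mul, mul_comm (N + 1)]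
      _ = _ := by norm_num
  -- Multiplied by the gap `2N`, this gives the loss `Q / 8`, hence the constant `2N - 1/8`.
  have hmom : m⁻¹ * (I0 ^ 2 + N * ∑ i, I1 i ^ 2) ≤ 1 / (16 * N) * Q := by
    have h1 := hsq _ (hI0.trans (mul_le_mul_of_nonneg_right
      (pow_le_pow_right₀ (by norm_num) (Nat.le_succ N)) hQ0))
    have h2 : ∑ i, I1 i ^ 2 ≤ N * (16 ^ (N + 1) * Q ^ 2) := by
      calc _ ≤ ∑ _i : Fin N, (16 : ℝ) ^ (N + 1) * Q ^ 2 :=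
            Finset.sum_le_sum fun i _ => hsq _ (hI1 i)
        _ = _ := by simp
    rw [inv_mul_le_iff₀ hm0]
    calc _ ≤ 16 ^ (N + 1) * Q ^ 2 + N * (N * (16 ^ (N + 1) * Q ^ 2)) := by gcongr
      _ = ((1 + (N : ℝ) ^ 2) * 16 ^ (N + 1) * Q) * Q := by ring
      _ ≤ ((1 + (N : ℝ) ^ 2) * 16 ^ (N + 1) * (η * m)) * Q := by gcongr
      _ = ((1 + (N : ℝ) ^ 2) * 16 ^ (N + 1) * η) * (m * Q) := by ring
      _ ≤ 1 / (16 * N) * (m * Q) := by gcongr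
      _ = m * (1 / (16 * N) * Q) := by ring
  have h := mul_le_mul_of_nonneg_left hmom (show 0 ≤ 2 * (N : ℝ) by positivity)
  have e : 2 * (N : ℝ) * (1 / (16 * N) * Q) = Q / 8 := by field_simp; ring
  rw [e] at h
  linarith

/-- A quantitative isoperimetric inequality for nearly spherical sets, in terms of the integral
that represents the perimeter. -/
theorem le_integral_norm_gradient_gauge (hN : 2 ≤ N) (hf : IsProfile f) {η : ℝ} (hη : 0 < η)
    (hη1 : N * η ≤ 1 / 16) (hη2 : (1 + (N : ℝ) ^ 2) * 16 ^ (N + 1) * η ≤ 1 / (16 * N))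
    (hb : ∀ x : 𝔼 N, x ≠ 0 → |f x| ≤ η)
    (hg : ∀ᵐ θ : Metric.sphere (0 : 𝔼 N) 1 ∂(surface N), ‖gradient f (θ : 𝔼 N)‖ ≤ 1 / 2)
    (hm : ∫ θ : Metric.sphere (0 : 𝔼 N) 1, (1 + f θ) ^ N ∂(surface N) = (surface N).real univ)
    (hbar : ∀ i, ∫ θ : Metric.sphere (0 : 𝔼 N) 1, (θ : 𝔼 N) i * (1 + f θ) ^ (N + 1) ∂(surface N) =
      0) :
    (surface N).real univ + 1 / (16 * N) *
        ((∫ θ : Metric.sphere (0 : 𝔼 N) 1, f θ ^ 2 ∂(surface N)) +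
          ∫ θ : Metric.sphere (0 : 𝔼 N) 1, ‖gradient f (θ : 𝔼 N)‖ ^ 2 ∂(surface N)) ≤
      ∫ θ : Metric.sphere (0 : 𝔼 N) 1, ‖gradient (gauge f) (θ : 𝔼 N)‖ *
        (gauge f (θ : 𝔼 N) ^ N)⁻¹ ∂(surface N) := by
  have hm0 := surface_real_univ_pos (N := N)
  set m := (surface N).real univ with hmdef
  set Q := ∫ θ : Metric.sphere (0 : 𝔼 N) 1, f θ ^ 2 ∂(surface N) with hQ
  set G := ∫ θ : Metric.sphere (0 : 𝔼 N) 1, ‖gradient f (θ : 𝔼 N)‖ ^ 2 ∂(surface N) with hG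
  have hQ0 : 0 ≤ Q := integral_nonneg fun _ => by positivity
  have hG0 : 0 ≤ G := integral_nonneg fun _ => by positivity
  have hN2 : (2 : ℝ) ≤ N := by exact_mod_cast hN
  have hN0 : (0 : ℝ) < N := by linarith
  have hη3 : η ≤ 1 / 32 := by nlinarith
  have hb2 : ∀ x : 𝔼 N, x ≠ 0 → |f x| ≤ 1 / 2 := fun x hx => (hb x hx).trans (by linarith)
  obtain ⟨n, hn⟩ : ∃ n, N = n + 1 := ⟨N - 1, by omega⟩
  have hnN : (N : ℝ) = n + 1 := by exact_mod_cast hn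
  have hpoin := poincare_sphere_of_constraints hN hf (by linarith) hη2 hb hm hbar
  rw [← hQ, ← hG] at hpoin
  have i1 : Integrable (fun θ : Metric.sphere (0 : 𝔼 N) 1 => 1 / (N : ℝ) + n / N * (1 + f θ) ^ N)
      (surface N) := (integrable_const _).add ((hf.integrable_one_add_pow N).const_mul _)
  have i2 : Integrable (fun θ : Metric.sphere (0 : 𝔼 N) 1 => 3 / 4 * n * f θ ^ 2) (surface N) :=
    hf.integrable_sq.const_mul _
  have i3 : Integrable (fun θ : Metric.sphere (0 : 𝔼 N) 1 => 3 / 8 * ‖gradient f (θ : 𝔼 N)‖ ^ 2)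
    (surface N) := hf.integrable_norm_gradient_sq.const_mul _
  have i12 : Integrable (fun θ : Metric.sphere (0 : 𝔼 N) 1 =>
    1 / (N : ℝ) + n / N * (1 + f θ) ^ N - 3 / 4 * n * f θ ^ 2) (surface N) := i1.sub i2
  have hlow : ∫ θ : Metric.sphere (0 : 𝔼 N) 1, (1 / (N : ℝ) + n / N * (1 + f θ) ^ N -
      3 / 4 * n * f θ ^ 2 + 3 / 8 * ‖gradient f (θ : 𝔼 N)‖ ^ 2) ∂(surface N) =
      m - 3 / 4 * n * Q + 3 / 8 * G := by
    rw [integral_add i12 i3, integral_sub i1 i2, integral_const_mul, integral_const_mul,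
      integral_add (integrable_const _) ((hf.integrable_one_add_pow N).const_mul _),
      integral_const_mul, hm, integral_const, smul_eq_mul, ← hmdef, hG]
    congr 2
    field_simp
    rw [hnN]
    ring
  have hmono : m - 3 / 4 * n * Q + 3 / 8 * G ≤ ∫ θ : Metric.sphere (0 : 𝔼 N) 1,
      ‖gradient (gauge f) (θ : 𝔼 N)‖ * (gauge f (θ : 𝔼 N) ^ N)⁻¹ ∂(surface N) := by
    rw [← hlow]
    refine integral_mono_ae (i12.add i3) (integrable_norm_gradient_gauge_mul hf hb2) ?_
    filter_upwards [hf.ae_differentiableAt, hg] with θ hθ hgθ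
    exact le_norm_gradient_gauge_mul hf hn ((mul_le_mul_of_nonneg_left
      (hb θ (Metric.ne_of_mem_sphere θ.2 one_ne_zero)) hN0.le).trans hη1) hgθ hθ
  refine le_trans ?_ hmono
  -- The Poincaré inequality is applied to the share `3/8 - 1/(16N)` of `G`; the rest is kept as
  -- gain. Since `(3/8)(2N - 1/8)` exceeds `(3/4)(N - 1)` by `45/64`, enough of `Q` is left as well.
  have hc : 1 / (16 * (N : ℝ)) * (Q + G) ≤ 3 / 8 * G - 3 / 4 * n * Q := by
    have h1 : (n : ℝ) = N - 1 := by rw [hnN]; ring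
    have h2 : 0 ≤ 3 / 8 - 1 / (16 * (N : ℝ)) := by
      rw [sub_nonneg, div_le_iff₀ (by positivity)]
      linarith
    have h3 := mul_le_mul_of_nonneg_left hpoin h2
    have h4 : (3 / 8 - 1 / (16 * (N : ℝ))) * ((2 * N - 1 / 8) * Q) =
        3 / 4 * N * Q - 3 / 64 * Q - Q / 8 + 1 / (16 * N) * (Q / 8) := by field_simp; ring
    have h5 : 1 / (16 * (N : ℝ)) ≤ 1 / 32 := by
      rw [div_le_div_iff_of_pos_left one_pos (by positivity) (by norm_num)]
      linarith
    have h6 := mul_le_mul_of_nonneg_right h5 hQ0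
    rw [h4] at h3
    rw [h1]
    nlinarith
  linarith

end Perimeter

/-! ### Conclusion for perturbed balls -/

section Stability

variable {R : ℝ} {h : (𝔼 N) → ℝ}

theorem normH1_sq (hR : 0 < R) (hh : MemW1Inf R h) :
    normH1 R h ^ 2 = R ^ (N - 1) *
      ((∫ θ : Metric.sphere (0 : 𝔼 N) 1, radialExtension R h θ ^ 2 ∂(surface N)) + (R⁻¹) ^ 2 *
        ∫ θ : Metric.sphere (0 : 𝔼 N) 1, ‖gradient (radialExtension R h) (θ : 𝔼 N)‖ ^ 2
          ∂(surface N)) := by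
  rw [normH1, Real.sq_sqrt (add_nonneg (integral_nonneg fun _ => by positivity)
    (integral_nonneg fun _ => by positivity)), integral_sphereMeasure hR,
    integral_sphereMeasure hR, ← mul_add, ← integral_const_mul]
  congr 2
  · simp only [radialExtension_apply_smul]
  · refine integral_congr_ae (Eventually.of_forall fun θ => ?_)
    simp only
    rw [tangentialGradient_smul hR hh, norm_smul, mul_pow, Real.norm_eq_abs, sq_abs]

/-- The constant in the bound of the first eigenvalue. -/
def eigenvalueConst (N : ℕ) (R : ℝ) : ℝ :=
  lambda1 (Metric.ball (0 : 𝔼 N) R) * (16 * (3 / 2) ^ N / (surface N).real univ)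

theorem eigenvalueConst_nonneg : 0 ≤ eigenvalueConst N R :=
  mul_nonneg (lambda1_nonneg _) (div_nonneg (by positivity) measureReal_nonneg)

/-- The bound on the `W^{1,∞}` norm under which the ball is optimal. -/
def stabilityRadius (N : ℕ) (R : ℝ) : ℝ :=
  min (1 / (2 * R)) (1 / (16 * N) / ((1 + (N : ℝ) ^ 2) * 16 ^ (N + 1)))

theorem mul_stabilityRadius_le (hR : 0 < R) : R * stabilityRadius N R ≤ 1 / 2 := by
  calc R * stabilityRadius N R ≤ R * (1 / (2 * R)) := by
        gcongr
        exact min_le_left _ _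
    _ = 1 / 2 := by field_simp

theorem const_mul_stabilityRadius_le :
    (1 + (N : ℝ) ^ 2) * 16 ^ (N + 1) * stabilityRadius N R ≤ 1 / (16 * N) := by
  have h : (0 : ℝ) < (1 + (N : ℝ) ^ 2) * 16 ^ (N + 1) := by positivity
  rw [← le_div_iff₀' h]
  exact min_le_right _ _

variable [NeZero N]

theorem lambda1_perturbedBall_sub_le (hN : 2 ≤ N) (hR : 0 < R) (hh : MemW1Inf R h)
    (hL : normLInf R h ≤ ENNReal.ofReal (1 / 2))
    (hv : volume (perturbedBall R h) = volume (Metric.ball (0 : 𝔼 N) R)) :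
    lambda1 (perturbedBall R h) - lambda1 (Metric.ball (0 : 𝔼 N) R) ≤ eigenvalueConst N R *
      ∫ θ : Metric.sphere (0 : 𝔼 N) 1, ‖gradient (radialExtension R h) (θ : 𝔼 N)‖ ^ 2
        ∂(surface N) := by
  have hf := isProfile_radialExtension hR hh
  have hb := forall_abs_le_of_normLInf_le hR hh (by norm_num) hL
  rw [perturbedBall_eq hR hh hb] at hv ⊢
  exact lambda1_gauge_sub_le hN hf hb hR (integral_one_add_pow_eq hf hb hR hv)

/-- The summand `1` only makes the constant positive, `eigenvalueConst` being known to be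
nonnegative. -/
theorem lambda1_perturbedBall_sub_le_normH1 (hN : 2 ≤ N) (hR : 0 < R) (hh : MemW1Inf R h)
    (hL : normLInf R h ≤ ENNReal.ofReal (1 / 2))
    (hv : volume (perturbedBall R h) = volume (Metric.ball (0 : 𝔼 N) R)) :
    lambda1 (perturbedBall R h) - lambda1 (Metric.ball (0 : 𝔼 N) R) ≤
      (eigenvalueConst N R * (R ^ 2 / R ^ (N - 1)) + 1) * normH1 R h ^ 2 := by
  have h1 := lambda1_perturbedBall_sub_le hN hR hh hL hv
  have h2 := normH1_sq (N := N) hR hh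
  have hQ : 0 ≤ ∫ θ : Metric.sphere (0 : 𝔼 N) 1, radialExtension R h θ ^ 2 ∂(surface N) :=
    integral_nonneg fun _ => by positivity
  generalize (∫ θ : Metric.sphere (0 : 𝔼 N) 1, radialExtension R h θ ^ 2 ∂(surface N)) = Q at *
  generalize (∫ θ : Metric.sphere (0 : 𝔼 N) 1, ‖gradient (radialExtension R h) (θ : 𝔼 N)‖ ^ 2
    ∂(surface N)) = G at *
  have hC := eigenvalueConst_nonneg (N := N) (R := R)
  have h3 : G ≤ R ^ 2 / R ^ (N - 1) * normH1 R h ^ 2 := by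
    have : R ^ 2 / R ^ (N - 1) * normH1 R h ^ 2 = R ^ 2 * Q + G := by
      rw [h2]; field_simp
    rw [this]
    nlinarith [mul_nonneg (sq_nonneg R) hQ]
  calc _ ≤ eigenvalueConst N R * G := h1
    _ ≤ eigenvalueConst N R * (R ^ 2 / R ^ (N - 1) * normH1 R h ^ 2) := by gcongr
    _ ≤ _ := by nlinarith [sq_nonneg (normH1 R h)]

theorem stabilityRadius_pos (hR : 0 < R) : 0 < stabilityRadius N R := by
  have : (0 : ℝ) < N := by exact_mod_cast NeZero.pos N
  exact lt_min (by positivity) (by positivity)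

theorem natCast_mul_stabilityRadius_le (hR : 0 < R) : N * stabilityRadius N R ≤ 1 / 16 := by
  have hN : (0 : ℝ) < N := by exact_mod_cast NeZero.pos N
  have h1 := const_mul_stabilityRadius_le (N := N) (R := R)
  have h2 := (stabilityRadius_pos (N := N) hR).le
  have h3 : (1 : ℝ) ≤ (1 + (N : ℝ) ^ 2) * 16 ^ (N + 1) :=
    one_le_mul_of_one_le_of_one_le (by nlinarith) (one_le_pow₀ (by norm_num))
  have h4 : stabilityRadius N R ≤ 1 / (16 * N) := by nlinarith
  rw [le_div_iff₀ (by positivity)] at h4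
  linarith

theorem ofReal_le_perimeter_perturbedBall (hN : 2 ≤ N) (hR : 0 < R) (hh : MemW1Inf R h)
    (hW : normW1Inf R h ≤ ENNReal.ofReal (stabilityRadius N R))
    (hv : volume (perturbedBall R h) = volume (Metric.ball (0 : 𝔼 N) R))
    (hbar : barycenter (perturbedBall R h) = 0) :
    ENNReal.ofReal (R ^ (N - 1) * ((surface N).real univ + 1 / (16 * N) *
        ((∫ θ : Metric.sphere (0 : 𝔼 N) 1, radialExtension R h θ ^ 2 ∂(surface N)) +
          ∫ θ : Metric.sphere (0 : 𝔼 N) 1, ‖gradient (radialExtension R h) (θ : 𝔼 N)‖ ^ 2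
            ∂(surface N)))) ≤ perimeter (perturbedBall R h) := by
  have hη := stabilityRadius_pos (N := N) hR
  have hη1 := natCast_mul_stabilityRadius_le (N := N) hR
  have hN2 : (2 : ℝ) ≤ N := by exact_mod_cast hN
  have hf := isProfile_radialExtension hR hh
  have hb := forall_abs_le_of_normLInf_le hR hh hη.le (le_self_add.trans hW)
  have hb2 : ∀ x : 𝔼 N, x ≠ 0 → |radialExtension R h x| ≤ 1 / 2 :=
    fun x hx => (hb x hx).trans (by nlinarith)
  -- On the unit sphere gradients are `R` times larger than on the sphere of radius `R`; hence the
  -- bound `1 / (2R)` in `stabilityRadius`.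
  have hg : ∀ᵐ θ : Metric.sphere (0 : 𝔼 N) 1 ∂(surface N),
      ‖gradient (radialExtension R h) (θ : 𝔼 N)‖ ≤ 1 / 2 := by
    filter_upwards [ae_norm_le_of_eLpNorm_sphereMeasure_le hR hη.le (le_add_self.trans hW)]
      with θ hθ
    rw [tangentialGradient_smul hR hh, norm_smul, norm_inv, Real.norm_of_nonneg hR.le,
      inv_mul_le_iff₀ hR] at hθ
    exact hθ.trans (mul_stabilityRadius_le hR)
  rw [perturbedBall_eq hR hh hb2] at hv hbar ⊢
  refine le_trans (ENNReal.ofReal_le_ofReal ?_) (ofReal_area_le_perimeter hf hb2 hR)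
  exact mul_le_mul_of_nonneg_left (le_integral_norm_gradient_gauge hN hf hη hη1
    const_mul_stabilityRadius_le hb hg (integral_one_add_pow_eq hf hb2 hR hv)
    (integral_one_add_pow_mul_eq hf hb2 hR hv hbar)) (pow_nonneg hR.le _)

theorem perturbedBall_eq_ball (hR : 0 < R) (hh : MemW1Inf R h)
    (hQ : ∫ θ : Metric.sphere (0 : 𝔼 N) 1, radialExtension R h θ ^ 2 ∂(surface N) ≤ 0) :
    perturbedBall R h = Metric.ball (0 : 𝔼 N) R := by
  have hf := isProfile_radialExtension hR hh
  have h1 : (fun θ : Metric.sphere (0 : 𝔼 N) 1 => radialExtension R h θ ^ 2) = 0 := by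
    refine (Continuous.ae_eq_iff_eq (surface N) (hf.continuous_sphere.pow 2) continuous_zero).1 ?_
    exact (integral_eq_zero_iff_of_nonneg (fun _ => sq_nonneg _) hf.integrable_sq).1
      (le_antisymm hQ (integral_nonneg fun _ => sq_nonneg _))
  have h2 : ∀ x : 𝔼 N, x ≠ 0 → radialExtension R h x = 0 := by
    intro x hx
    have := congrFun h1 ⟨_, normalize_mem_sphere hx⟩
    simp only [Pi.zero_apply, hf.apply_normalize hx] at this
    exact pow_eq_zero_iff two_ne_zero |>.1 this
  rw [perturbedBall_eq hR hh fun x hx => by rw [h2 x hx]; norm_num, ball_eq_gauge h2]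

/-- The bound on `ε` under which the ball is optimal. -/
def stabilityThreshold (N : ℕ) (R : ℝ) : ℝ :=
  R ^ (N - 1) * (1 / (16 * N)) / (eigenvalueConst N R + 1)

theorem stabilityThreshold_pos (hR : 0 < R) : 0 < stabilityThreshold N R := by
  have : (0 : ℝ) < N := by exact_mod_cast NeZero.pos N
  have := eigenvalueConst_nonneg (N := N) (R := R)
  exact div_pos (by positivity) (by positivity)

theorem energy_ball_le_energy_perturbedBall (hN : 2 ≤ N) (hR : 0 < R) (hh : MemW1Inf R h)
    (hW : normW1Inf R h ≤ ENNReal.ofReal (stabilityRadius N R))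
    (hv : volume (perturbedBall R h) = volume (Metric.ball (0 : 𝔼 N) R))
    (hbar : barycenter (perturbedBall R h) = 0) {ε : ℝ} (hε : 0 < ε)
    (hε0 : ε < stabilityThreshold N R) :
    energy ε (Metric.ball (0 : 𝔼 N) R) ≤ energy ε (perturbedBall R h) ∧
      (energy ε (perturbedBall R h) = energy ε (Metric.ball (0 : 𝔼 N) R) →
        perturbedBall R h = Metric.ball (0 : 𝔼 N) R) := by
  have hN0 : (0 : ℝ) < N := by exact_mod_cast NeZero.pos N
  have hη1 := natCast_mul_stabilityRadius_le (N := N) hR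
  have hη := stabilityRadius_pos (N := N) hR
  have hN2 : (2 : ℝ) ≤ N := by exact_mod_cast hN
  have hL : normLInf R h ≤ ENNReal.ofReal (1 / 2) :=
    (le_self_add.trans hW).trans (ENNReal.ofReal_le_ofReal (by nlinarith))
  have hP := ofReal_le_perimeter_perturbedBall hN hR hh hW hv hbar
  have hPB := perimeter_ball_le (N := N) hR
  have hlam := lambda1_perturbedBall_sub_le hN hR hh hL hv
  have hball := perturbedBall_eq_ball hR hh
  have hQ0 : 0 ≤ ∫ θ : Metric.sphere (0 : 𝔼 N) 1, radialExtension R h θ ^ 2 ∂(surface N) :=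
    integral_nonneg fun _ => by positivity
  have hG0 : 0 ≤ ∫ θ : Metric.sphere (0 : 𝔼 N) 1, ‖gradient (radialExtension R h) (θ : 𝔼 N)‖ ^ 2
    ∂(surface N) := integral_nonneg fun _ => by positivity
  generalize (∫ θ : Metric.sphere (0 : 𝔼 N) 1, radialExtension R h θ ^ 2 ∂(surface N)) = Q at *
  generalize (∫ θ : Metric.sphere (0 : 𝔼 N) 1, ‖gradient (radialExtension R h) (θ : 𝔼 N)‖ ^ 2
    ∂(surface N)) = G at *
  have hC := eigenvalueConst_nonneg (N := N) (R := R)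
  have hm0 := surface_real_univ_pos (N := N)
  rw [stabilityThreshold, lt_div_iff₀ (by linarith)] at hε0
  unfold energy
  generalize (surface N).real univ = m at *
  generalize lambda1 (perturbedBall R h) = l at *
  generalize lambda1 (Metric.ball (0 : 𝔼 N) R) = l0 at *
  generalize eigenvalueConst N R = C at *
  have hr : 0 < R ^ (N - 1) := pow_pos hR _
  have hc : 0 < 1 / (16 * (N : ℝ)) := by positivity
  generalize R ^ (N - 1) = r at *
  generalize 1 / (16 * (N : ℝ)) = c at *
  -- The choice of `ε` makes `ε C G` at most `r c G`. The part `r c Q` of the perimeter gain is left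
  -- over and decides the equality case: it forces `Q ≤ 0`, hence `f = 0` off the origin.
  have hreal : r * m - ε * l0 + r * c * Q ≤ r * (m + c * (Q + G)) - ε * l := by
    have h1 := mul_le_mul_of_nonneg_left hlam hε.le
    have h2 : ε * C * G ≤ r * c * G := mul_le_mul_of_nonneg_right (by nlinarith) hG0
    nlinarith
  -- The comparison runs through two real numbers, so it remains valid if the perimeter of the
  -- perturbed ball is infinite.
  have hup : (perimeter (Metric.ball (0 : 𝔼 N) R) : EReal) - ((ε * l0 : ℝ) : EReal) ≤
      ((r * m - ε * l0 : ℝ) : EReal) := by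
    rw [EReal.coe_sub]
    refine EReal.sub_le_sub ?_ le_rfl
    refine (EReal.coe_ennreal_le_coe_ennreal_iff.2 hPB).trans_eq ?_
    rw [EReal.coe_ennreal_ofReal, max_eq_left (by positivity)]
  have hlow : ((r * (m + c * (Q + G)) - ε * l : ℝ) : EReal) ≤
      (perimeter (perturbedBall R h) : EReal) - ((ε * l : ℝ) : EReal) := by
    rw [EReal.coe_sub]
    refine EReal.sub_le_sub ?_ le_rfl
    refine le_of_eq_of_le ?_ (EReal.coe_ennreal_le_coe_ennreal_iff.2 hP)
    rw [EReal.coe_ennreal_ofReal, max_eq_left (by positivity)]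
  refine ⟨hup.trans (le_trans (EReal.coe_le_coe_iff.2 ?_) hlow), fun heq => hball ?_⟩
  · nlinarith [mul_nonneg (mul_pos hr hc).le hQ0]
  · rw [heq] at hlow
    have h1 := EReal.coe_le_coe_iff.1 (hlow.trans hup)
    have h2 : r * c * Q ≤ 0 := by linarith
    by_contra! hcon
    exact absurd h2 (not_le.2 (mul_pos (mul_pos hr hc) hcon))

end Stability

end BallStability

end

theorem proposition2p4 (N : ℕ) (hN : 2 ≤ N) (R : ℝ) (hR : 0 < R) :
    (∃ C : ℝ, 0 < C ∧
      ∀ h : EuclideanSpace ℝ (Fin N) → ℝ,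
        BallStability.MemW1Inf R h →
        BallStability.normLInf R h ≤ ENNReal.ofReal (1 / 2) →
        volume (BallStability.perturbedBall R h) =
          volume (Metric.ball (0 : EuclideanSpace ℝ (Fin N)) R) →
        BallStability.lambda1 (BallStability.perturbedBall R h) -
            BallStability.lambda1 (Metric.ball (0 : EuclideanSpace ℝ (Fin N)) R) ≤
          C * BallStability.normH1 R h ^ 2) ∧
    (∃ η ε₀ : ℝ, 0 < η ∧ 0 < ε₀ ∧
      ∀ h : EuclideanSpace ℝ (Fin N) → ℝ,
        BallStability.MemW1Inf R h →
        BallStability.normW1Inf R h ≤ ENNReal.ofReal η →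
        volume (BallStability.perturbedBall R h) =
          volume (Metric.ball (0 : EuclideanSpace ℝ (Fin N)) R) →
        BallStability.barycenter (BallStability.perturbedBall R h) = 0 →
        ∀ ε : ℝ, 0 < ε → ε < ε₀ →
          BallStability.energy ε (Metric.ball (0 : EuclideanSpace ℝ (Fin N)) R) ≤
            BallStability.energy ε (BallStability.perturbedBall R h) ∧
          (BallStability.energy ε (BallStability.perturbedBall R h) =
              BallStability.energy ε (Metric.ball (0 : EuclideanSpace ℝ (Fin N)) R) →
            BallStability.perturbedBall R h =
              Metric.ball (0 : EuclideanSpace ℝ (Fin N)) R)) := by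
  have : NeZero N := ⟨by omega⟩
  refine ⟨⟨BallStability.eigenvalueConst N R * (R ^ 2 / R ^ (N - 1)) + 1, ?_, ?_⟩,
    ⟨BallStability.stabilityRadius N R, BallStability.stabilityThreshold N R,
      BallStability.stabilityRadius_pos hR, BallStability.stabilityThreshold_pos hR, ?_⟩⟩
  · have := BallStability.eigenvalueConst_nonneg (N := N) (R := R)
    positivity
  · intro h hh hL hv
    exact BallStability.lambda1_perturbedBall_sub_le_normH1 hN hR hh hL hv
  · intro h hh hW hv hbar ε hε hε0
    exact BallStability.energy_ball_le_energy_perturbedBall hN hR hh hW hv hbar hε hε0
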